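/- Let $Y,Y'$ be Riemann surfaces (Hausdorff one-dimensional complex manifolds, not necessarily connected) and let $\nu:Y\to Y'$ be a finite branched covering, i.e. a proper surjective holomorphic map with finite fibres. Let $f:Y\to\mathbb R\cup\{\pm\infty\}$ be harmonic and real-valued except at a finite set $Pol\subset Y$ of logarithmic singularities: near $p\in Pol$ one has $f=r\log|z|+\tilde f$, where $z$ is a local coordinate centred at $p$, $r\in\mathbb R\setminus\{0\}$ is the residue of $f$ at $p$, and $\tilde f$ is harmonic near $p$; the value of $f$ at $p$ is its limit there ($-\infty$ if $r>0$, $+\infty$ if $r<0$). Let $Pol^-$ (resp. $Pol^+$) be the set of $p\in Pol$ with $r<0$ (resp. $r>0$). The tropical trace of $f$ is $$\nu_*f(z)=\max_{y\in\nu^{-1}(z)}f(y),\qquad z\in Y'.$$ By a real semi-analytic curve in $Y'$ we mean a closed semi-analytic subset of $Y'$ of pure dimension $1$ (possibly empty); semi-analytic means that every point of $Y'$ has a neighbourhood in which the set is a finite union of sets $\{F=0,\,G_1>0,\dots,G_m>0\}$ with $F,G_j$ real analytic. A function is piecewise-harmonic in an open set $W\subset Y'$ if there is a real semi-analytic curve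 $S\subset Y'$ such that the function is harmonic on $W\setminus S$ and the connected components of $W\setminus S$ form a family that is locally finite in $W$. Then: 1. $\nu_*f$ is real-valued, continuous and piecewise-harmonic in the open set $Y'\setminus\nu(Pol)$. 2. $\nu_*f$ is subharmonic in $U=Y'\setminus\nu(Pol^-)$. 3. $\nu_*f$ has at most logarithmic singularities: for every $q\in\nu(Pol)$, with a local coordinate $z$ centred at $q$, there are $\rho\in\mathbb R$ and a continuous real function $h$ defined near $q$ such that $\nu_*f=\rho\log|z|+h$ in a punctured neighbourhood of $q$, and $\nu_*f(q)=\lim_{z\to q}\nu_*f(z)\in\mathbb R\cup\{\pm\infty\}$. 4. $\nu_*f$ is locally integrable on $U$, and the support of its distributional Laplacian in $U$ is contained in the union of a real semi-analytic curve $S\subset Y'$ and a finite set of points $Q\subset\nu(Pol)$. Moreover, $S$ is the union of a locally finite family of connected real semi-analytic curves, and this family is finite if $Y'$ is compact. -/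

import Mathlib

open Set Filter Topology MeasureTheory
open scoped Manifold ContDiff

namespace TropicalTrace

section Surface

variable {X : Type*} [TopologicalSpace X] [ChartedSpace ℂ X]

/-- `g` is real-valued and harmonic in a neighbourhood of `x`, read in the chart at `x`
(harmonicity does not depend on the holomorphic coordinate). -/
def IsHarmonicAt (g : X → EReal) (x : X) : Prop :=
  ∃ h : ℂ → ℝ, InnerProductSpace.HarmonicAt h (chartAt ℂ x x) ∧
    ∀ᶠ y in 𝓝 x, g y = ((h (chartAt ℂ x y) : ℝ) : EReal)

/-- Near `x`, `g = r log |z| + h`, where `z` is the local coordinate centred at `x`, and the value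
of `g` at `x` (possibly `±∞`) is the limit of `g` there. -/
def HasLogExpansionAt (g : X → EReal) (x : X) (r : ℝ) (h : ℂ → ℝ) : Prop :=
  (∀ᶠ y in 𝓝[≠] x, g y =
    ((r * Real.log ‖chartAt ℂ x y - chartAt ℂ x x‖ + h (chartAt ℂ x y) : ℝ) : EReal)) ∧
  ContinuousAt g x

/-- `f` has a logarithmic singularity with residue `r` at `y`: `f = r log |z| + harmonic`. -/
def HasLogSingularityAt (f : X → EReal) (y : X) (r : ℝ) : Prop :=
  ∃ h : ℂ → ℝ, InnerProductSpace.HarmonicAt h (chartAt ℂ y y) ∧ HasLogExpansionAt f y r h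

/-- The logarithmic singularities with negative residue. -/
def polNeg (f : X → EReal) : Set X := {y | ∃ r : ℝ, r < 0 ∧ HasLogSingularityAt f y r}

/-- The logarithmic singularities with positive residue. -/
def polPos (f : X → EReal) : Set X := {y | ∃ r : ℝ, 0 < r ∧ HasLogSingularityAt f y r}

/-- All logarithmic singularities. -/
def pol (f : X → EReal) : Set X := polNeg f ∪ polPos f

/-- `f` is harmonic except at a finite set where it has logarithmic singularities. -/
structure IsHarmonicWithLogPoles (f : X → EReal) : Prop where
  finite_pol : (pol f).Finite
  harmonic : ∀ y, y ∉ pol f → IsHarmonicAt f y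

/-- At most a logarithmic singularity at `x`: up to a real multiple (possibly zero) of `log |z|`,
`g` is continuous near `x`. -/
def HasAtMostLogSingularityAt (g : X → EReal) (x : X) : Prop :=
  ∃ (r : ℝ) (h : ℂ → ℝ), (∀ᶠ w in 𝓝 (chartAt ℂ x x), ContinuousAt h w) ∧
    HasLogExpansionAt g x r h

/-- Semianalytic subsets: every point of `X` has a neighbourhood on which the set is a finite union
of sets of the form `{F = 0, G₁ > 0, …, Gₘ > 0}` with real analytic functions. -/
def IsSemianalytic (S : Set X) : Prop :=
  ∀ x : X, ∃ V : Set ℂ, IsOpen V ∧ chartAt ℂ x x ∈ V ∧ V ⊆ (chartAt ℂ x).target ∧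
    ∃ (n m : ℕ) (F : Fin n → ℂ → ℝ) (G : Fin n → Fin m → ℂ → ℝ),
      (∀ i, AnalyticOnNhd ℝ (F i) V) ∧ (∀ i j, AnalyticOnNhd ℝ (G i j) V) ∧
      ∀ w ∈ V, ((chartAt ℂ x).symm w ∈ S ↔ ∃ i, F i w = 0 ∧ ∀ j, 0 < G i j w)

/-- Semianalytic curves: closed semianalytic sets of pure dimension one. In a surface, a closed
semianalytic set has dimension at most one iff its interior is empty, and has no zero-dimensional
part iff it has no isolated points. -/
structure IsSemianalyticCurve (S : Set X) : Prop where
  semianalytic : IsSemianalytic S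
  perfect : Perfect S
  interior_eq_empty : interior S = ∅

/-- `g` is piecewise harmonic in the open set `W`: there is a semianalytic curve `S` such that `g`
is harmonic on `W \ S`, and the pieces (the connected components of `W \ S`) are locally finite
in `W`. -/
def IsPiecewiseHarmonicOn (g : X → EReal) (W : Set X) : Prop :=
  ∃ S : Set X, IsSemianalyticCurve S ∧ (∀ x ∈ W \ S, IsHarmonicAt g x) ∧
    ∀ x ∈ W, ∃ N ∈ 𝓝 x,
      {C : Set X | (∃ y ∈ W \ S, C = connectedComponentIn (W \ S) y) ∧ (C ∩ N).Nonempty}.Finite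

/-- Subharmonic functions on an open set `U`: upper semicontinuous with values in `[-∞, ∞)`, not
identically `-∞` on any connected component, and below every harmonic function on a closed
coordinate disc which dominates them on the boundary circle. -/
structure IsSubharmonicOn (u : X → EReal) (U : Set X) : Prop where
  upperSemicontinuous : UpperSemicontinuousOn u U
  lt_top : ∀ x ∈ U, u x < ⊤
  ne_bot : ∀ x ∈ U, ∃ y ∈ connectedComponentIn U x, u y ≠ ⊥
  le_harmonic : ∀ e ∈ IsManifold.maximalAtlas 𝓘(ℂ) ω X, ∀ (c : ℂ) (R : ℝ), 0 < R →
    Metric.closedBall c R ⊆ e.target → e.symm '' Metric.closedBall c R ⊆ U →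
    ∀ h : ℂ → ℝ, ContinuousOn h (Metric.closedBall c R) →
      InnerProductSpace.HarmonicOnNhd h (Metric.ball c R) →
      (∀ w ∈ Metric.sphere c R, u (e.symm w) ≤ (h w : EReal)) →
      ∀ w ∈ Metric.ball c R, u (e.symm w) ≤ (h w : EReal)

/-- `g` is locally integrable on the open set `U`, read in charts. -/
def IsLocallyIntegrableOn (g : X → EReal) (U : Set X) : Prop :=
  ∀ x : X, LocallyIntegrableOn (fun w : ℂ => (g ((chartAt ℂ x).symm w)).toReal)
    ((chartAt ℂ x).target ∩ (chartAt ℂ x).symm ⁻¹' U) volume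

/-- The distributional Laplacian of `g` in the chart at `x`, evaluated at a test function `ψ`. -/
noncomputable def laplacianPairing (g : X → EReal) (x : X) (ψ : ℂ → ℝ) : ℝ :=
  ∫ w : ℂ, (g ((chartAt ℂ x).symm w)).toReal * Laplacian.laplacian ψ w

/-- The support of the distributional Laplacian of `g`: `x` is not in it iff the Laplacian vanishes
on all test functions supported in some neighbourhood of `x`. The vanishing of the Laplacian does
not depend on the holomorphic coordinate. -/
def laplacianSupport (g : X → EReal) : Set X :=
  {x | ¬ ∃ V : Set ℂ, IsOpen V ∧ chartAt ℂ x x ∈ V ∧ V ⊆ (chartAt ℂ x).target ∧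
    ∀ ψ : ℂ → ℝ, ContDiff ℝ ∞ ψ → HasCompactSupport ψ → tsupport ψ ⊆ V →
      laplacianPairing g x ψ = 0}

end Surface

section Covering

variable {Y Y' : Type*} [TopologicalSpace Y] [ChartedSpace ℂ Y]
  [TopologicalSpace Y'] [ChartedSpace ℂ Y']

/-- Finite branched coverings of Riemann surfaces: proper surjective holomorphic maps with finite
fibres. -/
structure IsBranchedCovering (ν : Y → Y') : Prop where
  holomorphic : MDifferentiable 𝓘(ℂ) 𝓘(ℂ) ν
  proper : IsProperMap ν
  surjective : Function.Surjective ν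
  finite_fiber : ∀ z, (ν ⁻¹' {z}).Finite

/-- The tropical trace: the maximum of `f` over the fibre (fibres of a branched covering are finite
and non-empty, so the supremum is a maximum). -/
noncomputable def tropicalTrace (ν : Y → Y') (f : Y → EReal) (z : Y') : EReal :=
  ⨆ y ∈ ν ⁻¹' {z}, f y

end Covering

end TropicalTrace

open TropicalTrace

/-! Locally on the base the trace is a maximum of finitely many explicit functions. Near `q`, each
point `y` of the fibre has a coordinate `t` in which `ν` is `t ^ k`. If `m` is a common multiple of
these exponents, the substitution `z = ξ ^ m` makes all branches single-valued: they are `t = ζ ^ l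
* ξ ^ (m / k)` with `ζ` a primitive `k`-th root of unity. Since `ν` is closed, fibres over points
near `q` contain nothing else. Hence the pullback of the trace is a maximum of functions `ρ j * log
‖ξ‖ + H j ξ` with `H j` harmonic at `0` (`exists_branch`, `exists_isLocalModel`). The coefficients
vanish off the image of the poles and are nonnegative off the image of the poles of negative
residue.

Continuity and the logarithmic singularities are read off from this model: near `0` the smallest `ρ
j` wins. Subharmonicity is the maximum principle: if the trace touches a harmonic function `k` from
below at `q`, a term attaining the value at `q` has `ρ j = 0` and lies below `k`, so it coincides
with `k`, and so does the trace (`eventually_eq_of_le`). A clopen argument turns this local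
principle into domination on discs. Local integrability follows from `|log t| ≤ 1 / t` near `0`.

For the curve, a difference of two terms with equal `ρ` is harmonic, and in polar coordinates the
zero set of a nonzero harmonic germ is a finite union of arcs `θ = β r` with `β` analytic, by the
implicit function theorem (`exists_arcs_of_harmonicAt`). Along such an arc the set of maximal terms
is eventually constant, so near `q` the trace fails to be harmonic exactly on finitely many arcs
(`exists_arcs_maxLogHarm`). The map `ξ ^ m` sends them to Puiseux arcs `θ = β (r ^ (1 / m))`. These
are semianalytic: a Puiseux series is a root of a monic polynomial with analytic coefficients, and
by Thom's lemma it is singled out by the signs of the derivatives of that polynomial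
(`exists_sign_description`, `isSemianalyticGerm_arcSet`).

The curve `S` is the derived set of the non-harmonic locus. Passing to the derived set discards
isolated points, which can only be images of poles: elsewhere an isolated non-harmonic point is
removable (`isHarmonicAt_of_isolated`). The arc description makes the components of `S` open in `S`,
hence locally finite, and cuts small punctured discs into finitely many sectors, which bounds the
pieces of the complement. Finally, Green's identity shows that the distributional Laplacian vanishes
wherever the trace is harmonic. -/

namespace TropicalTrace

open InnerProductSpace

/-! ### Thom's lemma and Puiseux roots -/

/-- If all derivatives of a real polynomial have the same signs at the two ends of an interval,
then the polynomial has constant sign on the interval. -/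
theorem sign_eval_eq_of_mem_Icc (n : ℕ) : ∀ p : Polynomial ℝ, p.natDegree ≤ n → ∀ a b : ℝ,
    (∀ k, SignType.sign ((Polynomial.derivative^[k] p).eval a) =
      SignType.sign ((Polynomial.derivative^[k] p).eval b)) →
    ∀ t ∈ Icc a b, SignType.sign (p.eval t) = SignType.sign (p.eval a) := by
  induction n with
  | zero =>
    intro p hp a b _ t _
    rw [Polynomial.eq_C_of_natDegree_le_zero hp]
    simp
  | succ n ih =>
    intro p hp a b hs t ht
    have hab : a ≤ b := ht.1.trans ht.2
    have hd : (Polynomial.derivative p).natDegree ≤ n :=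
      (Polynomial.natDegree_derivative_le p).trans (by omega)
    have hder := ih (Polynomial.derivative p) hd a b fun k => by
      simpa [Function.iterate_succ_apply] using hs (k + 1)
    have hcont : ContinuousOn (fun x => p.eval x) (Icc a b) := p.continuous.continuousOn
    have hs0 : SignType.sign (p.eval a) = SignType.sign (p.eval b) := by simpa using hs 0
    have ha : a ∈ Icc a b := left_mem_Icc.2 hab
    have hb : b ∈ Icc a b := right_mem_Icc.2 hab
    -- By induction the derivative has constant sign, so `p` is monotone on the interval and its
    -- value at `t` lies between two end values of equal sign.
    rcases le_total 0 ((Polynomial.derivative p).eval a) with h0 | h0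
    · have hm : MonotoneOn (fun x => p.eval x) (Icc a b) := by
        refine monotoneOn_of_deriv_nonneg (convex_Icc a b) hcont
          p.differentiable.differentiableOn fun x hx => ?_
        rw [interior_Icc] at hx
        rw [Polynomial.deriv, ← sign_nonneg_iff, hder x (Ioo_subset_Icc_self hx), sign_nonneg_iff]
        exact h0
      refine le_antisymm ?_ (SignType.sign.monotone (hm ha ht ht.1))
      rw [hs0]
      exact SignType.sign.monotone (hm ht hb ht.2)
    · have hm : AntitoneOn (fun x => p.eval x) (Icc a b) := by
        refine antitoneOn_of_deriv_nonpos (convex_Icc a b) hcont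
          p.differentiable.differentiableOn fun x hx => ?_
        rw [interior_Icc] at hx
        rw [Polynomial.deriv, ← sign_nonpos_iff, hder x (Ioo_subset_Icc_self hx), sign_nonpos_iff]
        exact h0
      refine le_antisymm (SignType.sign.monotone (hm ha ht ht.1)) ?_
      rw [hs0]
      exact SignType.sign.monotone (hm ht hb ht.2)

/-- Thom's lemma: a root of a real polynomial is determined by the signs of the derivatives. -/
theorem eq_of_sign_derivative_eq {p : Polynomial ℝ} (hp : p ≠ 0) {a b : ℝ} (ha : p.eval a = 0)
    (hs : ∀ k ≤ p.natDegree, SignType.sign ((Polynomial.derivative^[k] p).eval a) =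
      SignType.sign ((Polynomial.derivative^[k] p).eval b)) : a = b := by
  have hs' : ∀ k, SignType.sign ((Polynomial.derivative^[k] p).eval a) =
      SignType.sign ((Polynomial.derivative^[k] p).eval b) := fun k => by
    rcases le_or_gt k p.natDegree with h | h
    · exact hs k h
    · simp [Polynomial.iterate_derivative_eq_zero h]
  have key : ∀ a b : ℝ, a < b → p.eval a = 0 →
      (∀ k, SignType.sign ((Polynomial.derivative^[k] p).eval a) =
      SignType.sign ((Polynomial.derivative^[k] p).eval b)) → False := by
    intro a b hab ha hs
    refine hp (Polynomial.eq_zero_of_infinite_isRoot p ((Icc_infinite hab).mono fun t ht => ?_))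
    have := sign_eval_eq_of_mem_Icc _ p le_rfl a b hs t ht
    rw [ha, sign_zero, sign_eq_zero_iff] at this
    exact this
  have hb : p.eval b = 0 := by
    have := hs' 0
    simp only [Function.iterate_zero, id_eq, ha, sign_zero] at this
    exact sign_eq_zero_iff.1 this.symm
  rcases lt_trichotomy a b with h | h | h
  · exact (key a b h ha hs').elim
  · exact h
  · exact (key b a h hb fun k => (hs' k).symm).elim

/-- The sign of a real analytic function is constant to the right of a point. -/
theorem exists_eventually_sign_eq {φ : ℝ → ℝ} (hφ : AnalyticAt ℝ φ 0) :
    ∃ σ : SignType, ∀ᶠ s in 𝓝[>] (0 : ℝ), SignType.sign (φ s) = σ := by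
  by_cases h0 : ∀ᶠ s in 𝓝 (0 : ℝ), φ s = 0
  · exact ⟨0, (h0.filter_mono nhdsWithin_le_nhds).mono fun s hs => by simp [hs]⟩
  -- A nonzero germ is `s ^ n * g s` with `g 0 ≠ 0`, and `s ^ n` is positive to the right of the
  -- origin.
  · obtain ⟨n, g, hg, hg0, hev⟩ := hφ.exists_eventuallyEq_pow_smul_nonzero_iff.2 h0
    have hsign : ∀ᶠ s in 𝓝 (0 : ℝ), SignType.sign (g s) = SignType.sign (g 0) := by
      rcases hg0.lt_or_gt with h | h
      · filter_upwards [hg.continuousAt.eventually_lt continuousAt_const h] with s hs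
        rw [sign_neg hs, sign_neg h]
      · filter_upwards [continuousAt_const.eventually_lt hg.continuousAt h] with s hs
        rw [sign_pos hs, sign_pos h]
    refine ⟨SignType.sign (g 0), ?_⟩
    filter_upwards [nhdsWithin_le_nhds hev, nhdsWithin_le_nhds hsign, self_mem_nhdsWithin]
      with s h1 h2 h3
    rw [h1, sub_zero, smul_eq_mul, sign_mul, sign_pow, sign_pos (show (0 : ℝ) < s from h3), one_pow,
      one_mul, h2]

/-- Splitting a power series according to residue classes of the exponents. -/
theorem exists_analyticAt_residue_split (M : ℕ) [NeZero M] {b : ℝ → ℝ} (hb : AnalyticAt ℝ b 0) :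
    ∃ B : ZMod M → ℝ → ℝ, (∀ j, AnalyticAt ℝ (B j) 0) ∧
      ∀ᶠ s in 𝓝 (0 : ℝ), b s = ∑ j : ZMod M, s ^ j.val * B j (s ^ M) := by
  obtain ⟨p, r, hp⟩ := hb
  obtain ⟨ρ, hρ0, hρr⟩ := ENNReal.lt_iff_exists_nnreal_btwn.1 hp.r_pos
  have hρ : 0 < ρ := by exact_mod_cast hρ0
  obtain ⟨C, hC0, hC⟩ := p.norm_mul_pow_le_of_lt_radius (hρr.trans_le hp.r_le)
  -- The bound on the `n`-th coefficient times `ρ ^ n` gives, along the exponents `j + M * n`, a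
  -- radius of convergence of at least `ρ ^ M`.
  set q : ZMod M → FormalMultilinearSeries ℝ ℝ ℝ := fun j =>
    FormalMultilinearSeries.ofScalars ℝ fun n => p.coeff (j.val + M * n) with hq
  have hrad : ∀ j, ((ρ ^ M : NNReal) : ENNReal) ≤ (q j).radius := fun j => by
    refine (q j).le_radius_of_bound (C / ρ ^ j.val) fun n => ?_
    rw [le_div_iff₀ (by positivity)]
    refine le_trans (le_of_eq ?_) (hC (j.val + M * n))
    simp only [hq, NNReal.coe_pow, FormalMultilinearSeries.norm_apply_eq_norm_coef,
      FormalMultilinearSeries.coeff_ofScalars]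
    ring
  have hq_ball : ∀ j, HasFPowerSeriesOnBall (q j).sum (q j) 0 (q j).radius := fun j =>
    (q j).hasFPowerSeriesOnBall
      (lt_of_lt_of_le (by exact_mod_cast pow_pos hρ M) (hrad j))
  refine ⟨fun j => (q j).sum, fun j => (hq_ball j).analyticAt, ?_⟩
  have hball : ∀ᶠ s in 𝓝 (0 : ℝ), |s| < (ρ : ℝ) := by
    have := Metric.ball_mem_nhds (0 : ℝ) (show (0 : ℝ) < ρ by exact_mod_cast hρ)
    filter_upwards [this] with s hs
    simpa using hs
  filter_upwards [hball] with s hs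
  have hs' : s ∈ Metric.eball (0 : ℝ) r := by
    rw [Metric.mem_eball, edist_zero_right]
    refine lt_trans ?_ hρr
    rw [← ofReal_norm, ENNReal.ofReal_lt_coe_iff (norm_nonneg _)]
    simpa using hs
  have hsum := hp.hasSum hs'
  simp only [zero_add] at hsum
  have hsum' : HasSum (fun n => p.coeff n * s ^ n) (b s) := by
    refine hsum.congr_fun fun n => ?_
    rw [FormalMultilinearSeries.apply_eq_pow_smul_coeff, smul_eq_mul, mul_comm]
  rw [← hsum'.tsum_eq, Nat.sumByResidueClasses hsum'.summable M]
  refine Finset.sum_congr rfl fun j _ => ?_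
  rw [FormalMultilinearSeries.sum, ← tsum_mul_left]
  refine tsum_congr fun n => ?_
  rw [FormalMultilinearSeries.apply_eq_pow_smul_coeff, FormalMultilinearSeries.coeff_ofScalars,
    smul_eq_mul]
  ring

/-- Functions on the line which are analytic at the origin. -/
def analyticSubring : Subring (ℝ → ℝ) where
  carrier := {g | AnalyticAt ℝ g 0}
  mul_mem' := fun h₁ h₂ => AnalyticAt.mul h₁ h₂
  add_mem' := fun h₁ h₂ => AnalyticAt.add h₁ h₂
  one_mem' := analyticAt_const
  zero_mem' := analyticAt_const
  neg_mem' := fun h => AnalyticAt.neg h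

/-- Substitution of `s ^ M`. -/
def powSubst (M : ℕ) [NeZero M] : analyticSubring →+* analyticSubring where
  toFun g := ⟨fun s => g.1 (s ^ M), AnalyticAt.fun_comp (f := fun s : ℝ => s ^ M)
    (by rw [zero_pow (NeZero.ne M)]; exact g.2) (analyticAt_id.pow M)⟩
  map_one' := rfl
  map_mul' _ _ := rfl
  map_zero' := rfl
  map_add' _ _ := rfl

/-- Evaluation at a point. -/
def evalAt (v : ℝ) : analyticSubring →+* ℝ := (Pi.evalRingHom (fun _ : ℝ => ℝ) v).comp
  analyticSubring.subtype

theorem evalAt_apply (v : ℝ) (g : analyticSubring) : evalAt v g = g.1 v := rfl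

theorem evalAt_powSubst (M : ℕ) [NeZero M] (s : ℝ) :
    (evalAt s).comp (powSubst M) = evalAt (s ^ M) := rfl

/-- A convergent Puiseux series is singled out by sign conditions on finitely many polynomials with
analytic coefficients. -/
theorem exists_sign_description (M : ℕ) [NeZero M] {b : ℝ → ℝ} (hb : AnalyticAt ℝ b 0) :
    ∃ (N : ℕ) (D : Fin (N + 1) → Polynomial analyticSubring) (σ : Fin (N + 1) → SignType),
      (∀ k, (D k).natDegree ≤ N) ∧
      ∀ᶠ s in 𝓝[>] (0 : ℝ), ∀ t : ℝ, t = b s ↔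
        ∀ k, SignType.sign (((D k).map (evalAt (s ^ M))).eval t) = σ k := by
  obtain ⟨B, hB, hbB⟩ := exists_analyticAt_residue_split M hb
  set X : analyticSubring := ⟨fun s => s, analyticAt_id⟩
  set b' : analyticSubring := ∑ j : ZMod M, X ^ j.val * powSubst M ⟨B j, hB j⟩ with hb'
  -- The function `s` is integral over the functions of `s ^ M`, being a root of `T ^ M - s ^ M`;
  -- hence so is every combination of its powers with coefficients analytic in `s ^ M`.
  have hint : (powSubst M).IsIntegralElem b' := by
    let := (powSubst M).toAlgebra
    change IsIntegral analyticSubring b'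
    refine IsIntegral.sum _ fun j _ => ((?_ : IsIntegral _ X).pow _).mul isIntegral_algebraMap
    refine IsIntegral.of_pow (NeZero.pos M) ?_
    have : X ^ M = algebraMap analyticSubring analyticSubring X := rfl
    rw [this]
    exact isIntegral_algebraMap
  obtain ⟨P, hP, hroot⟩ := hint
  have heval : ∀ s, b'.1 s = ∑ j : ZMod M, s ^ j.val * B j (s ^ M) := fun s => by
    rw [← evalAt_apply, hb', map_sum]
    rfl
  have hroot' : ∀ s, (P.map (evalAt (s ^ M))).eval (b'.1 s) = 0 := fun s => by
    have := congrArg (evalAt s) hroot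
    rwa [Polynomial.hom_eval₂, map_zero, evalAt_powSubst, evalAt_apply,
      ← Polynomial.eval_map] at this
  set N := P.natDegree
  set D : Fin (N + 1) → Polynomial analyticSubring := fun k => Polynomial.derivative^[k] P
  -- Each derivative of `P`, evaluated along the root, is an analytic function of `s`, so its sign
  -- stabilizes; these limits are the prescribed signs `σ`.
  have han : ∀ k, ∃ σ : SignType, ∀ᶠ s in 𝓝[>] (0 : ℝ),
      SignType.sign (((D k).map (evalAt (s ^ M))).eval (b'.1 s)) = σ := fun k => by
    refine exists_eventually_sign_eq (φ := fun s => ((D k).map (evalAt (s ^ M))).eval (b'.1 s)) ?_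
    have h : AnalyticAt ℝ (Polynomial.eval₂ (powSubst M) b' (D k)).1 0 :=
      (Polynomial.eval₂ (powSubst M) b' (D k)).2
    refine h.congr (Eventually.of_forall fun s => ?_)
    change evalAt s _ = _
    rw [Polynomial.hom_eval₂, evalAt_powSubst, evalAt_apply, ← Polynomial.eval_map]
  choose σ hσ using han
  refine ⟨N, D, σ, fun k => (Polynomial.natDegree_iterate_derivative P k).trans
    (Nat.sub_le _ _), ?_⟩
  filter_upwards [nhdsWithin_le_nhds hbB, eventually_all.2 hσ] with s hs hsσ t
  have hbs : b s = b'.1 s := by rw [hs, heval]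
  rw [hbs]
  refine ⟨fun h => h ▸ hsσ, fun h => ?_⟩
  -- Monicity keeps the specialized polynomial nonzero for every `s`, as Thom's lemma requires.
  have hmonic : (P.map (evalAt (s ^ M))).Monic := hP.map _
  refine (eq_of_sign_derivative_eq hmonic.ne_zero (hroot' s) fun k hk => ?_).symm
  have hk' : k < N + 1 := by
    have := Polynomial.natDegree_map_le (f := evalAt (s ^ M)) (p := P)
    omega
  rw [Polynomial.iterate_derivative_map]
  exact (hsσ ⟨k, hk'⟩).trans (h ⟨k, hk'⟩).symm

/-! ### Semianalytic germs -/

/-- The germ at `c` of a subset of the plane is semianalytic. -/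
def IsSemianalyticGerm (T : Set ℂ) (c : ℂ) : Prop :=
  ∃ (ι κ : Type) (_ : Finite ι) (_ : Finite κ) (F : ι → ℂ → ℝ) (G : ι → κ → ℂ → ℝ),
    (∀ i, AnalyticAt ℝ (F i) c) ∧ (∀ i j, AnalyticAt ℝ (G i j) c) ∧
    ∀ᶠ w in 𝓝 c, (w ∈ T ↔ ∃ i, F i w = 0 ∧ ∀ j, 0 < G i j w)

theorem IsSemianalyticGerm.congr {T T' : Set ℂ} {c : ℂ} (h : IsSemianalyticGerm T c)
    (hT : ∀ᶠ w in 𝓝 c, (w ∈ T' ↔ w ∈ T)) : IsSemianalyticGerm T' c := by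
  obtain ⟨ι, κ, _, _, F, G, hF, hG, hev⟩ := h
  refine ⟨ι, κ, ‹_›, ‹_›, F, G, hF, hG, ?_⟩
  filter_upwards [hev, hT] with w h1 h2
  rw [h2, h1]

theorem isSemianalyticGerm_empty (c : ℂ) : IsSemianalyticGerm ∅ c :=
  ⟨Empty, Empty, inferInstance, inferInstance, fun i => i.elim, fun i => i.elim,
    fun i => i.elim, fun i => i.elim, by simp⟩

theorem IsSemianalyticGerm.union {T T' : Set ℂ} {c : ℂ} (h : IsSemianalyticGerm T c)
    (h' : IsSemianalyticGerm T' c) : IsSemianalyticGerm (T ∪ T') c := by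
  obtain ⟨ι, κ, _, _, F, G, hF, hG, hev⟩ := h
  obtain ⟨ι', κ', _, _, F', G', hF', hG', hev'⟩ := h'
  refine ⟨ι ⊕ ι', κ ⊕ κ', inferInstance, inferInstance, Sum.elim F F',
    Sum.elim (fun i => Sum.elim (G i) fun _ _ => 1) (fun i => Sum.elim (fun _ _ => 1) (G' i)),
    ?_, ?_, ?_⟩
  · rintro (i | i)
    exacts [hF i, hF' i]
  · rintro (i | i) (j | j)
    exacts [hG i j, analyticAt_const, analyticAt_const, hG' i j]
  · filter_upwards [hev, hev'] with w h1 h2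
    simp [h1, h2]

theorem isSemianalyticGerm_biUnion {α : Type*} (s : Finset α) {T : α → Set ℂ} {c : ℂ}
    (h : ∀ a ∈ s, IsSemianalyticGerm (T a) c) : IsSemianalyticGerm (⋃ a ∈ s, T a) c := by
  classical
  induction s using Finset.induction_on with
  | empty => simpa using isSemianalyticGerm_empty c
  | insert a s _ ih =>
    rw [Finset.set_biUnion_insert]
    exact (h a (by simp)).union (ih fun b hb => h b (by simp [hb]))

theorem IsSemianalyticGerm.preimage {T : Set ℂ} {c : ℂ} {φ : ℂ → ℂ}
    (h : IsSemianalyticGerm T (φ c)) (hφ : AnalyticAt ℝ φ c) :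
    IsSemianalyticGerm (φ ⁻¹' T) c := by
  obtain ⟨ι, κ, _, _, F, G, hF, hG, hev⟩ := h
  exact ⟨ι, κ, ‹_›, ‹_›, fun i => F i ∘ φ, fun i j => G i j ∘ φ, fun i => (hF i).comp hφ,
    fun i j => (hG i j).comp hφ, hφ.continuousAt.eventually hev⟩

/-- The required equalities are merged into one sum of squares, and the required strict inequalities
are normalized by multiplying with the sign. The slots left over are filled with `0` in the sum and
with `1` among the positive functions. -/
theorem isSemianalyticGerm_sign {K : Type} [Fintype K] {Φ : K → ℂ → ℝ} {σ : K → SignType} {c : ℂ}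
    (hΦ : ∀ k, AnalyticAt ℝ (Φ k) c) :
    IsSemianalyticGerm {w | ∀ k, SignType.sign (Φ k w) = σ k} c := by
  classical
  refine ⟨Unit, K, inferInstance, inferInstance,
    fun _ w => ∑ k, if σ k = 0 then (Φ k w) ^ 2 else 0,
    fun _ k w => if σ k = 0 then 1 else (σ k : ℝ) * Φ k w, fun _ => ?_, fun _ k => ?_, ?_⟩
  · refine Finset.analyticAt_fun_sum _ fun k _ => ?_
    split_ifs
    exacts [(hΦ k).pow 2, analyticAt_const]
  · dsimp only
    split_ifs
    exacts [analyticAt_const, analyticAt_const.mul (hΦ k)]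
  · refine Eventually.of_forall fun w => ?_
    have hsum : (∑ k, if σ k = 0 then (Φ k w) ^ 2 else 0) = 0 ↔ ∀ k, σ k = 0 → Φ k w = 0 := by
      rw [Finset.sum_eq_zero_iff_of_nonneg fun k _ => by split_ifs <;> positivity]
      simp
    simp only [exists_const, hsum, mem_ofPred_eq, ← forall_and]
    refine forall_congr' fun k => ?_
    rcases hk : σ k with _ | _ | _
    · simp
    · simpa using sign_eq_neg_one_iff
    · simpa using sign_eq_one_iff

theorem isSemianalyticGerm_singleton (c : ℂ) : IsSemianalyticGerm {c} c := by
  refine (isSemianalyticGerm_sign (K := Fin 2) (σ := fun _ => 0)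
    (Φ := ![fun w => (w - c).re, fun w => (w - c).im]) ?_).congr (Eventually.of_forall fun w => ?_)
  · intro k
    have h : AnalyticAt ℝ (fun w : ℂ => w - c) c := by fun_prop
    fin_cases k
    · exact (Complex.reCLM.analyticAt _).comp h
    · exact (Complex.imCLM.analyticAt _).comp h
  · simp only [mem_singleton_iff, mem_ofPred_eq, sign_eq_zero_iff]
    simp [Fin.forall_fin_two, Complex.ext_iff, sub_eq_zero]

/-! ### Arcs -/

/-- The arc `θ = β (r ^ (1 / m))` in polar coordinates, without its end point. -/
def arcSet (m : ℕ) (β : ℝ → ℝ) : Set ℂ :=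
  {z | z ≠ 0 ∧ z = ‖z‖ * Complex.exp (β (‖z‖ ^ (1 / m : ℝ)) * Complex.I)}

theorem tendsto_norm_rpow {m : ℕ} (hm : m ≠ 0) :
    Tendsto (fun z : ℂ => ‖z‖ ^ (1 / m : ℝ)) (𝓝[≠] 0) (𝓝[>] 0) := by
  refine tendsto_nhdsWithin_iff.2 ⟨?_, ?_⟩
  · have hc : Continuous fun z : ℂ => ‖z‖ ^ (1 / m : ℝ) :=
      continuous_norm.rpow_const fun _ => Or.inr (by positivity)
    have h0 : ‖(0 : ℂ)‖ ^ (1 / m : ℝ) = 0 := by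
      rw [norm_zero, Real.zero_rpow (by positivity)]
    have := hc.tendsto 0
    rw [h0] at this
    exact this.mono_left nhdsWithin_le_nhds
  · filter_upwards [self_mem_nhdsWithin] with z hz
    exact Real.rpow_pos_of_pos (norm_pos_iff.2 hz) _

theorem norm_rpow_pow {m : ℕ} (hm : m ≠ 0) (z : ℂ) : (‖z‖ ^ (1 / m : ℝ)) ^ m = ‖z‖ := by
  rw [one_div, Real.rpow_inv_natCast_pow (norm_nonneg z) hm]

/-- In the right half plane the argument is determined by its tangent, so the transcendental
equation of the arc becomes an equation for the slope `y / x`. -/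
theorem mem_arcSet_iff_of_abs_lt {m : ℕ} {β : ℝ → ℝ} {z : ℂ} (hz : z ≠ 0)
    (hβ : |β (‖z‖ ^ (1 / m : ℝ))| < Real.pi / 2) :
    z ∈ arcSet m β ↔ 0 < z.re ∧ z.im / z.re = Real.tan (β (‖z‖ ^ (1 / m : ℝ))) := by
  set θ := β (‖z‖ ^ (1 / m : ℝ)) with hθ
  have hθ' := abs_lt.1 hβ
  have hn : 0 < ‖z‖ := norm_pos_iff.2 hz
  constructor
  · rintro ⟨-, h⟩
    rw [← hθ] at h
    have hre : z.re = ‖z‖ * Real.cos θ := by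
      conv_lhs => rw [h]
      simp [Complex.exp_ofReal_mul_I_re]
    have him : z.im = ‖z‖ * Real.sin θ := by
      conv_lhs => rw [h]
      simp [Complex.exp_ofReal_mul_I_im]
    have hcos : 0 < Real.cos θ := Real.cos_pos_of_mem_Ioo ⟨by linarith, hθ'.2⟩
    refine ⟨by rw [hre]; positivity, ?_⟩
    rw [him, hre, Real.tan_eq_sin_div_cos, mul_div_mul_left _ _ hn.ne']
  · rintro ⟨hre, h⟩
    have harg : |Complex.arg z| < Real.pi / 2 :=
      Complex.abs_arg_lt_pi_div_two_iff.2 (Or.inl hre)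
    have harg' := abs_lt.1 harg
    rw [← Complex.tan_arg] at h
    have : Complex.arg z = θ := Real.injOn_tan ⟨by linarith, harg'.2⟩ ⟨by linarith, hθ'.2⟩ h
    refine ⟨hz, ?_⟩
    rw [← hθ, ← this, Complex.norm_mul_exp_arg_mul_I]

/-- With `s = ‖z‖ ^ (1 / m)` the arc is `y / x = tan (β s)` in `x > 0`. The sign description is
applied with exponent `2 * m`, because `s ^ (2 * m) = ‖z‖ ^ 2` is analytic at the origin whereas
`‖z‖` is not. Multiplying the polynomials in `y / x` by the positive factor `x ^ N` clears
denominators without changing signs. -/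
theorem isSemianalyticGerm_arcSet_of_zero {m : ℕ} (hm : m ≠ 0) {β : ℝ → ℝ} (hβ : AnalyticAt ℝ β 0)
    (h0 : β 0 = 0) : IsSemianalyticGerm (arcSet m β) 0 := by
  have : NeZero (2 * m) := ⟨by omega⟩
  have hb : AnalyticAt ℝ (fun s => Real.tan (β s)) 0 := by
    have hcos : Real.cos (β 0) ≠ 0 := by simp [h0]
    have h1 : AnalyticAt ℝ (fun s => Real.sin (β s) / Real.cos (β s)) 0 :=
      (Real.analyticAt_sin.comp hβ).div (Real.analyticAt_cos.comp hβ) hcos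
    simpa only [Real.tan_eq_sin_div_cos] using h1
  obtain ⟨N, D, σ, hdeg, hD⟩ := exists_sign_description (2 * m) hb
  set Φ : Option (Fin (N + 1)) → ℂ → ℝ := fun k => k.elim (fun z => z.re) fun k z =>
    ∑ i ∈ Finset.range (N + 1),
      ((D k).coeff i).1 (Complex.normSq z) * z.re ^ (N - i) * z.im ^ i with hΦ
  have hre : AnalyticAt ℝ (fun z : ℂ => z.re) 0 := Complex.reCLM.analyticAt _
  have him : AnalyticAt ℝ (fun z : ℂ => z.im) 0 := Complex.imCLM.analyticAt _
  have hnsq : AnalyticAt ℝ (fun z : ℂ => Complex.normSq z) 0 := by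
    simp only [Complex.normSq_apply]
    exact (hre.mul hre).add (him.mul him)
  refine (isSemianalyticGerm_sign (Φ := Φ) (σ := fun k => k.elim 1 σ) ?_).congr ?_
  · rintro (_ | k)
    · exact hre
    · refine Finset.analyticAt_fun_sum _ fun i _ => (AnalyticAt.mul ?_ (hre.pow _)).mul (him.pow _)
      refine AnalyticAt.fun_comp (f := fun z : ℂ => Complex.normSq z) ?_ hnsq
      rw [map_zero]
      exact ((D k).coeff i).2
  have hβs : ∀ᶠ s in 𝓝[>] (0 : ℝ), |β s| < Real.pi / 2 := by
    refine nhdsWithin_le_nhds (hβ.continuousAt.abs.eventually_lt continuousAt_const ?_)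
    rw [h0, abs_zero]
    positivity
  have hev := (tendsto_norm_rpow hm).eventually (hD.and hβs)
  rw [eventually_nhdsWithin_iff] at hev
  filter_upwards [hev] with z hz
  rcases eq_or_ne z 0 with rfl | hz0
  · simp only [arcSet, ne_eq, mem_ofPred_eq, not_true_eq_false, false_and, false_iff]
    intro h
    simpa [hΦ] using h none
  obtain ⟨hz1, hz2⟩ := hz hz0
  rw [mem_arcSet_iff_of_abs_lt hz0 hz2, hz1]
  have hs : (‖z‖ ^ (1 / m : ℝ)) ^ (2 * m) = Complex.normSq z := by
    rw [mul_comm, pow_mul, norm_rpow_pow hm, Complex.normSq_eq_norm_sq]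
  rw [hs, Option.forall]
  simp only [Option.elim_none, Option.elim_some, hΦ, sign_eq_one_iff]
  refine and_congr_right fun hx => forall_congr' fun k => ?_
  have : ∑ i ∈ Finset.range (N + 1),
      ((D k).coeff i).1 (Complex.normSq z) * z.re ^ (N - i) * z.im ^ i =
      z.re ^ N * ((D k).map (evalAt (Complex.normSq z))).eval (z.im / z.re) := by
    rw [Polynomial.eval_eq_sum_range' (n := N + 1)
      (Nat.lt_succ_of_le (Polynomial.natDegree_map_le.trans (hdeg k))), Finset.mul_sum]
    refine Finset.sum_congr rfl fun i hi => ?_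
    have hi' : i ≤ N := by simpa [Nat.lt_succ_iff] using hi
    rw [Polynomial.coeff_map, evalAt_apply, div_pow, ← Nat.sub_add_cancel hi', pow_add,
      Nat.add_sub_cancel]
    field_simp
  rw [this, sign_mul, sign_pos (pow_pos hx N), one_mul]

/-- Arcs are semianalytic at their end point. -/
theorem isSemianalyticGerm_arcSet {m : ℕ} (hm : m ≠ 0) {β : ℝ → ℝ} (hβ : AnalyticAt ℝ β 0) :
    IsSemianalyticGerm (arcSet m β) 0 := by
  -- A rotation by the angle `β 0` reduces to an arc tangent to the positive real axis.
  set a : ℂ := Complex.exp (β 0 * Complex.I) with ha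
  have ha0 : a ≠ 0 := Complex.exp_ne_zero _
  have hna : ‖a‖ = 1 := Complex.norm_exp_ofReal_mul_I _
  have h := isSemianalyticGerm_arcSet_of_zero hm (β := fun s => β s - β 0)
    (hβ.sub analyticAt_const) (sub_self _)
  have h' : IsSemianalyticGerm (arcSet m fun s => β s - β 0) ((fun z => a⁻¹ * z) 0) := by
    simpa using h
  have hφ : AnalyticAt ℝ (fun z : ℂ => a⁻¹ * z) 0 := by fun_prop
  refine (h'.preimage hφ).congr (Eventually.of_forall fun z => ?_)
  simp only [arcSet, mem_preimage, mem_ofPred_eq, norm_mul, norm_inv, hna, inv_one, one_mul]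
  refine and_congr (by simp [ha0]) ?_
  have : Complex.exp (((β (‖z‖ ^ (1 / m : ℝ)) - β 0 : ℝ) : ℂ) * Complex.I) =
      a⁻¹ * Complex.exp (β (‖z‖ ^ (1 / m : ℝ)) * Complex.I) := by
    rw [ha, ← Complex.exp_neg, ← Complex.exp_add]
    congr 1
    push_cast
    ring
  rw [this, mul_left_comm, mul_right_inj' (inv_ne_zero ha0)]

/-! ### Topology of arcs -/

/-- The parametrization of an arc by the root of the radius. -/
noncomputable def arcPath (m : ℕ) (β : ℝ → ℝ) (s : ℝ) : ℂ :=
  (s : ℂ) ^ m * Complex.exp (β s * Complex.I)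

theorem norm_arcPath {m : ℕ} {β : ℝ → ℝ} {s : ℝ} (hs : 0 ≤ s) : ‖arcPath m β s‖ = s ^ m := by
  rw [arcPath, norm_mul, Complex.norm_exp_ofReal_mul_I, mul_one, norm_pow, Complex.norm_real,
    Real.norm_of_nonneg hs]

theorem arcPath_zero {m : ℕ} (hm : m ≠ 0) (β : ℝ → ℝ) : arcPath m β 0 = 0 := by
  simp [arcPath, hm]

theorem arcPath_ne_zero {m : ℕ} {β : ℝ → ℝ} {s : ℝ} (hs : 0 < s) : arcPath m β s ≠ 0 := by
  rw [← norm_pos_iff, norm_arcPath hs.le]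
  positivity

theorem norm_arcPath_rpow {m : ℕ} (hm : m ≠ 0) {β : ℝ → ℝ} {s : ℝ} (hs : 0 ≤ s) :
    ‖arcPath m β s‖ ^ (1 / m : ℝ) = s := by
  rw [norm_arcPath hs, one_div, Real.pow_rpow_inv_natCast hs hm]

theorem arcPath_mem_arcSet_iff {m : ℕ} (hm : m ≠ 0) {β γ : ℝ → ℝ} {s : ℝ} (hs : 0 < s) :
    arcPath m β s ∈ arcSet m γ ↔
      Complex.exp (β s * Complex.I) = Complex.exp (γ s * Complex.I) := by
  have hs' : ((s : ℂ) ^ m) ≠ 0 := pow_ne_zero _ (by exact_mod_cast hs.ne')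
  simp only [arcSet, mem_ofPred_eq, norm_arcPath_rpow hm hs.le]
  rw [norm_arcPath hs.le, and_iff_right (arcPath_ne_zero hs), arcPath, Complex.ofReal_pow, mul_right_inj' hs']

theorem arcPath_mem_arcSet {m : ℕ} (hm : m ≠ 0) {β : ℝ → ℝ} {s : ℝ} (hs : 0 < s) :
    arcPath m β s ∈ arcSet m β :=
  (arcPath_mem_arcSet_iff hm hs).2 rfl

theorem eq_arcPath_of_mem_arcSet {m : ℕ} (hm : m ≠ 0) {β : ℝ → ℝ} {z : ℂ} (hz : z ∈ arcSet m β) :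
    z = arcPath m β (‖z‖ ^ (1 / m : ℝ)) := by
  rw [arcPath, ← Complex.ofReal_pow, norm_rpow_pow hm]
  exact hz.2

theorem continuousAt_arcPath {m : ℕ} {β : ℝ → ℝ} {s : ℝ} (hβ : ContinuousAt β s) :
    ContinuousAt (arcPath m β) s := by
  unfold arcPath
  fun_prop

theorem arcPath_injOn {m : ℕ} (hm : m ≠ 0) (β : ℝ → ℝ) : InjOn (arcPath m β) (Ici 0) :=
  fun s hs t ht h => by rw [← norm_arcPath_rpow (β := β) hm hs, h, norm_arcPath_rpow hm ht]

theorem accPt_arcPath {m : ℕ} (hm : m ≠ 0) {β : ℝ → ℝ} {s : ℝ} (hs : 0 ≤ s)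
    (hβ : ContinuousAt β s) : AccPt (arcPath m β s) (𝓟 (arcSet m β)) := by
  have h : Tendsto (arcPath m β) (𝓝[>] s) (𝓝[≠] arcPath m β s ⊓ 𝓟 (arcSet m β)) := by
    refine tendsto_inf.2 ⟨tendsto_nhdsWithin_iff.2
      ⟨(continuousAt_arcPath hβ).tendsto.mono_left nhdsWithin_le_nhds, ?_⟩, tendsto_principal.2 ?_⟩
    · filter_upwards [self_mem_nhdsWithin] with t ht h
      exact (ne_of_gt (show s < t from ht)) (arcPath_injOn hm β (hs.trans (le_of_lt ht)) hs h)
    · filter_upwards [self_mem_nhdsWithin] with t ht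
      exact arcPath_mem_arcSet hm (hs.trans_lt ht)
  exact h.neBot

theorem accPt_of_mem_arcSet {m : ℕ} (hm : m ≠ 0) {β : ℝ → ℝ} {z : ℂ} (hz : z ∈ arcSet m β)
    (hβ : ContinuousAt β (‖z‖ ^ (1 / m : ℝ))) : AccPt z (𝓟 (arcSet m β)) := by
  have h := accPt_arcPath hm (by positivity) hβ
  rwa [← eq_arcPath_of_mem_arcSet hm hz] at h

/-- The truncated arc with its end point is the image of `[0, δ)` under `arcPath`. -/
theorem isPreconnected_insert_arcSet_inter_ball {m : ℕ} (hm : m ≠ 0) {β : ℝ → ℝ} {δ : ℝ}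
    (hδ : 0 < δ) (hβ : ∀ s ∈ Ico 0 δ, ContinuousAt β s) :
    IsPreconnected (insert 0 (arcSet m β ∩ Metric.ball 0 (δ ^ m))) := by
  have : insert 0 (arcSet m β ∩ Metric.ball 0 (δ ^ m)) = arcPath m β '' Ico 0 δ := by
    ext z
    constructor
    · rintro (rfl | ⟨hz, hzδ⟩)
      · exact ⟨0, ⟨le_rfl, hδ⟩, arcPath_zero hm β⟩
      · refine ⟨‖z‖ ^ (1 / m : ℝ), ⟨by positivity, ?_⟩, (eq_arcPath_of_mem_arcSet hm hz).symm⟩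
        refine lt_of_pow_lt_pow_left₀ m hδ.le ?_
        rw [norm_rpow_pow hm]
        simpa using hzδ
    · rintro ⟨s, ⟨hs0, hsδ⟩, rfl⟩
      rcases hs0.eq_or_lt with rfl | hs
      · exact Or.inl (arcPath_zero hm β)
      · refine Or.inr ⟨arcPath_mem_arcSet hm hs, ?_⟩
        rw [mem_ball_zero_iff, norm_arcPath hs0]
        exact pow_lt_pow_left₀ hsδ hs0 hm
  rw [this]
  exact isPreconnected_Ico.image _ fun s hs =>
    (continuousAt_arcPath (hβ s hs)).continuousWithinAt

/-- Finitely many arcs do not fill a punctured neighbourhood of their end point. -/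
theorem not_eventually_mem_arcSet (m : ℕ) (A : Finset (ℝ → ℝ)) :
    ¬ ∀ᶠ z in 𝓝[≠] (0 : ℂ), ∃ β ∈ A, z ∈ arcSet m β := by
  intro h
  rw [eventually_nhdsWithin_iff, Metric.eventually_nhds_iff] at h
  obtain ⟨ε, hε, h⟩ := h
  set r : ℝ := ε / 2
  have hr : 0 < r := by positivity
  have hfin : (Metric.sphere (0 : ℂ) r).Finite := by
    -- Each arc meets the circle of radius `r` in at most one point, whereas a circle is connected
    -- with more than one point, hence infinite.
    refine (A.finite_toSet.image
      fun β => (r : ℂ) * Complex.exp (β (r ^ (1 / m : ℝ)) * Complex.I)).subset fun z hz => ?_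
    have hzr : ‖z‖ = r := by simpa using hz
    have hz0 : z ≠ 0 := norm_pos_iff.1 (hzr ▸ hr)
    obtain ⟨β, hβ, -, hzβ⟩ := h (y := z) (by rw [dist_zero_right, hzr]; exact half_lt_self hε) hz0
    rw [hzr] at hzβ
    exact ⟨β, hβ, hzβ.symm⟩
  have hconn : IsPreconnected (Metric.sphere (0 : ℂ) r) :=
    isPreconnected_sphere (by rw [Complex.rank_real_complex]; norm_num) 0 r
  have h1 : (r : ℂ) ∈ Metric.sphere (0 : ℂ) r := by simp [abs_of_pos hr]
  have h2 : -(r : ℂ) ∈ Metric.sphere (0 : ℂ) r := by simp [abs_of_pos hr]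
  refine hconn.infinite_of_nontrivial ⟨_, h1, _, h2, fun h => ?_⟩ hfin
  have hr' : r = -r := by exact_mod_cast h
  linarith

/-- Rescaling each vertical segment affinely exhibits the region as a continuous image of a
rectangle. -/
theorem isPreconnected_between {δ : ℝ} {lo hi : ℝ → ℝ} (hlo : ContinuousOn lo (Ioo 0 δ))
    (hhi : ContinuousOn hi (Ioo 0 δ)) (hlt : ∀ s ∈ Ioo 0 δ, lo s < hi s) :
    IsPreconnected {p : ℝ × ℝ | p.1 ∈ Ioo 0 δ ∧ lo p.1 < p.2 ∧ p.2 < hi p.1} := by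
  have : {p : ℝ × ℝ | p.1 ∈ Ioo 0 δ ∧ lo p.1 < p.2 ∧ p.2 < hi p.1} =
      (fun p : ℝ × ℝ => (p.1, lo p.1 + p.2 * (hi p.1 - lo p.1))) '' (Ioo 0 δ ×ˢ Ioo 0 1) := by
    ext ⟨s, θ⟩
    constructor
    · rintro ⟨hs, h1, h2⟩
      dsimp only at hs h1 h2
      have hd : 0 < hi s - lo s := sub_pos.2 (hlt s hs)
      refine ⟨(s, (θ - lo s) / (hi s - lo s)), ⟨hs, div_pos (by linarith) hd,
        (div_lt_one hd).2 (by linarith)⟩, ?_⟩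
      ext
      · rfl
      · change lo s + (θ - lo s) / (hi s - lo s) * (hi s - lo s) = θ
        rw [div_mul_cancel₀ _ hd.ne']
        ring
    · rintro ⟨⟨s', l⟩, ⟨hs, h1, h2⟩, h⟩
      dsimp only at hs h1 h2 h
      obtain ⟨rfl, rfl⟩ := Prod.mk.inj h
      have hd : 0 < hi s' - lo s' := sub_pos.2 (hlt s' hs)
      refine ⟨hs, ?_, ?_⟩ <;> dsimp only <;> nlinarith
  rw [this]
  refine (isPreconnected_Ioo.prod isPreconnected_Ioo).image _ ?_
  have h1 : ContinuousOn (fun p : ℝ × ℝ => lo p.1) (Ioo 0 δ ×ˢ Ioo 0 1) :=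
    hlo.comp continuousOn_fst fun p hp => hp.1
  have h2 : ContinuousOn (fun p : ℝ × ℝ => hi p.1) (Ioo 0 δ ×ˢ Ioo 0 1) :=
    hhi.comp continuousOn_fst fun p hp => hp.1
  exact continuousOn_fst.prodMk (h1.add (continuousOn_snd.mul (h2.sub h1)))

/-- The complement of finitely many graphs in a thin strip decomposes into finitely many connected
pieces, provided that the order of the graphs does not change. -/
theorem isPreconnected_sector {δ : ℝ} (L R : Finset (ℝ → ℝ)) (hL : L.Nonempty) (hR : R.Nonempty)
    (hcL : ∀ b ∈ L, ContinuousOn b (Ioo 0 δ)) (hcR : ∀ b ∈ R, ContinuousOn b (Ioo 0 δ))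
    (hsign : ∀ b ∈ L, ∀ c ∈ R, ∀ s ∈ Ioo 0 δ, ∀ t ∈ Ioo 0 δ, b s < c s → b t < c t) :
    IsPreconnected {p : ℝ × ℝ | p.1 ∈ Ioo 0 δ ∧ (∀ b ∈ L, b p.1 < p.2) ∧ ∀ c ∈ R, p.2 < c p.1} := by
  rcases Set.eq_empty_or_nonempty
    {p : ℝ × ℝ | p.1 ∈ Ioo 0 δ ∧ (∀ b ∈ L, b p.1 < p.2) ∧ ∀ c ∈ R, p.2 < c p.1} with he | ⟨q, hq⟩
  · rw [he]
    exact isPreconnected_empty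
  have := isPreconnected_between (δ := δ) (lo := fun s => L.sup' hL fun b => b s)
    (hi := fun s => R.inf' hR fun c => c s) (ContinuousOn.finset_sup'_apply hL hcL)
    (ContinuousOn.finset_inf'_apply hR hcR) (fun s hs => by
      rw [Finset.sup'_lt_iff]
      intro b hb
      rw [Finset.lt_inf'_iff]
      intro c hc
      exact hsign b hb c hc q.1 hq.1 s hs ((hq.2.1 b hb).trans (hq.2.2 c hc)))
  convert this using 3
  simp [Finset.sup'_lt_iff, Finset.lt_inf'_iff]

/-- The difference of two analytic germs has constant sign to the right of the origin, so finitely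
many graphs keep their order on a common interval. -/
theorem exists_uniform_sign (Λ : Finset (ℝ → ℝ)) (hΛ : ∀ b ∈ Λ, AnalyticAt ℝ b 0) :
    ∀ᶠ δ in 𝓝[>] (0 : ℝ), (∀ b ∈ Λ, ContinuousOn b (Ioo 0 δ)) ∧
      ∀ b ∈ Λ, ∀ c ∈ Λ, ∀ s ∈ Ioo 0 δ, ∀ t ∈ Ioo 0 δ, b s < c s → b t < c t := by
  have h1 : ∀ᶠ s in 𝓝[>] (0 : ℝ), ∀ b ∈ Λ, ContinuousAt b s := by
    rw [Filter.eventually_all_finset]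
    exact fun b hb => nhdsWithin_le_nhds
      ((hΛ b hb).eventually_analyticAt.mono fun s hs => hs.continuousAt)
  have h2 : ∃ σ : (ℝ → ℝ) → (ℝ → ℝ) → SignType, ∀ᶠ s in 𝓝[>] (0 : ℝ), ∀ b ∈ Λ, ∀ c ∈ Λ,
      SignType.sign (c s - b s) = σ b c := by
    have : ∀ b c, ∃ τ : SignType, b ∈ Λ → c ∈ Λ →
        ∀ᶠ s in 𝓝[>] (0 : ℝ), SignType.sign (c s - b s) = τ := fun b c => by
      by_cases h : b ∈ Λ ∧ c ∈ Λ
      · obtain ⟨τ, hτ⟩ := exists_eventually_sign_eq ((hΛ c h.2).sub (hΛ b h.1))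
        exact ⟨τ, fun _ _ => hτ⟩
      · exact ⟨0, fun hb hc => (h ⟨hb, hc⟩).elim⟩
    choose σ hσ using this
    refine ⟨σ, ?_⟩
    rw [Filter.eventually_all_finset]
    intro b hb
    rw [Filter.eventually_all_finset]
    exact fun c hc => hσ b c hb hc
  obtain ⟨σ, h2⟩ := h2
  obtain ⟨δ₀, hδ₀, h⟩ := mem_nhdsGT_iff_exists_Ioo_subset.1 (h1.and h2)
  filter_upwards [Ioo_mem_nhdsGT hδ₀] with δ hδ
  have hsub : ∀ s ∈ Ioo 0 δ, s ∈ Ioo 0 δ₀ := fun s hs => ⟨hs.1, hs.2.trans hδ.2⟩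
  refine ⟨fun b hb s hs => ((h (hsub s hs)).1 b hb).continuousWithinAt, ?_⟩
  intro b hb c hc s hs t ht hlt
  have e1 := (h (hsub s hs)).2 b hb c hc
  have e2 := (h (hsub t ht)).2 b hb c hc
  rw [← e1, sign_pos (sub_pos.2 hlt), sign_eq_one_iff] at e2
  linarith

/-- The complement of finitely many arcs in a small punctured disc has finitely many pieces. -/
theorem exists_finite_sectors {m : ℕ} (hm : m ≠ 0) (A : Finset (ℝ → ℝ))
    (hA : ∀ β ∈ A, AnalyticAt ℝ β 0) :
    ∀ᶠ δ in 𝓝[>] (0 : ℝ), ∃ 𝓑 : Set (Set ℂ), 𝓑.Finite ∧ (∀ B ∈ 𝓑, IsPreconnected B) ∧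
      ⋃₀ 𝓑 = {z | z ∈ Metric.ball (0 : ℂ) (δ ^ m) ∧ z ≠ 0 ∧ ∀ β ∈ A, z ∉ arcSet m β} := by
  classical
  have hbdd : ∃ C : ℝ, ∀ᶠ s in 𝓝[>] (0 : ℝ), ∀ β ∈ A, |β s| ≤ C := by
    refine ⟨∑ β ∈ A, (|β 0| + 1), ?_⟩
    rw [Filter.eventually_all_finset]
    intro β hβ
    refine nhdsWithin_le_nhds ?_
    filter_upwards [(hA β hβ).continuousAt.abs.eventually_lt continuousAt_const
      (lt_add_one |β 0|)] with s hs
    exact hs.le.trans (Finset.single_le_sum (f := fun β : ℝ → ℝ => |β 0| + 1)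
      (fun β _ => by positivity) hβ)
  obtain ⟨C, hC⟩ := hbdd
  obtain ⟨K, hK⟩ := exists_nat_ge (C + 4)
  -- All lifts of the arcs to the strip of angles between `-4` and `4`, together with these two
  -- barriers; the strip contains the range of `arg` because `π < 4`. A lift by `2 * π * k` meeting
  -- the strip satisfies `2 * π * |k| < C + 4 ≤ K`, so the shifts with `|k| ≤ K` suffice.
  set Λ : Finset (ℝ → ℝ) := {fun _ => (-4 : ℝ), fun _ => (4 : ℝ)} ∪
    (A ×ˢ Finset.Icc (-(K : ℤ)) K).image fun p s => p.1 s + p.2 * (2 * Real.pi) with hΛdef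
  have hΛ : ∀ b ∈ Λ, AnalyticAt ℝ b 0 := by
    intro b hb
    simp only [hΛdef, Finset.mem_union, Finset.mem_insert, Finset.mem_singleton,
      Finset.mem_image, Finset.mem_product] at hb
    rcases hb with (rfl | rfl) | ⟨p, ⟨hp, -⟩, rfl⟩
    · exact analyticAt_const
    · exact analyticAt_const
    · exact (hA _ hp).add analyticAt_const
  have hm4 : (fun _ => (-4 : ℝ)) ∈ Λ := by simp [hΛdef]
  have hp4 : (fun _ => (4 : ℝ)) ∈ Λ := by simp [hΛdef]
  obtain ⟨δ₁, hδ₁, hC'⟩ := mem_nhdsGT_iff_exists_Ioo_subset.1 hC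
  filter_upwards [exists_uniform_sign Λ hΛ, Ioo_mem_nhdsGT hδ₁] with δ hδ hδδ
  have hδ0 : 0 < δ := hδδ.1
  have hCδ : ∀ s ∈ Ioo 0 δ, ∀ β ∈ A, |β s| ≤ C := fun s hs => hC' ⟨hs.1, hs.2.trans hδδ.2⟩
  -- A sector is labelled by the set `L` of graphs lying below it; the remaining graphs lie above.
  set E : Finset (ℝ → ℝ) → Set (ℝ × ℝ) := fun L =>
    {p : ℝ × ℝ | p.1 ∈ Ioo 0 δ ∧ (∀ b ∈ L, b p.1 < p.2) ∧ ∀ c ∈ Λ \ L, p.2 < c p.1} with hE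
  set P : ℝ × ℝ → ℂ := fun p => arcPath m (fun _ => p.2) p.1 with hP
  have hPc : Continuous P := by
    simp only [hP, arcPath]
    fun_prop
  refine ⟨(fun L => P '' E L) ''
    {L | L ⊆ Λ ∧ (fun _ => (-4 : ℝ)) ∈ L ∧ (fun _ => (4 : ℝ)) ∉ L}, ?_, ?_, ?_⟩
  · exact ((Λ.powerset.finite_toSet).subset fun L hL => by simpa using hL.1).image _
  · rintro _ ⟨L, ⟨hL, h1, h2⟩, rfl⟩
    refine (isPreconnected_sector L (Λ \ L) ⟨_, h1⟩ ⟨_, Finset.mem_sdiff.2 ⟨hp4, h2⟩⟩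
      (fun b hb => hδ.1 b (hL hb)) (fun b hb => hδ.1 b (Finset.mem_sdiff.1 hb).1)
      fun b hb c hc => hδ.2 b (hL hb) c (Finset.mem_sdiff.1 hc).1).image _ hPc.continuousOn
  · ext z
    constructor
    · rintro ⟨_, ⟨L, ⟨hL, h1, h2⟩, rfl⟩, ⟨s, θ⟩, ⟨hs, hbelow, habove⟩, rfl⟩
      dsimp only at hs hbelow habove
      refine ⟨?_, arcPath_ne_zero hs.1, fun β hβ hmem => ?_⟩
      · rw [mem_ball_zero_iff]
        change ‖arcPath m (fun _ => θ) s‖ < _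
        rw [norm_arcPath hs.1.le]
        exact pow_lt_pow_left₀ hs.2 hs.1.le hm
      · have hexp := (arcPath_mem_arcSet_iff hm hs.1).1 hmem
        obtain ⟨k, hk⟩ := Complex.exp_eq_exp_iff_exists_int.1 hexp
        have hk' : θ = β s + k * (2 * Real.pi) := by
          have : ((θ : ℂ)) * Complex.I = ((β s + k * (2 * Real.pi) : ℝ) : ℂ) * Complex.I := by
            rw [hk]; push_cast; ring
          exact_mod_cast mul_right_cancel₀ Complex.I_ne_zero this
        have hθ1 : -4 < θ := hbelow _ h1
        have hθ2 : θ < 4 := habove _ (Finset.mem_sdiff.2 ⟨hp4, h2⟩)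
        have hβC := abs_le.1 (hCδ s hs β hβ)
        have hpi := Real.pi_gt_three
        have hkK : k ∈ Finset.Icc (-(K : ℤ)) K := by
          rw [Finset.mem_Icc]
          constructor
          · by_contra! hlt
            have : (k : ℝ) < -K := by exact_mod_cast hlt
            nlinarith
          · by_contra! hlt
            have : (K : ℝ) < k := by exact_mod_cast hlt
            nlinarith
        have hb : (fun s => β s + k * (2 * Real.pi)) ∈ Λ := by
          refine Finset.mem_union_right _ (Finset.mem_image.2 ⟨(β, k), ?_, rfl⟩)
          exact Finset.mem_product.2 ⟨hβ, hkK⟩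
        by_cases hbL : (fun s => β s + k * (2 * Real.pi)) ∈ L
        · exact (hbelow _ hbL).ne hk'.symm
        · exact (habove _ (Finset.mem_sdiff.2 ⟨hb, hbL⟩)).ne hk'
    · rintro ⟨hz, hz0, hzA⟩
      set s : ℝ := ‖z‖ ^ (1 / m : ℝ) with hs
      have hs0 : 0 < s := Real.rpow_pos_of_pos (norm_pos_iff.2 hz0) _
      have hsm : s ^ m = ‖z‖ := norm_rpow_pow hm z
      have hsδ : s < δ := lt_of_pow_lt_pow_left₀ m hδ0.le (by rw [hsm]; simpa using hz)
      set θ := Complex.arg z with hθ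
      have hzP : P (s, θ) = z := by
        change arcPath m (fun _ => θ) s = z
        rw [arcPath, ← Complex.ofReal_pow, hsm, Complex.norm_mul_exp_arg_mul_I]
      have hθ1 := Complex.neg_pi_lt_arg z
      have hθ2 := Complex.arg_le_pi z
      have hpi := Real.pi_lt_four
      -- The label of `z` consists of the graphs below its argument. No other graph passes through
      -- the point, since `z` lies on no arc and its argument is not a barrier.
      refine ⟨_, ⟨Λ.filter fun b => b s < θ, ⟨Finset.filter_subset _ _, ?_, ?_⟩, rfl⟩,
        (s, θ), ⟨⟨hs0, hsδ⟩, ?_, ?_⟩, hzP⟩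
      · rw [Finset.mem_filter]
        exact ⟨hm4, by linarith⟩
      · rw [Finset.mem_filter]
        rintro ⟨-, h⟩
        linarith
      · intro b hb
        exact (Finset.mem_filter.1 hb).2
      · intro c hc
        rw [Finset.mem_sdiff, Finset.mem_filter, not_and, not_lt] at hc
        refine lt_of_le_of_ne (hc.2 hc.1) fun heq => ?_
        have hcΛ := hc.1
        simp only [hΛdef, Finset.mem_union, Finset.mem_insert, Finset.mem_singleton,
          Finset.mem_image, Finset.mem_product] at hcΛ
        dsimp only at heq
        rcases hcΛ with (rfl | rfl) | ⟨p, ⟨hp, -⟩, rfl⟩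
        · linarith
        · linarith
        · refine hzA p.1 hp ?_
          rw [← hzP]
          refine (arcPath_mem_arcSet_iff hm hs0).2 ?_
          rw [heq, Complex.exp_eq_exp_iff_exists_int]
          exact ⟨p.2, by push_cast; ring⟩

/-! ### Harmonic functions in the plane -/

theorem exists_analyticAt_re_eq {h : ℂ → ℝ} {c : ℂ} (hh : HarmonicAt h c) :
    ∃ F : ℂ → ℂ, AnalyticAt ℂ F c ∧ ∀ᶠ z in 𝓝 c, h z = (F z).re := by
  obtain ⟨ε, hε, hball⟩ := Metric.eventually_nhds_iff_ball.1 hh.eventually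
  obtain ⟨F, hF, hre⟩ := HarmonicOnNhd.exists_analyticOnNhd_ball_re_eq (f := h) (z := c) (R := ε)
    fun x hx => hball x hx
  refine ⟨F, hF c (Metric.mem_ball_self hε), ?_⟩
  filter_upwards [Metric.ball_mem_nhds c hε] with z hz
  exact (hre hz).symm

theorem harmonicAt_comp {h : ℂ → ℝ} {φ : ℂ → ℂ} {c : ℂ} (hh : HarmonicAt h (φ c))
    (hφ : AnalyticAt ℂ φ c) : HarmonicAt (fun z => h (φ z)) c := by
  obtain ⟨F, hF, hre⟩ := exists_analyticAt_re_eq hh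
  refine (harmonicAt_congr_nhds ?_).2 (AnalyticAt.harmonicAt_re (hF.comp hφ))
  filter_upwards [hφ.continuousAt.eventually hre] with z hz
  exact hz

/-- The maximum principle. -/
theorem eventually_eq_of_isLocalMax {u : ℂ → ℝ} {c : ℂ} (hu : HarmonicAt u c)
    (hmax : ∀ᶠ z in 𝓝 c, u z ≤ u c) : ∀ᶠ z in 𝓝 c, u z = u c := by
  obtain ⟨F, hF, hre⟩ := exists_analyticAt_re_eq hu
  have hE : AnalyticAt ℂ (fun z => Complex.exp (F z)) c := hF.cexp
  have hd : ∀ᶠ z in 𝓝 c, DifferentiableAt ℂ (fun z => Complex.exp (F z)) z :=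
    hE.eventually_analyticAt.mono fun z hz => hz.differentiableAt
  -- Since `‖exp F‖ = exp (re F)`, a maximum of the harmonic function is a maximum of the modulus of
  -- a holomorphic one.
  have hloc : IsLocalMax (norm ∘ fun z => Complex.exp (F z)) c := by
    filter_upwards [hre, hmax] with z h1 h2
    simp only [Function.comp_apply, Complex.norm_exp]
    rw [← h1, ← hre.self_of_nhds]
    exact Real.exp_le_exp.2 h2
  filter_upwards [Complex.eventually_eq_of_isLocalMax_norm hd hloc, hre] with z h1 h2
  have := congrArg norm h1
  rw [Complex.norm_exp, Complex.norm_exp, Real.exp_eq_exp] at this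
  rw [h2, this, ← hre.self_of_nhds]

theorem isInvertible_of_apply_one_ne_zero {c : ℝ →L[ℝ] ℝ} (hc : c 1 ≠ 0) : c.IsInvertible := by
  refine ⟨ContinuousLinearEquiv.unitsEquivAut ℝ (Units.mk0 _ hc), ?_⟩
  ext
  simp

/-- Analytic implicit function theorem for plane curves. -/
theorem exists_analytic_implicit {Q : ℝ × ℝ → ℝ} {a b d : ℝ} (hQ : AnalyticAt ℝ Q (a, b))
    (h0 : Q (a, b) = 0) (hd : HasDerivAt (fun θ => Q (a, θ)) d b) (hd0 : d ≠ 0) :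
    ∃ β : ℝ → ℝ, AnalyticAt ℝ β a ∧ (∀ᶠ s in 𝓝 a, Q (s, β s) = 0) ∧
      ∀ᶠ p in 𝓝 (a, b), Q p = 0 → β p.1 = p.2 := by
  have hcd : ContDiffAt ℝ ω Q (a, b) := hQ.contDiffAt
  have hinv : (fderiv ℝ Q (a, b) ∘L ContinuousLinearMap.inr ℝ ℝ ℝ).IsInvertible := by
    refine isInvertible_of_apply_one_ne_zero ?_
    have h1 : HasFDerivAt Q (fderiv ℝ Q (a, b)) (a, b) := hQ.differentiableAt.hasFDerivAt
    have h2 : HasDerivAt (fun θ : ℝ => ((a, θ) : ℝ × ℝ)) (0, 1) b :=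
      (hasDerivAt_const b a).prodMk (hasDerivAt_id b)
    have h3 := (h1.comp_hasDerivAt b h2).unique hd
    simpa [h3] using hd0
  refine ⟨hcd.implicitFunction (by simp) hinv,
    (hcd.contDiffAt_implicitFunction (by simp) hinv).analyticAt, ?_, ?_⟩
  · simpa only [h0] using hcd.eventually_apply_implicitFunction (by simp) hinv
  · filter_upwards [hcd.eventually_apply_eq_iff_implicitFunction (by simp) hinv] with p hp hQp
    exact hp.1 (hQp.trans h0.symm)

/-- The zero set of a nonzero harmonic function is a finite union of arcs. -/
theorem exists_arcs_of_harmonicAt {h : ℂ → ℝ} (hh : HarmonicAt h 0)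
    (hne : ¬ ∀ᶠ z in 𝓝 (0 : ℂ), h z = 0) :
    ∃ A : Finset (ℝ → ℝ), (∀ β ∈ A, AnalyticAt ℝ β 0) ∧
      ∀ᶠ z in 𝓝[≠] (0 : ℂ), (h z = 0 ↔ ∃ β ∈ A, z ∈ arcSet 1 β) := by
  classical
  by_cases h0 : h 0 = 0
  swap
  · refine ⟨∅, by simp, nhdsWithin_le_nhds ?_⟩
    filter_upwards [hh.1.continuousAt.eventually_ne h0] with z hz
    simpa using hz
  obtain ⟨F₀, hF₀, hre₀⟩ := exists_analyticAt_re_eq hh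
  set F : ℂ → ℂ := fun z => F₀ z - F₀ 0 with hFdef
  have hF : AnalyticAt ℂ F 0 := hF₀.sub analyticAt_const
  have hre : ∀ᶠ z in 𝓝 (0 : ℂ), h z = (F z).re := by
    filter_upwards [hre₀] with z hz
    rw [hz, hFdef, Complex.sub_re, ← hre₀.self_of_nhds, h0, sub_zero]
  have hFne : ¬ ∀ᶠ z in 𝓝 (0 : ℂ), F z = 0 := fun hF0 => hne <| by
    filter_upwards [hre, hF0] with z h1 h2
    rw [h1, h2, Complex.zero_re]
  obtain ⟨n, g, hg, hg0, hFg⟩ := hF.exists_eventuallyEq_pow_smul_nonzero_iff.2 hFne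
  have hn : n ≠ 0 := by
    rintro rfl
    have := hFg.self_of_nhds
    simp [hFdef] at this
    exact hg0 this.symm
  -- Polar blow-up: writing `F z = z ^ n * g z` with `g 0 ≠ 0`, the function `h` at radius `s` and
  -- angle `θ` equals `s ^ n * Q (s, θ)`, and `Q` is analytic across `s = 0`.
  set Q : ℝ × ℝ → ℝ := fun p => (Complex.exp (n * (p.2 * Complex.I)) *
    g (p.1 * Complex.exp (p.2 * Complex.I))).re with hQdef
  have hhQ : ∀ᶠ s : ℝ in 𝓝 (0 : ℝ), ∀ θ : ℝ,
      h ((s : ℂ) * Complex.exp (θ * Complex.I)) = s ^ n * Q (s, θ) := by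
    obtain ⟨ε, hε, hb⟩ := Metric.eventually_nhds_iff_ball.1 (hre.and hFg)
    filter_upwards [Metric.ball_mem_nhds (0 : ℝ) hε] with s hs θ
    have hmem : (s : ℂ) * Complex.exp (θ * Complex.I) ∈ Metric.ball (0 : ℂ) ε := by
      rw [mem_ball_zero_iff] at hs ⊢
      rwa [norm_mul, Complex.norm_exp_ofReal_mul_I, mul_one, Complex.norm_real]
    obtain ⟨h1, h2⟩ := hb _ hmem
    rw [h1, h2, sub_zero, smul_eq_mul, mul_pow, ← Complex.exp_nat_mul, mul_assoc,
      ← Complex.ofReal_pow, Complex.re_ofReal_mul]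
  have hQan : ∀ θ : ℝ, AnalyticAt ℝ Q (0, θ) := fun θ => by
    have e1 : AnalyticAt ℝ (fun p : ℝ × ℝ => (p.1 : ℂ)) (0, θ) :=
      (Complex.ofRealCLM.analyticAt _).comp analyticAt_fst
    have e2 : AnalyticAt ℝ (fun p : ℝ × ℝ => (p.2 : ℂ)) (0, θ) :=
      (Complex.ofRealCLM.analyticAt _).comp analyticAt_snd
    have e3 : ∀ w : ℂ, AnalyticAt ℝ Complex.exp w := fun w =>
      (analyticAt_cexp (z := w)).restrictScalars
    have e4 : AnalyticAt ℝ (fun p : ℝ × ℝ => Complex.exp (p.2 * Complex.I)) (0, θ) :=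
      (e3 _).fun_comp (e2.mul analyticAt_const)
    have e5 : AnalyticAt ℝ (fun p : ℝ × ℝ => Complex.exp (n * (p.2 * Complex.I))) (0, θ) :=
      (e3 _).fun_comp (analyticAt_const.mul (e2.mul analyticAt_const))
    have e6 : AnalyticAt ℝ (fun p : ℝ × ℝ => g (p.1 * Complex.exp (p.2 * Complex.I))) (0, θ) := by
      refine AnalyticAt.fun_comp (g := g)
        (f := fun p : ℝ × ℝ => (p.1 : ℂ) * Complex.exp (p.2 * Complex.I)) ?_ (e1.mul e4)
      simpa using hg.restrictScalars (𝕜 := ℝ)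
    exact (Complex.reCLM.analyticAt _).fun_comp (e5.mul e6)
  have hQ0 : ∀ θ : ℝ, Q (0, θ) = (Complex.exp (n * (θ * Complex.I)) * g 0).re := fun θ => by
    simp [hQdef]
  have hQd : ∀ θ : ℝ, HasDerivAt (fun θ => Q (0, θ))
      (-(n * (Complex.exp (n * (θ * Complex.I)) * g 0).im)) θ := fun θ => by
    have e1 : HasDerivAt (fun θ : ℝ => (n : ℂ) * ((θ : ℂ) * Complex.I)) (n * (1 * Complex.I)) θ :=
      ((Complex.ofRealCLM.hasDerivAt (x := θ)).mul_const Complex.I).const_mul _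
    have e2 := ((e1.cexp).mul_const (g 0))
    have e3 := Complex.reCLM.hasFDerivAt.comp_hasDerivAt θ e2
    refine (e3.congr_deriv ?_).congr_of_eventuallyEq (Eventually.of_forall fun t => hQ0 t)
    simp [Complex.mul_re, Complex.mul_im]
    ring
  set good : (ℝ → ℝ) → Prop := fun β => AnalyticAt ℝ β 0 ∧ ∀ᶠ s in 𝓝 (0 : ℝ), Q (s, β s) = 0
  -- Near each point of the angular interval the zeros of `Q` lie on at most one analytic graph;
  -- compactness of the interval leaves finitely many graphs.
  have hcpt : ∃ A : Finset (ℝ → ℝ), (∀ β ∈ A, good β) ∧ ∀ᶠ s in 𝓝 (0 : ℝ),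
      ∀ θ ∈ Icc (-Real.pi) Real.pi, Q (s, θ) = 0 → ∃ β ∈ A, β s = θ := by
    refine IsCompact.induction_on (isCompact_Icc (a := -Real.pi) (b := Real.pi))
      (p := fun K => ∃ A : Finset (ℝ → ℝ), (∀ β ∈ A, good β) ∧ ∀ᶠ s in 𝓝 (0 : ℝ),
      ∀ θ ∈ K, Q (s, θ) = 0 → ∃ β ∈ A, β s = θ) ⟨∅, by simp⟩ ?_ ?_ ?_
    · rintro s t hst ⟨A, hA, hev⟩
      exact ⟨A, hA, hev.mono fun x hx θ hθ => hx θ (hst hθ)⟩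
    · rintro s t ⟨A, hA, hev⟩ ⟨A', hA', hev'⟩
      refine ⟨A ∪ A', fun β hβ => (Finset.mem_union.1 hβ).elim (hA β) (hA' β), ?_⟩
      filter_upwards [hev, hev'] with x h1 h2 θ hθ hx
      rcases hθ with hθ | hθ
      · obtain ⟨β, hβ, e⟩ := h1 θ hθ hx
        exact ⟨β, Finset.mem_union_left _ hβ, e⟩
      · obtain ⟨β, hβ, e⟩ := h2 θ hθ hx
        exact ⟨β, Finset.mem_union_right _ hβ, e⟩
    · intro θ _
      have hlocal : ∃ A : Finset (ℝ → ℝ), (∀ β ∈ A, good β) ∧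
          ∀ᶠ p in 𝓝 ((0 : ℝ), θ), Q p = 0 → ∃ β ∈ A, β p.1 = p.2 := by
        by_cases hz : Q (0, θ) = 0
        -- At `s = 0` the values of `Q` and of its angular derivative are, up to the factor `-n`,
        -- the real and imaginary part of the same nonzero number, so they cannot both vanish.
        · have hd0 : -(n * (Complex.exp (n * (θ * Complex.I)) * g 0).im) ≠ 0 := by
            rw [neg_ne_zero]
            refine mul_ne_zero (by exact_mod_cast hn) fun him => ?_
            rw [hQ0] at hz
            exact mul_ne_zero (Complex.exp_ne_zero _) hg0 (Complex.ext hz him)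
          obtain ⟨β, hβ, hβ0, hev⟩ := exists_analytic_implicit (hQan θ) hz (hQd θ) hd0
          refine ⟨{β}, by simpa using ⟨hβ, hβ0⟩, hev.mono fun p hp hQp => ⟨β, by simp, hp hQp⟩⟩
        · refine ⟨∅, by simp, ?_⟩
          filter_upwards [(hQan θ).continuousAt.eventually_ne hz] with p hp hp'
          exact (hp hp').elim
      obtain ⟨A, hA, hev⟩ := hlocal
      rw [nhds_prod_eq] at hev
      obtain ⟨P1, hP1, P2, hP2, hP⟩ := eventually_prod_iff.1 hev
      refine ⟨{t | P2 t}, mem_nhdsWithin_of_mem_nhds hP2, A, hA, ?_⟩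
      filter_upwards [hP1] with s hs t ht
      exact hP hs ht
  obtain ⟨A, hA, hev⟩ := hcpt
  refine ⟨A, fun β hβ => (hA β hβ).1, ?_⟩
  have hgood : ∀ᶠ s in 𝓝 (0 : ℝ), ∀ β ∈ A, Q (s, β s) = 0 := by
    rw [Filter.eventually_all_finset]
    exact fun β hβ => (hA β hβ).2
  have htend : Tendsto (fun z : ℂ => ‖z‖) (𝓝 0) (𝓝 0) := by
    simpa using (continuous_norm (E := ℂ)).tendsto 0
  filter_upwards [nhdsWithin_le_nhds (htend.eventually (hhQ.and (hev.and hgood))),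
    self_mem_nhdsWithin] with z ⟨h1, h2, h3⟩ hz
  have hz0 : z ≠ 0 := hz
  have hzn : ‖z‖ ≠ 0 := norm_ne_zero_iff.2 hz0
  have hzpow : ‖z‖ ^ (1 / (1 : ℕ) : ℝ) = ‖z‖ := by simp
  constructor
  · intro hhz
    have hQz : Q (‖z‖, Complex.arg z) = 0 := by
      have := h1 (Complex.arg z)
      rw [Complex.norm_mul_exp_arg_mul_I, hhz] at this
      exact (mul_eq_zero.1 this.symm).resolve_left (pow_ne_zero _ hzn)
    obtain ⟨β, hβ, hβz⟩ := h2 _ ⟨(Complex.neg_pi_lt_arg z).le, Complex.arg_le_pi z⟩ hQz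
    refine ⟨β, hβ, hz0, ?_⟩
    rw [hzpow, hβz, Complex.norm_mul_exp_arg_mul_I]
  · rintro ⟨β, hβ, -, hzβ⟩
    rw [hzpow] at hzβ
    rw [hzβ, h1, h3 β hβ, mul_zero]

theorem exists_analytic_localInverse {φ : ℂ → ℂ} {a : ℂ} (hφ : AnalyticAt ℂ φ a)
    (hd : deriv φ a ≠ 0) : ∃ ψ : ℂ → ℂ, AnalyticAt ℂ ψ (φ a) ∧ ψ (φ a) = a ∧
      (∀ᶠ z in 𝓝 (φ a), φ (ψ z) = z) ∧ ∀ᶠ ξ in 𝓝 a, ψ (φ ξ) = ξ := by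
  have hs : HasStrictDerivAt φ (deriv φ a) a := hφ.hasStrictDerivAt
  have hF := hs.hasStrictFDerivAt_equiv hd
  refine ⟨hF.localInverse, ?_, hF.localInverse_apply_image, hF.eventually_right_inverse,
    hF.eventually_left_inverse⟩
  exact (hφ.contDiffAt (n := ω)).to_localInverse hF.hasFDerivAt (by simp) |>.analyticAt

/-- The germ of an extended real function is real-valued and harmonic. -/
def EHarmonicAt (G : ℂ → EReal) (w : ℂ) : Prop :=
  ∃ h : ℂ → ℝ, HarmonicAt h w ∧ ∀ᶠ z in 𝓝 w, G z = (h z : EReal)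

theorem EHarmonicAt.congr {G G' : ℂ → EReal} {w : ℂ} (h : EHarmonicAt G w)
    (hG : ∀ᶠ z in 𝓝 w, G' z = G z) : EHarmonicAt G' w := by
  obtain ⟨u, hu, hev⟩ := h
  exact ⟨u, hu, by filter_upwards [hev, hG] with z h1 h2; rw [h2, h1]⟩

theorem EHarmonicAt.comp {G : ℂ → EReal} {φ : ℂ → ℂ} {w : ℂ} (h : EHarmonicAt G (φ w))
    (hφ : AnalyticAt ℂ φ w) : EHarmonicAt (fun z => G (φ z)) w := by
  obtain ⟨u, hu, hev⟩ := h
  exact ⟨fun z => u (φ z), harmonicAt_comp hu hφ, hφ.continuousAt.eventually hev⟩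

theorem eHarmonicAt_comp_iff {G : ℂ → EReal} {φ : ℂ → ℂ} {w : ℂ} (hφ : AnalyticAt ℂ φ w)
    (hd : deriv φ w ≠ 0) : EHarmonicAt (fun z => G (φ z)) w ↔ EHarmonicAt G (φ w) := by
  refine ⟨fun h => ?_, fun h => h.comp hφ⟩
  obtain ⟨ψ, hψ, hψw, hr, -⟩ := exists_analytic_localInverse hφ hd
  have h' : EHarmonicAt (fun z => G (φ z)) (ψ (φ w)) := by rwa [hψw]
  exact (h'.comp hψ).congr (hr.mono fun z hz => by simp only [hz])

theorem eHarmonicAt_coe_iff {u : ℂ → ℝ} {w : ℂ} :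
    EHarmonicAt (fun z => (u z : EReal)) w ↔ HarmonicAt u w := by
  refine ⟨fun ⟨h, hh, hev⟩ => (harmonicAt_congr_nhds ?_).2 hh, fun h => ⟨u, h, by simp⟩⟩
  filter_upwards [hev] with z hz
  exact_mod_cast hz

/-! ### Maxima of harmonic functions with logarithmic terms -/

/-- A harmonic function with a logarithmic term. -/
noncomputable def logHarm (ρ : ℝ) (H : ℂ → ℝ) (ξ : ℂ) : ℝ := ρ * Real.log ‖ξ‖ + H ξ

theorem harmonicAt_log_norm {ξ : ℂ} (hξ : ξ ≠ 0) : HarmonicAt (fun z : ℂ => Real.log ‖z‖) ξ :=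
  AnalyticAt.harmonicAt_log_norm (f := fun z => z) analyticAt_id hξ

theorem harmonicAt_logHarm {ρ : ℝ} {H : ℂ → ℝ} (hH : HarmonicAt H 0) :
    ∀ᶠ ξ in 𝓝[≠] (0 : ℂ), HarmonicAt (logHarm ρ H) ξ := by
  filter_upwards [nhdsWithin_le_nhds hH.eventually, self_mem_nhdsWithin] with ξ h1 h2
  exact ((harmonicAt_log_norm h2).const_smul (c := ρ)).add h1

theorem tendsto_log_norm : Tendsto (fun ξ : ℂ => Real.log ‖ξ‖) (𝓝[≠] 0) atBot :=
  Real.tendsto_log_nhdsGT_zero.comp tendsto_norm_nhdsNE_zero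

/-- Since `log ‖ξ‖` tends to `-∞`, the term with the smaller coefficient is the larger one near the
origin, whatever the bounded parts are. -/
theorem eventually_logHarm_lt {ρ ρ' : ℝ} {H H' : ℂ → ℝ} (hρ : ρ < ρ') (hH : ContinuousAt H 0)
    (hH' : ContinuousAt H' 0) : ∀ᶠ ξ in 𝓝[≠] (0 : ℂ), logHarm ρ' H' ξ < logHarm ρ H ξ := by
  have h1 : Tendsto (fun ξ : ℂ => (ρ' - ρ) * Real.log ‖ξ‖) (𝓝[≠] 0) atBot :=
    tendsto_log_norm.const_mul_atBot (sub_pos.2 hρ)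
  have h2 : Tendsto (fun ξ : ℂ => H' ξ - H ξ) (𝓝[≠] 0) (𝓝 (H' 0 - H 0)) :=
    (hH'.sub hH).tendsto.mono_left nhdsWithin_le_nhds
  filter_upwards [(h1.atBot_add h2).eventually (eventually_lt_atBot 0)] with ξ hξ
  simp only [logHarm]
  linarith

theorem eventually_nhds_of_eventually_nhdsNE {p : ℂ → Prop} (h : ∀ᶠ ξ in 𝓝[≠] (0 : ℂ), p ξ) :
    ∀ᶠ ξ in 𝓝[≠] (0 : ℂ), ∀ᶠ η in 𝓝 ξ, p η := by
  filter_upwards [eventually_eventually_nhdsWithin.2 h, self_mem_nhdsWithin] with ξ h1 h2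
  rwa [isOpen_compl_singleton.nhdsWithin_eq h2] at h1

/-- Terms with different coefficients never agree near the origin. With equal coefficients the
logarithms cancel and the difference is harmonic at `0` itself: either it vanishes near `0`, or its
zeros form arcs and, by the identity principle on a disc, it vanishes identically near no point of
that disc. -/
theorem logHarm_eq_or_arcs {ρ ρ' : ℝ} {H H' : ℂ → ℝ} (hH : HarmonicAt H 0)
    (hH' : HarmonicAt H' 0) :
    (∀ᶠ ξ in 𝓝[≠] (0 : ℂ), logHarm ρ H =ᶠ[𝓝 ξ] logHarm ρ' H') ∨
    ∃ A : Finset (ℝ → ℝ), (∀ β ∈ A, AnalyticAt ℝ β 0) ∧ ∀ᶠ ξ in 𝓝[≠] (0 : ℂ),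
      (logHarm ρ H ξ = logHarm ρ' H' ξ ↔ ∃ β ∈ A, ξ ∈ arcSet 1 β) ∧
      ¬ logHarm ρ H =ᶠ[𝓝 ξ] logHarm ρ' H' := by
  have hc : ContinuousAt H 0 := hH.1.continuousAt
  have hc' : ContinuousAt H' 0 := hH'.1.continuousAt
  rcases eq_or_ne ρ ρ' with rfl | hρ
  · have hiff : ∀ ξ, logHarm ρ H ξ = logHarm ρ H' ξ ↔ (H - H') ξ = 0 := fun ξ => by
      simp [logHarm, sub_eq_zero]
    have hd : HarmonicAt (H - H') 0 := hH.sub hH'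
    by_cases h0 : ∀ᶠ z in 𝓝 (0 : ℂ), (H - H') z = 0
    · refine Or.inl (nhdsWithin_le_nhds ?_)
      filter_upwards [eventually_eventually_nhds.2 h0] with ξ hξ
      filter_upwards [hξ] with η hη
      exact (hiff η).2 hη
    · obtain ⟨A, hA, hev⟩ := exists_arcs_of_harmonicAt hd h0
      refine Or.inr ⟨A, hA, ?_⟩
      obtain ⟨ε, hε, hball⟩ := Metric.eventually_nhds_iff_ball.1 hd.eventually
      filter_upwards [hev, nhdsWithin_le_nhds (Metric.ball_mem_nhds (0 : ℂ) hε)] with ξ h1 h2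
      refine ⟨by rw [hiff, h1], fun heq => h0 ?_⟩
      have han : AnalyticOnNhd ℝ (H - H') (Metric.ball 0 ε) := fun z hz => HarmonicAt.analyticAt (hball z hz)
      have := han.eqOn_zero_of_preconnected_of_eventuallyEq_zero
        (convex_ball (0 : ℂ) ε).isPreconnected h2 (heq.mono fun η hη => (hiff η).1 hη)
      filter_upwards [Metric.ball_mem_nhds (0 : ℂ) hε] with z hz
      exact this hz
  · refine Or.inr ⟨∅, by simp, ?_⟩
    have hne : ∀ᶠ ξ in 𝓝[≠] (0 : ℂ), logHarm ρ H ξ ≠ logHarm ρ' H' ξ := by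
      rcases hρ.lt_or_gt with h | h
      · exact (eventually_logHarm_lt h hc hc').mono fun ξ hξ => hξ.ne'
      · exact (eventually_logHarm_lt h hc' hc).mono fun ξ hξ => hξ.ne
    filter_upwards [hne] with ξ hξ
    exact ⟨by simpa using hξ, fun h => hξ h.self_of_nhds⟩

theorem tendsto_arcPath {β : ℝ → ℝ} (hβ : AnalyticAt ℝ β 0) :
    Tendsto (arcPath 1 β) (𝓝[>] 0) (𝓝[≠] 0) := by
  refine tendsto_nhdsWithin_iff.2 ⟨?_, ?_⟩
  · have := (continuousAt_arcPath (m := 1) hβ.continuousAt).tendsto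
    rw [arcPath_zero one_ne_zero] at this
    exact this.mono_left nhdsWithin_le_nhds
  · filter_upwards [self_mem_nhdsWithin] with s hs
    exact arcPath_ne_zero hs

theorem analyticAt_arcPath {β : ℝ → ℝ} (m : ℕ) (hβ : AnalyticAt ℝ β 0) :
    AnalyticAt ℝ (arcPath m β) 0 := by
  have e1 : AnalyticAt ℝ (fun s : ℝ => (s : ℂ)) 0 := Complex.ofRealCLM.analyticAt _
  have e2 : AnalyticAt ℝ (fun s : ℝ => (β s : ℂ)) 0 := (Complex.ofRealCLM.analyticAt _).comp hβ
  have e3 : ∀ w : ℂ, AnalyticAt ℝ Complex.exp w := fun w =>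
    (analyticAt_cexp (z := w)).restrictScalars
  exact (e1.pow m).mul ((e3 _).fun_comp (e2.mul analyticAt_const))

/-- Either the logarithms decide the comparison, or they cancel and the difference along the arc is
an analytic function of one real variable, whose sign stabilizes. -/
theorem exists_eventually_logHarm_le_iff {ρ ρ' : ℝ} {H H' : ℂ → ℝ} (hH : HarmonicAt H 0)
    (hH' : HarmonicAt H' 0) {β : ℝ → ℝ} (hβ : AnalyticAt ℝ β 0) :
    ∃ b : Prop, ∀ᶠ s in 𝓝[>] (0 : ℝ),
      (logHarm ρ' H' (arcPath 1 β s) ≤ logHarm ρ H (arcPath 1 β s) ↔ b) := by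
  have hc : ContinuousAt H 0 := hH.1.continuousAt
  have hc' : ContinuousAt H' 0 := hH'.1.continuousAt
  rcases lt_trichotomy ρ ρ' with h | rfl | h
  · refine ⟨True, ?_⟩
    filter_upwards [(tendsto_arcPath hβ).eventually (eventually_logHarm_lt h hc hc')] with s hs
    simpa using hs.le
  · have han : AnalyticAt ℝ (fun s => (H - H') (arcPath 1 β s)) 0 := by
      refine AnalyticAt.fun_comp (g := H - H') ?_ (analyticAt_arcPath 1 hβ)
      rw [arcPath_zero one_ne_zero]
      exact HarmonicAt.analyticAt (hH.sub hH')
    obtain ⟨σ, hσ⟩ := exists_eventually_sign_eq han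
    refine ⟨0 ≤ σ, ?_⟩
    filter_upwards [hσ] with s hs
    rw [← hs, sign_nonneg_iff]
    simp [logHarm, sub_nonneg]
  · refine ⟨False, ?_⟩
    filter_upwards [(tendsto_arcPath hβ).eventually (eventually_logHarm_lt h hc' hc)] with s hs
    simpa using hs

variable {J : Type*} [Fintype J] [Nonempty J]

/-- The maximum of finitely many harmonic functions with logarithmic terms. -/
noncomputable def maxLogHarm (ρ : J → ℝ) (H : J → ℂ → ℝ) (ξ : ℂ) : ℝ :=
  Finset.univ.sup' Finset.univ_nonempty fun j => logHarm (ρ j) (H j) ξ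

/-- Each term is a lower barrier for the maximum; together with harmonicity this allows the maximum
principle to be applied to their difference. -/
theorem logHarm_le_maxLogHarm (ρ : J → ℝ) (H : J → ℂ → ℝ) (ξ : ℂ) (j : J) :
    logHarm (ρ j) (H j) ξ ≤ maxLogHarm ρ H ξ :=
  Finset.le_sup' (fun j => logHarm (ρ j) (H j) ξ) (Finset.mem_univ j)

theorem exists_logHarm_eq_maxLogHarm (ρ : J → ℝ) (H : J → ℂ → ℝ) (ξ : ℂ) :
    ∃ j, logHarm (ρ j) (H j) ξ = maxLogHarm ρ H ξ := by
  obtain ⟨j, -, hj⟩ := Finset.exists_mem_eq_sup' Finset.univ_nonempty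
    fun j => logHarm (ρ j) (H j) ξ
  exact ⟨j, hj.symm⟩

theorem maxLogHarm_le_iff {ρ : J → ℝ} {H : J → ℂ → ℝ} {ξ : ℂ} {a : ℝ} :
    maxLogHarm ρ H ξ ≤ a ↔ ∀ j, logHarm (ρ j) (H j) ξ ≤ a := by
  simp [maxLogHarm, Finset.sup'_le_iff]

theorem coe_maxLogHarm (ρ : J → ℝ) (H : J → ℂ → ℝ) (ξ : ℂ) :
    ((maxLogHarm ρ H ξ : ℝ) : EReal) = ⨆ j, ((logHarm (ρ j) (H j) ξ : ℝ) : EReal) := by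
  refine le_antisymm ?_ (iSup_le fun j => EReal.coe_le_coe_iff.2 (logHarm_le_maxLogHarm ρ H ξ j))
  obtain ⟨j, hj⟩ := exists_logHarm_eq_maxLogHarm ρ H ξ
  rw [← hj]
  exact le_iSup (fun j => ((logHarm (ρ j) (H j) ξ : ℝ) : EReal)) j

/-- A term attaining a harmonic maximum agrees with the maximum nearby. -/
theorem eventuallyEq_of_harmonicAt_maxLogHarm {ρ : J → ℝ} {H : J → ℂ → ℝ} {ξ : ℂ} {j : J}
    (hM : HarmonicAt (maxLogHarm ρ H) ξ) (hj : HarmonicAt (logHarm (ρ j) (H j)) ξ)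
    (heq : logHarm (ρ j) (H j) ξ = maxLogHarm ρ H ξ) :
    logHarm (ρ j) (H j) =ᶠ[𝓝 ξ] maxLogHarm ρ H := by
  have h := eventually_eq_of_isLocalMax (hj.sub hM) (Eventually.of_forall fun z => by
    simp only [Pi.sub_apply, heq, sub_self, sub_nonpos]
    exact logHarm_le_maxLogHarm ρ H z j)
  filter_upwards [h] with z hz
  simp only [Pi.sub_apply, heq, sub_self, sub_eq_zero] at hz
  exact hz

/-- The maximum is harmonic where all maximal terms agree nearby. -/
theorem harmonicAt_maxLogHarm {ρ : J → ℝ} {H : J → ℂ → ℝ} {ξ : ℂ}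
    (hU : ∀ j, HarmonicAt (logHarm (ρ j) (H j)) ξ)
    (hact : ∀ i j, logHarm (ρ i) (H i) ξ = maxLogHarm ρ H ξ →
      logHarm (ρ j) (H j) ξ = maxLogHarm ρ H ξ →
      logHarm (ρ i) (H i) =ᶠ[𝓝 ξ] logHarm (ρ j) (H j)) :
    HarmonicAt (maxLogHarm ρ H) ξ := by
  obtain ⟨i, hi⟩ := exists_logHarm_eq_maxLogHarm ρ H ξ
  refine (harmonicAt_congr_nhds ?_).2 (hU i)
  have hle : ∀ᶠ z in 𝓝 ξ, ∀ j, logHarm (ρ j) (H j) z ≤ logHarm (ρ i) (H i) z := by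
    refine eventually_all.2 fun j => ?_
    rcases (logHarm_le_maxLogHarm ρ H ξ j).eq_or_lt with h | h
    · exact (hact j i h hi).le
    · rw [← hi] at h
      exact ((hU j).1.continuousAt.eventually_lt (hU i).1.continuousAt h).mono fun z hz => hz.le
  filter_upwards [hle] with z hz
  exact le_antisymm (maxLogHarm_le_iff.2 hz) (logHarm_le_maxLogHarm ρ H z i)

/-- The points where the maximum is not harmonic form finitely many arcs. -/
theorem exists_arcs_maxLogHarm {ρ : J → ℝ} {H : J → ℂ → ℝ} (hH : ∀ j, HarmonicAt (H j) 0) :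
    ∃ A : Finset (ℝ → ℝ), (∀ β ∈ A, AnalyticAt ℝ β 0) ∧ ∀ᶠ ξ in 𝓝[≠] (0 : ℂ),
      (¬ HarmonicAt (maxLogHarm ρ H) ξ ↔ ∃ β ∈ A, ξ ∈ arcSet 1 β) := by
  classical
  set U : J → ℂ → ℝ := fun j => logHarm (ρ j) (H j) with hUdef
  -- Terms that agree near the origin must not contribute arcs; they are separated here from the
  -- pairs whose coincidence set is a finite union of arcs.
  set rel : J → J → Prop := fun i j => ∀ᶠ ξ in 𝓝[≠] (0 : ℂ), U i =ᶠ[𝓝 ξ] U j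
  have hpair : ∀ i j, ∃ A : Finset (ℝ → ℝ), (∀ β ∈ A, AnalyticAt ℝ β 0) ∧
      (¬ rel i j → ∀ᶠ ξ in 𝓝[≠] (0 : ℂ), (U i ξ = U j ξ ↔ ∃ β ∈ A, ξ ∈ arcSet 1 β) ∧
        ¬ U i =ᶠ[𝓝 ξ] U j) := fun i j => by
    rcases logHarm_eq_or_arcs (ρ := ρ i) (ρ' := ρ j) (hH i) (hH j) with h | ⟨A, hA, h⟩
    · exact ⟨∅, by simp, fun hn => (hn h).elim⟩
    · exact ⟨A, hA, fun _ => h⟩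
  choose A hA hAev using hpair
  -- A term is active on an arc if it realizes the maximum near its end point. Comparisons stabilize
  -- along arcs, so near the end point each term is either always or never maximal.
  set act : J → (ℝ → ℝ) → Prop := fun i β =>
    ∀ᶠ s in 𝓝[>] (0 : ℝ), U i (arcPath 1 β s) = maxLogHarm ρ H (arcPath 1 β s)
  have hact : ∀ i β, AnalyticAt ℝ β 0 → ∀ᶠ s in 𝓝[>] (0 : ℝ),
      (U i (arcPath 1 β s) = maxLogHarm ρ H (arcPath 1 β s) ↔ act i β) := fun i β hβ => by
    have h1 : ∀ k, ∃ b : Prop, ∀ᶠ s in 𝓝[>] (0 : ℝ),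
        (U k (arcPath 1 β s) ≤ U i (arcPath 1 β s) ↔ b) := fun k =>
      exists_eventually_logHarm_le_iff (hH i) (hH k) hβ
    choose b hb using h1
    have h2 : ∀ᶠ s in 𝓝[>] (0 : ℝ),
        (U i (arcPath 1 β s) = maxLogHarm ρ H (arcPath 1 β s) ↔ ∀ k, b k) := by
      filter_upwards [eventually_all.2 hb] with s hs
      rw [← forall_congr' hs, ← maxLogHarm_le_iff]
      exact ⟨fun h => h.ge, fun h => le_antisymm (logHarm_le_maxLogHarm ρ H _ i) h⟩
    have h3 : act i β ↔ ∀ k, b k := by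
      refine ⟨fun h => ?_, fun h => h2.mono fun s hs => hs.2 h⟩
      obtain ⟨s, hs1, hs2⟩ := (h.and h2).exists
      exact hs2.1 hs1
    exact h2.mono fun s hs => hs.trans h3.symm
  have hact' : ∀ i β, AnalyticAt ℝ β 0 → ∀ᶠ ξ in 𝓝[≠] (0 : ℂ), ξ ∈ arcSet 1 β →
      (U i ξ = maxLogHarm ρ H ξ ↔ act i β) := fun i β hβ => by
    filter_upwards [(tendsto_norm_rpow one_ne_zero).eventually (hact i β hβ)] with ξ h1 h2
    rwa [← eq_arcPath_of_mem_arcSet one_ne_zero h2] at h1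
  -- Only those coincidence arcs are kept on which both terms of a distinct pair are maximal.
  set B : J × J → Finset (ℝ → ℝ) := fun p =>
    if rel p.1 p.2 then ∅ else (A p.1 p.2).filter fun β => act p.1 β ∧ act p.2 β with hB
  refine ⟨Finset.univ.biUnion B, ?_, ?_⟩
  · intro β hβ
    obtain ⟨p, -, hp⟩ := Finset.mem_biUnion.1 hβ
    simp only [hB] at hp
    split_ifs at hp with h
    · simp at hp
    · exact hA _ _ β (Finset.mem_filter.1 hp).1
  have e1 : ∀ᶠ ξ in 𝓝[≠] (0 : ℂ), ∀ i, HarmonicAt (U i) ξ :=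
    eventually_all.2 fun i => harmonicAt_logHarm (hH i)
  have e2 : ∀ᶠ ξ in 𝓝[≠] (0 : ℂ), ∀ i j, rel i j → U i =ᶠ[𝓝 ξ] U j := by
    refine eventually_all.2 fun i => eventually_all.2 fun j => ?_
    by_cases h : rel i j
    · exact h.mono fun ξ hξ _ => hξ
    · exact Eventually.of_forall fun ξ h' => (h h').elim
  have e3 : ∀ᶠ ξ in 𝓝[≠] (0 : ℂ), ∀ i j, ¬ rel i j →
      (U i ξ = U j ξ ↔ ∃ β ∈ A i j, ξ ∈ arcSet 1 β) ∧ ¬ U i =ᶠ[𝓝 ξ] U j := by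
    refine eventually_all.2 fun i => eventually_all.2 fun j => ?_
    by_cases h : rel i j
    · exact Eventually.of_forall fun ξ h' => (h' h).elim
    · exact (hAev i j h).mono fun ξ hξ _ => hξ
  have e4 : ∀ᶠ ξ in 𝓝[≠] (0 : ℂ), ∀ i j k, ∀ β ∈ A i j, ξ ∈ arcSet 1 β →
      (U k ξ = maxLogHarm ρ H ξ ↔ act k β) := by
    refine eventually_all.2 fun i => eventually_all.2 fun j => eventually_all.2 fun k => ?_
    rw [Filter.eventually_all_finset]
    exact fun β hβ => hact' k β (hA i j β hβ)
  filter_upwards [e1, e2, e3, e4] with ξ h1 h2 h3 h4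
  constructor
  · intro hn
    have : ∃ i j, U i ξ = maxLogHarm ρ H ξ ∧ U j ξ = maxLogHarm ρ H ξ ∧ ¬ rel i j := by
      by_contra! hcon
      exact hn (harmonicAt_maxLogHarm h1 fun i j hi hj => h2 i j (hcon i j hi hj))
    obtain ⟨i, j, hi, hj, hij⟩ := this
    obtain ⟨β, hβ, hξ⟩ := (h3 i j hij).1.1 (hi.trans hj.symm)
    refine ⟨β, Finset.mem_biUnion.2 ⟨(i, j), Finset.mem_univ _, ?_⟩, hξ⟩
    simp only [hB, if_neg hij, Finset.mem_filter]
    exact ⟨hβ, (h4 i j i β hβ hξ).1 hi, (h4 i j j β hβ hξ).1 hj⟩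
  · rintro ⟨β, hβ, hξ⟩ hharm
    obtain ⟨⟨i, j⟩, -, hp⟩ := Finset.mem_biUnion.1 hβ
    simp only [hB] at hp
    split_ifs at hp with hij
    · simp at hp
    rw [Finset.mem_filter] at hp
    -- If the maximum were harmonic at such a point, both maximal terms would coincide with it
    -- nearby, hence with each other, which is excluded for a distinct pair.
    have hi := (h4 i j i β hp.1 hξ).2 hp.2.1
    have hj := (h4 i j j β hp.1 hξ).2 hp.2.2
    exact (h3 i j hij).2 ((eventuallyEq_of_harmonicAt_maxLogHarm hharm (h1 i) hi).trans
      (eventuallyEq_of_harmonicAt_maxLogHarm hharm (h1 j) hj).symm)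

/-! ### Descent along the power map -/

theorem isOpenMap_pow {m : ℕ} (hm : m ≠ 0) : IsOpenMap fun ξ : ℂ => ξ ^ m := by
  have han : AnalyticOnNhd ℂ (fun ξ : ℂ => ξ ^ m) univ := fun ξ _ => analyticAt_id.pow m
  rcases han.is_constant_or_isOpen isPreconnected_univ with ⟨w, hw⟩ | h
  · have h0 := hw 0 (mem_univ _)
    have h1 := hw 1 (mem_univ _)
    simp [hm] at h0 h1
    exact (zero_ne_one (h0.trans h1.symm)).elim
  · exact fun s hs => h s (subset_univ s) hs

theorem isPreconnected_puncturedBall {ε : ℝ} :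
    IsPreconnected (Metric.ball (0 : ℂ) ε \ {0}) := by
  have : Metric.ball (0 : ℂ) ε \ {0} =
      (fun p : ℝ × ℝ => arcPath 1 (fun _ => p.2) p.1) '' (Ioo 0 ε ×ˢ univ) := by
    ext z
    constructor
    · rintro ⟨hz, hz0⟩
      refine ⟨(‖z‖, Complex.arg z), ⟨⟨norm_pos_iff.2 hz0, by simpa using hz⟩, mem_univ _⟩, ?_⟩
      simp [arcPath, Complex.norm_mul_exp_arg_mul_I]
    · rintro ⟨⟨s, θ⟩, ⟨hs, -⟩, rfl⟩
      refine ⟨?_, arcPath_ne_zero hs.1⟩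
      dsimp only
      rw [mem_ball_zero_iff, norm_arcPath hs.1.le, pow_one]
      exact hs.2
  rw [this]
  refine (isPreconnected_Ioo.prod isPreconnected_univ).image _ (Continuous.continuousOn ?_)
  unfold arcPath
  fun_prop

/-- A term that is maximal at one point agrees with the harmonic maximum near that point, and the
identity principle propagates the equality over the connected punctured disc. -/
theorem exists_eventually_maxLogHarm_eq {J : Type*} [Fintype J] [Nonempty J] {ρ : J → ℝ}
    {H : J → ℂ → ℝ} (hH : ∀ j, HarmonicAt (H j) 0)
    (hM : ∀ᶠ ξ in 𝓝[≠] (0 : ℂ), HarmonicAt (maxLogHarm ρ H) ξ) :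
    ∃ j, ∀ᶠ ξ in 𝓝[≠] (0 : ℂ), maxLogHarm ρ H ξ = logHarm (ρ j) (H j) ξ := by
  have hU : ∀ᶠ ξ in 𝓝[≠] (0 : ℂ), ∀ j, HarmonicAt (logHarm (ρ j) (H j)) ξ :=
    eventually_all.2 fun j => harmonicAt_logHarm (hH j)
  have hev := hM.and hU
  rw [eventually_nhdsWithin_iff] at hev
  obtain ⟨ε, hε, hball⟩ := Metric.eventually_nhds_iff_ball.1 hev
  have hmem : ((ε / 2 : ℝ) : ℂ) ∈ Metric.ball (0 : ℂ) ε \ {0} := by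
    refine ⟨?_, by simpa using hε.ne'⟩
    rw [mem_ball_zero_iff, Complex.norm_real, Real.norm_of_nonneg (by positivity)]
    exact half_lt_self hε
  obtain ⟨j, hj⟩ := exists_logHarm_eq_maxLogHarm ρ H ((ε / 2 : ℝ) : ℂ)
  have h0 := hball _ hmem.1 hmem.2
  have heq := eventuallyEq_of_harmonicAt_maxLogHarm h0.1 (h0.2 j) hj
  have han : AnalyticOnNhd ℝ (maxLogHarm ρ H - logHarm (ρ j) (H j)) (Metric.ball 0 ε \ {0}) :=
    fun z hz => HarmonicAt.analyticAt ((hball z hz.1 hz.2).1.sub ((hball z hz.1 hz.2).2 j))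
  have hz := han.eqOn_zero_of_preconnected_of_eventuallyEq_zero isPreconnected_puncturedBall hmem
    (heq.mono fun z hz => by simp [hz])
  refine ⟨j, ?_⟩
  filter_upwards [nhdsWithin_le_nhds (Metric.ball_mem_nhds (0 : ℂ) hε), self_mem_nhdsWithin]
    with ξ h1 h2
  exact sub_eq_zero.1 (hz ⟨h1, h2⟩)

/-- A function is harmonic if its pullback under a power map is. -/
theorem harmonicAt_of_comp_pow {m : ℕ} (hm : m ≠ 0) {G H : ℂ → ℝ} (hH : HarmonicAt H 0)
    (hG : ∀ᶠ ξ in 𝓝 (0 : ℂ), G (ξ ^ m) = H ξ) : HarmonicAt G 0 := by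
  obtain ⟨F, hF, hre⟩ := exists_analyticAt_re_eq hH
  obtain ⟨ε, hε, hball⟩ := Metric.eventually_nhds_iff_ball.1
    (hF.eventually_analyticAt.and (hre.and hG))
  set ζ : ℂ := Complex.exp (2 * Real.pi * Complex.I / m) with hζ
  have hprim : IsPrimitiveRoot ζ m := Complex.isPrimitiveRoot_exp m hm
  have hζn : ∀ k : ℕ, ‖ζ ^ k‖ = 1 := fun k => by
    rw [norm_pow, hprim.norm'_eq_one hm, one_pow]
  -- Averaging over the rotations by `m`-th roots of unity leaves the real part unchanged, because
  -- `G (ξ ^ m)` is invariant, and makes the holomorphic function invariant too.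
  set F₁ : ℂ → ℂ := fun ξ => (m : ℂ)⁻¹ * ∑ k ∈ Finset.range m, F (ζ ^ k * ξ) with hF₁
  -- The same average, written as a sum over all `m`-th roots of `z`, is a function of `z` alone and
  -- needs no choice of root.
  set R : ℂ → ℂ := fun z => (m : ℂ)⁻¹ * ((Polynomial.nthRoots m z).map F).sum with hR
  have hRF : ∀ ξ, R (ξ ^ m) = F₁ ξ := fun ξ => by
    simp only [hR, hF₁, hprim.nthRoots_eq (rfl : ξ ^ m = ξ ^ m), Multiset.map_map]
    rfl
  have hmem : ∀ ξ ∈ Metric.ball (0 : ℂ) ε, ∀ k : ℕ, ζ ^ k * ξ ∈ Metric.ball (0 : ℂ) ε :=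
    fun ξ hξ k => by
      rw [mem_ball_zero_iff] at hξ ⊢
      rwa [norm_mul, hζn, one_mul]
  have hF₁an : ∀ ξ ∈ Metric.ball (0 : ℂ) ε, AnalyticAt ℂ F₁ ξ := fun ξ hξ => by
    refine analyticAt_const.mul (Finset.analyticAt_fun_sum _ fun k _ => ?_)
    exact AnalyticAt.fun_comp (hball _ (hmem ξ hξ k)).1 (analyticAt_const.mul analyticAt_id)
  have hF₁re : ∀ ξ ∈ Metric.ball (0 : ℂ) ε, (F₁ ξ).re = G (ξ ^ m) := fun ξ hξ => by
    have h1 : ∀ k ∈ Finset.range m, (F (ζ ^ k * ξ)).re = G (ξ ^ m) := fun k _ => by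
      obtain ⟨-, h1, h2⟩ := hball _ (hmem ξ hξ k)
      rw [← h1, ← h2, mul_pow, ← pow_mul, mul_comm k m, pow_mul, hprim.pow_eq_one, one_pow, one_mul]
    have h2 : (m : ℂ)⁻¹ = ((m : ℝ)⁻¹ : ℝ) := by push_cast; rfl
    simp only [hF₁]
    rw [h2, Complex.re_ofReal_mul, Complex.re_sum, Finset.sum_congr rfl h1, Finset.sum_const,
      Finset.card_range, nsmul_eq_mul, inv_mul_cancel_left₀ (by exact_mod_cast hm)]
  have hnhds : ∀ {p : ℂ → Prop}, (∀ ξ ∈ Metric.ball (0 : ℂ) ε, p (ξ ^ m)) →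
      ∀ᶠ z in 𝓝 (0 : ℂ), p z := fun {p} hp => by
    have h := (isOpenMap_pow hm).image_mem_nhds (Metric.ball_mem_nhds (0 : ℂ) hε)
    rw [zero_pow hm] at h
    filter_upwards [h]
    rintro _ ⟨ξ, hξ, rfl⟩
    exact hp ξ hξ
  -- Off the origin the power map has holomorphic local inverses; at the origin `R` is continuous
  -- because the power map is open, so the singularity is removable.
  have hRan : AnalyticAt ℂ R 0 := by
    refine Complex.analyticAt_of_differentiable_on_punctured_nhds_of_continuousAt ?_ ?_
    · rw [eventually_nhdsWithin_iff]
      refine hnhds fun ξ hξ hne => ?_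
      have hξ0 : ξ ≠ 0 := fun h => hne (by simp [h, hm])
      have hd : deriv (fun ξ : ℂ => ξ ^ m) ξ ≠ 0 := by
        simp [hm, hξ0]
      obtain ⟨ψ, hψ, hψξ, hr, -⟩ := exists_analytic_localInverse (analyticAt_id.pow m) hd
      have hc : AnalyticAt ℂ (fun z => F₁ (ψ z)) (ξ ^ m) := by
        refine AnalyticAt.fun_comp (g := F₁) ?_ hψ
        rw [show ψ (ξ ^ m) = ξ from hψξ]
        exact hF₁an ξ hξ
      refine hc.differentiableAt.congr_of_eventuallyEq ?_
      filter_upwards [hr] with z hz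
      rw [← hRF]
      exact congrArg R hz.symm
    · have hle : 𝓝 (0 : ℂ) ≤ map (fun ξ : ℂ => ξ ^ m) (𝓝 0) := by
        simpa [hm] using (isOpenMap_pow hm).nhds_le 0
      have h0 : R 0 = F₁ 0 := by rw [← hRF, zero_pow hm]
      have : Tendsto R (map (fun ξ : ℂ => ξ ^ m) (𝓝 0)) (𝓝 (R 0)) := by
        rw [tendsto_map'_iff, h0]
        exact (hF₁an 0 (Metric.mem_ball_self hε)).continuousAt.tendsto.congr fun ξ => (hRF ξ).symm
      exact this.mono_left hle
  refine (harmonicAt_congr_nhds ?_).2 hRan.harmonicAt_re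
  refine hnhds fun ξ hξ => ?_
  dsimp only
  rw [hRF, hF₁re ξ hξ]

/-- Arcs are mapped to arcs by the power map. -/
theorem arcs_of_comp_pow {m : ℕ} (hm : m ≠ 0) {T : Set ℂ} {A : Finset (ℝ → ℝ)}
    (hA : ∀ β ∈ A, AnalyticAt ℝ β 0)
    (hT : ∀ᶠ ξ in 𝓝[≠] (0 : ℂ), (ξ ^ m ∈ T ↔ ∃ β ∈ A, ξ ∈ arcSet 1 β)) :
    ∃ B : Finset (ℝ → ℝ), (∀ β ∈ B, AnalyticAt ℝ β 0) ∧
      ∀ᶠ z in 𝓝[≠] (0 : ℂ), (z ∈ T ↔ ∃ β ∈ B, z ∈ arcSet m β) := by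
  classical
  -- Raising `s * exp (i β s)` to the power `m` multiplies the angle by `m`, and the old radius `s`
  -- becomes the `m`-th root of the new one.
  refine ⟨A.image fun β s => m * β s, ?_, ?_⟩
  · intro b hb
    obtain ⟨β, hβ, rfl⟩ := Finset.mem_image.1 hb
    exact analyticAt_const.mul (hA β hβ)
  rw [eventually_nhdsWithin_iff] at hT ⊢
  obtain ⟨ε, hε, hball⟩ := Metric.eventually_nhds_iff_ball.1 hT
  have hpow : ∀ (β : ℝ → ℝ) (s : ℝ), (arcPath 1 β s) ^ m = arcPath m (fun s => m * β s) s :=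
    fun β s => by
      simp only [arcPath, pow_one, mul_pow, ← Complex.exp_nat_mul]
      push_cast
      ring_nf
  filter_upwards [Metric.ball_mem_nhds (0 : ℂ) (pow_pos hε m)] with z hz hz0
  have hlt : ∀ ξ : ℂ, ‖ξ‖ ^ m = ‖z‖ → ξ ∈ Metric.ball (0 : ℂ) ε := fun ξ hξ => by
    rw [mem_ball_zero_iff] at hz ⊢
    exact lt_of_pow_lt_pow_left₀ m hε.le (by rwa [hξ])
  simp only [Finset.mem_image, exists_exists_and_eq_and]
  constructor
  · intro hzT
    obtain ⟨ξ, rfl⟩ := IsAlgClosed.exists_pow_nat_eq z (Nat.pos_of_ne_zero hm)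
    have hξ0 : ξ ≠ 0 := fun h => hz0 (by simp [h, hm])
    obtain ⟨β, hβ, hmem⟩ := (hball ξ (hlt ξ (norm_pow ξ m).symm) hξ0).1 hzT
    refine ⟨β, hβ, ?_⟩
    have hs : 0 < ‖ξ‖ ^ (1 / (1 : ℕ) : ℝ) := by simpa using hξ0
    rw [eq_arcPath_of_mem_arcSet one_ne_zero hmem, hpow]
    exact arcPath_mem_arcSet hm hs
  · rintro ⟨β, hβ, hmem⟩
    have hzn : 0 < ‖z‖ := norm_pos_iff.2 hz0
    have hs : 0 < ‖z‖ ^ (1 / m : ℝ) := by positivity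
    have hξ := arcPath_mem_arcSet (m := 1) (β := β) one_ne_zero hs
    have e := eq_arcPath_of_mem_arcSet hm hmem
    rw [← hpow] at e
    have := (hball (arcPath 1 β (‖z‖ ^ (1 / m : ℝ))) (hlt _ (by rw [← norm_pow, ← e]))
      (arcPath_ne_zero hs)).2 ⟨β, hβ, hξ⟩
    rwa [← e] at this

/-- Holomorphic functions are powers in suitable coordinates. -/
theorem exists_pow_normalForm {p : ℂ → ℂ} {a : ℂ} (hp : AnalyticAt ℂ p a) (h0 : p a = 0)
    (hne : ¬ ∀ᶠ w in 𝓝 a, p w = 0) :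
    ∃ k : ℕ, k ≠ 0 ∧ ∃ ψ : ℂ → ℂ, AnalyticAt ℂ ψ 0 ∧ ψ 0 = a ∧ deriv ψ 0 ≠ 0 ∧
      map ψ (𝓝 0) = 𝓝 a ∧ ∀ᶠ t in 𝓝 (0 : ℂ), p (ψ t) = t ^ k := by
  obtain ⟨k, e, he, he0, hpe⟩ := hp.exists_eventuallyEq_pow_smul_nonzero_iff.2 hne
  have hk : k ≠ 0 := by
    rintro rfl
    have := hpe.self_of_nhds
    simp only [h0, pow_zero, one_smul] at this
    exact he0 this.symm
  obtain ⟨r, hr⟩ := IsAlgClosed.exists_pow_nat_eq (e a) (Nat.pos_of_ne_zero hk)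
  have hr0 : r ≠ 0 := fun h => he0 (by rw [← hr, h, zero_pow hk])
  -- A holomorphic `k`-th root of the unit `e`, obtained from the logarithm of `e w / e a`, which is
  -- near `1`.
  set E : ℂ → ℂ := fun w => r * Complex.exp (Complex.log (e w / e a) / k) with hE
  have hq : AnalyticAt ℂ (fun w => e w / e a) a := he.div analyticAt_const he0
  have hEan : AnalyticAt ℂ E a := by
    refine analyticAt_const.mul (AnalyticAt.cexp (AnalyticAt.div ?_ analyticAt_const
      (by exact_mod_cast hk)))
    exact hq.clog (by rw [div_self he0]; exact Complex.one_mem_slitPlane)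
  have hEa : E a = r := by simp [hE, div_self he0]
  have hEk : ∀ᶠ w in 𝓝 a, E w ^ k = e w := by
    filter_upwards [he.continuousAt.eventually_ne he0] with w hw
    simp only [hE]
    rw [mul_pow, hr, ← Complex.exp_nat_mul, mul_div_cancel₀ _ (by exact_mod_cast hk),
      Complex.exp_log (div_ne_zero hw he0), mul_div_cancel₀ _ he0]
  -- The new coordinate, in which `p = Z ^ k`; the required `ψ` is its local inverse.
  set Z : ℂ → ℂ := fun w => (w - a) * E w with hZ
  have hZan : AnalyticAt ℂ Z a := (analyticAt_id.sub analyticAt_const).mul hEan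
  have hZa : Z a = 0 := by simp [hZ]
  have hZd : deriv Z a = r := by
    have h1 : HasDerivAt Z (1 * E a + (a - a) * deriv E a) a :=
      ((hasDerivAt_id a).sub_const a).mul hEan.differentiableAt.hasDerivAt
    rw [h1.deriv, hEa]
    ring
  obtain ⟨ψ, hψ, hψa, hright, hleft⟩ := exists_analytic_localInverse hZan (by rw [hZd]; exact hr0)
  rw [hZa] at hψ hψa hright
  have hder : deriv ψ 0 ≠ 0 := by
    intro hd
    have h1 : HasDerivAt ψ (deriv ψ 0) (Z a) := by
      rw [hZa]; exact hψ.differentiableAt.hasDerivAt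
    have h2 := h1.comp a hZan.differentiableAt.hasDerivAt
    have h3 : HasDerivAt (ψ ∘ Z) 1 a := (hasDerivAt_id a).congr_of_eventuallyEq hleft
    have := h2.unique h3
    simp [hd] at this
  refine ⟨k, hk, ψ, hψ, hψa, hder, ?_, ?_⟩
  · have := hψ.hasStrictDerivAt.map_nhds_eq hder
    rwa [hψa] at this
  · have hψt : Tendsto ψ (𝓝 0) (𝓝 a) := by
      have := hψ.continuousAt.tendsto
      rwa [hψa] at this
    filter_upwards [hright, hψt.eventually (hpe.and hEk)] with t h1 ⟨h2, h3⟩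
    rw [h2, smul_eq_mul, ← h3, ← mul_pow]
    exact congrArg (· ^ k) h1

/-! ### Coordinates on Riemann surfaces -/

section Charts

variable {X X' : Type*} [TopologicalSpace X] [ChartedSpace ℂ X]
  [TopologicalSpace X'] [ChartedSpace ℂ X']

theorem analyticAt_inCharts {ν : X → X'} (hν : MDifferentiable 𝓘(ℂ) 𝓘(ℂ) ν)
    {e : OpenPartialHomeomorph X ℂ} (he : e ∈ IsManifold.maximalAtlas 𝓘(ℂ) ω X)
    {e' : OpenPartialHomeomorph X' ℂ} (he' : e' ∈ IsManifold.maximalAtlas 𝓘(ℂ) ω X') {y : X}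
    (hy : y ∈ e.source) (hy' : ν y ∈ e'.source) :
    AnalyticAt ℂ (fun w => e' (ν (e.symm w))) (e y) := by
  have hν' : Continuous ν := hν.continuous
  have hev : ∀ᶠ w in 𝓝 (e y), w ∈ e.target ∧ ν (e.symm w) ∈ e'.source := by
    have h1 := e.open_target.mem_nhds (e.map_source hy)
    have h2 : Tendsto (fun w => ν (e.symm w)) (𝓝 (e y)) (𝓝 (ν y)) :=
      (hν'.tendsto y).comp (e.tendsto_symm hy)
    exact Filter.Eventually.and h1 (h2.eventually (e'.open_source.mem_nhds hy'))
  refine Complex.analyticAt_iff_eventually_differentiableAt.2 (hev.mono fun w hw => ?_)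
  have h1 : MDifferentiableAt 𝓘(ℂ) 𝓘(ℂ) e.symm w :=
    (contMDiffAt_symm_of_mem_maximalAtlas he hw.1).mdifferentiableAt (by simp)
  have h2 : MDifferentiableAt 𝓘(ℂ) 𝓘(ℂ) e' (ν (e.symm w)) :=
    (contMDiffAt_of_mem_maximalAtlas he' hw.2).mdifferentiableAt (by simp)
  exact (h2.comp w ((hν _).comp w h1)).differentiableAt

theorem analyticAt_transition {e e' : OpenPartialHomeomorph X ℂ}
    (he : e ∈ IsManifold.maximalAtlas 𝓘(ℂ) ω X) (he' : e' ∈ IsManifold.maximalAtlas 𝓘(ℂ) ω X)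
    {x : X} (hx : x ∈ e.source) (hx' : x ∈ e'.source) :
    AnalyticAt ℂ (fun w => e' (e.symm w)) (e x) :=
  analyticAt_inCharts (ν := fun x => x) mdifferentiable_id he he' hx hx'

theorem eventually_transition_symm {X : Type*} [TopologicalSpace X]
    {e e' : OpenPartialHomeomorph X ℂ} {x : X} (hx : x ∈ e.source) (hx' : x ∈ e'.source) :
    ∀ᶠ w in 𝓝 (e x), w ∈ e.target ∧ e'.symm (e' (e.symm w)) = e.symm w := by
  have h1 := e.open_target.mem_nhds (e.map_source hx)
  have h2 := (e.tendsto_symm hx).eventually (e'.open_source.mem_nhds hx')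
  filter_upwards [h1, h2] with w hw1 hw2
  exact ⟨hw1, e'.left_inv hw2⟩

theorem deriv_transition_ne_zero {e e' : OpenPartialHomeomorph X ℂ}
    (he : e ∈ IsManifold.maximalAtlas 𝓘(ℂ) ω X) (he' : e' ∈ IsManifold.maximalAtlas 𝓘(ℂ) ω X)
    {x : X} (hx : x ∈ e.source) (hx' : x ∈ e'.source) :
    deriv (fun w => e' (e.symm w)) (e x) ≠ 0 := by
  have h1 := (analyticAt_transition he he' hx hx').differentiableAt.hasDerivAt
  have h2 : HasDerivAt (fun w => e (e'.symm w)) (deriv (fun w => e (e'.symm w)) (e' x))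
      (e' (e.symm (e x))) := by
    rw [e.left_inv hx]
    exact (analyticAt_transition he' he hx' hx).differentiableAt.hasDerivAt
  have h3 := h2.comp (e x) h1
  have h4 : HasDerivAt ((fun w => e (e'.symm w)) ∘ fun w => e' (e.symm w)) 1 (e x) := by
    refine (hasDerivAt_id (e x)).congr_of_eventuallyEq ?_
    filter_upwards [eventually_transition_symm hx hx'] with w hw
    simp only [Function.comp_apply, hw.2, e.right_inv hw.1, id]
  intro h0
  have := h3.unique h4
  simp [h0] at this

theorem isHarmonicAt_iff_chartAt {g : X → EReal} {x : X} : IsHarmonicAt g x ↔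
    EHarmonicAt (fun w => g ((chartAt ℂ x).symm w)) (chartAt ℂ x x) := by
  set e := chartAt ℂ x with he
  have hx : x ∈ e.source := mem_chart_source ℂ x
  constructor
  · rintro ⟨h, hh, hev⟩
    refine ⟨h, hh, ?_⟩
    filter_upwards [(e.tendsto_symm hx).eventually hev, e.open_target.mem_nhds (e.map_source hx)]
      with w h1 h2
    rw [h1, e.right_inv h2]
  · rintro ⟨h, hh, hev⟩
    refine ⟨h, hh, ?_⟩
    filter_upwards [(e.continuousAt hx).eventually hev, e.open_source.mem_nhds hx] with y h1 h2
    rw [← h1, e.left_inv h2]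

/-- Harmonicity can be tested in any coordinate. -/
theorem isHarmonicAt_iff [IsManifold 𝓘(ℂ) ω X] {g : X → EReal} {x : X} {e : OpenPartialHomeomorph X ℂ}
    (he : e ∈ IsManifold.maximalAtlas 𝓘(ℂ) ω X) (hx : x ∈ e.source) :
    IsHarmonicAt g x ↔ EHarmonicAt (fun w => g (e.symm w)) (e x) := by
  have he₀ : chartAt ℂ x ∈ IsManifold.maximalAtlas 𝓘(ℂ) ω X := IsManifold.chart_mem_maximalAtlas x
  have hx₀ : x ∈ (chartAt ℂ x).source := mem_chart_source ℂ x
  rw [isHarmonicAt_iff_chartAt]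
  have := eHarmonicAt_comp_iff (G := fun w => g ((chartAt ℂ x).symm w))
    (analyticAt_transition he he₀ hx hx₀) (deriv_transition_ne_zero he he₀ hx hx₀)
  rw [e.left_inv hx] at this
  rw [← this]
  have hev : ∀ᶠ w in 𝓝 (e x), g ((chartAt ℂ x).symm (chartAt ℂ x (e.symm w))) = g (e.symm w) :=
    (eventually_transition_symm hx hx₀).mono fun w hw => by rw [hw.2]
  exact ⟨fun h => h.congr (hev.mono fun w hw => hw.symm), fun h => h.congr hev⟩

theorem continuousAt_of_isHarmonicAt {g : X → EReal} {x : X} (h : IsHarmonicAt g x) :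
    ContinuousAt g x := by
  obtain ⟨u, hu, hev⟩ := h
  have h1 : ContinuousAt (fun y => (u (chartAt ℂ x y) : EReal)) x :=
    continuous_coe_real_ereal.continuousAt.comp
      (ContinuousAt.comp (hu.1.continuousAt) ((chartAt ℂ x).continuousAt (mem_chart_source ℂ x)))
  exact h1.congr (hev.mono fun y hy => hy.symm)

end Charts

/-! ### The local model of the tropical trace -/

/-- After the substitution `z = ξ ^ m`, the function `g` is near `q` the maximum of finitely many
harmonic functions with logarithmic terms. -/
structure IsLocalModel {X J : Type*} [TopologicalSpace X] [ChartedSpace ℂ X]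
    (g : X → EReal) (q : X) (m : ℕ) (ρ : J → ℝ) (H : J → ℂ → ℝ) (u : J → ℂ → EReal) : Prop where
  ne_zero : m ≠ 0
  harmonicAt : ∀ j, HarmonicAt (H j) 0
  continuousAt : ∀ j, ContinuousAt (u j) 0
  eq_logHarm : ∀ j, ∀ᶠ ξ in 𝓝[≠] (0 : ℂ), u j ξ = ((logHarm (ρ j) (H j) ξ : ℝ) : EReal)
  eq_iSup : ∀ᶠ ξ in 𝓝 (0 : ℂ),
    g ((chartAt ℂ q).symm (chartAt ℂ q q + ξ ^ m)) = ⨆ j, u j ξ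

section Covering

universe v w

variable {Y : Type v} {Y' : Type w} [TopologicalSpace Y] [ChartedSpace ℂ Y]
  [TopologicalSpace Y'] [ChartedSpace ℂ Y']

/-- Regular points are treated as singularities with coefficient `0`. A negative residue is chosen
whenever one exists, so the last clause does not depend on uniqueness of the residue. -/
theorem exists_logExpansion {f : Y → EReal} (hf : IsHarmonicWithLogPoles f) (y : Y) :
    ∃ (r : ℝ) (h : ℂ → ℝ), HarmonicAt h (chartAt ℂ y y) ∧ HasLogExpansionAt f y r h ∧
      (y ∉ pol f → r = 0) ∧ (y ∉ polNeg f → 0 ≤ r) := by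
  by_cases hp : y ∈ pol f
  · have key : ∀ r : ℝ, HasLogSingularityAt f y r → (y ∉ polNeg f → 0 ≤ r) →
        ∃ (r : ℝ) (h : ℂ → ℝ), HarmonicAt h (chartAt ℂ y y) ∧ HasLogExpansionAt f y r h ∧
        (y ∉ pol f → r = 0) ∧ (y ∉ polNeg f → 0 ≤ r) := by
      rintro r ⟨h, hh, hexp⟩ hr
      exact ⟨r, h, hh, hexp, fun hn => (hn hp).elim, hr⟩
    by_cases hn : y ∈ polNeg f
    · obtain ⟨r, hr0, hr⟩ := hn
      exact key r hr fun hn => (hn ⟨r, hr0, hr⟩).elim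
    · obtain ⟨r, hr0, hr⟩ := hp.resolve_left hn
      exact key r hr fun _ => hr0.le
  · have hharm := hf.harmonic y hp
    have hc := continuousAt_of_isHarmonicAt hharm
    obtain ⟨h, hh, hev⟩ := hharm
    refine ⟨0, h, hh, ⟨nhdsWithin_le_nhds (hev.mono fun z hz => ?_), hc⟩, fun _ => rfl,
      fun _ => le_rfl⟩
    simpa using hz

/-- The coordinate `t` is adapted to `ν`, not to the given chart. Changing to it multiplies the old
centred coordinate by a holomorphic unit, which preserves the residue and only alters the harmonic
part. -/
theorem exists_branch [IsManifold 𝓘(ℂ) ω Y] [IsManifold 𝓘(ℂ) ω Y'] {ν : Y → Y'} (hν : IsBranchedCovering ν) {f : Y → EReal}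
    (hf : IsHarmonicWithLogPoles f) (y : Y) :
    ∃ (k : ℕ) (φ : ℂ → Y) (ρ : ℝ) (H : ℂ → ℝ), k ≠ 0 ∧ φ 0 = y ∧ map φ (𝓝 0) = 𝓝 y ∧
      (∀ᶠ t in 𝓝 (0 : ℂ), ν (φ t) ∈ (chartAt ℂ (ν y)).source ∧
        chartAt ℂ (ν y) (ν (φ t)) = chartAt ℂ (ν y) (ν y) + t ^ k) ∧
      HarmonicAt H 0 ∧
      (∀ᶠ t in 𝓝[≠] (0 : ℂ), f (φ t) = ((logHarm ρ H t : ℝ) : EReal)) ∧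
      ContinuousAt (fun t => f (φ t)) 0 ∧ (y ∉ pol f → ρ = 0) ∧ (y ∉ polNeg f → 0 ≤ ρ) := by
  set e := chartAt ℂ y with he
  set e' := chartAt ℂ (ν y) with he'
  have hy : y ∈ e.source := mem_chart_source ℂ y
  have hy' : ν y ∈ e'.source := mem_chart_source ℂ (ν y)
  set a : ℂ := e y with ha
  set p : ℂ → ℂ := fun w => e' (ν (e.symm w)) - e' (ν y) with hp
  have hpan : AnalyticAt ℂ p a := (analyticAt_inCharts hν.holomorphic
    (IsManifold.chart_mem_maximalAtlas y) (IsManifold.chart_mem_maximalAtlas (ν y)) hy hy').sub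
    analyticAt_const
  have hp0 : p a = 0 := by simp [hp, ha, e.left_inv hy]
  have hsymm : Tendsto e.symm (𝓝 a) (𝓝 y) := e.tendsto_symm hy
  have hνs : ∀ᶠ w in 𝓝 a, ν (e.symm w) ∈ e'.source :=
    ((hν.proper.continuous.tendsto y).comp hsymm).eventually (e'.open_source.mem_nhds hy')
  -- If `ν` were constant near `y`, its fibre would contain a neighbourhood of `y` and be infinite.
  have hpne : ¬ ∀ᶠ w in 𝓝 a, p w = 0 := by
    intro h0
    have hmem : {w | w ∈ e.target ∧ e.symm w ∈ ν ⁻¹' {ν y}} ∈ 𝓝 a := by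
      filter_upwards [h0, hνs, e.open_target.mem_nhds (e.map_source hy)] with w h1 h2 h3
      refine ⟨h3, e'.injOn h2 hy' (sub_eq_zero.1 h1)⟩
    refine infinite_of_mem_nhds a hmem ?_
    refine Set.Finite.of_finite_image ((hν.finite_fiber (ν y)).subset ?_)
      (e.symm.injOn.mono fun w hw => hw.1)
    rintro _ ⟨w, hw, rfl⟩
    exact hw.2
  obtain ⟨k, hk, ψ, hψ, hψ0, hψd, hψmap, hψp⟩ := exists_pow_normalForm hpan hp0 hpne
  have hψt : Tendsto ψ (𝓝 0) (𝓝 a) := hψmap.le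
  obtain ⟨r, h, hh, hexp, hr1, hr2⟩ := exists_logExpansion hf y
  have hmap : map (fun t => e.symm (ψ t)) (𝓝 0) = 𝓝 y := by
    change map (e.symm ∘ ψ) (𝓝 0) = 𝓝 y
    rw [← Filter.map_map, hψmap]
    exact e.symm_map_nhds_eq hy
  -- `ψ t - a = t * E t` with `E` a holomorphic unit
  obtain ⟨E, hE, hE0, hψE⟩ : ∃ E : ℂ → ℂ, AnalyticAt ℂ E 0 ∧ E 0 ≠ 0 ∧
      ∀ᶠ t in 𝓝 (0 : ℂ), ψ t - a = t * E t := by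
    have han : AnalyticAt ℂ (fun t => ψ t - a) 0 := hψ.sub analyticAt_const
    have hz : (fun t => ψ t - a) 0 = 0 := by simp [hψ0]
    have hds : AnalyticAt ℂ (dslope (fun t => ψ t - a) 0) 0 := by
      obtain ⟨q, hq⟩ := han
      exact hq.has_fpower_series_dslope_fslope.analyticAt
    refine ⟨dslope (fun t => ψ t - a) 0, hds, ?_, Eventually.of_forall fun t => ?_⟩
    · rw [dslope_same]
      simpa using hψd
    · have := sub_smul_dslope (fun t => ψ t - a) 0 t
      simp only [hψ0, sub_self, sub_zero, smul_eq_mul] at this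
      exact this.symm
  -- Since `log ‖ψ t - a‖ = log ‖t‖ + log ‖E t‖` and `E` has no zero near `0`, the second summand is
  -- absorbed in the harmonic part.
  refine ⟨k, fun t => e.symm (ψ t), r, fun t => r * Real.log ‖E t‖ + h (ψ t), hk, ?_, hmap, ?_, ?_,
    ?_, ?_, hr1, hr2⟩
  · dsimp only
    rw [hψ0, ha, e.left_inv hy]
  · filter_upwards [hψp, hψt.eventually hνs] with t h1 h2
    refine ⟨h2, ?_⟩
    rw [← h1, hp]
    ring
  · exact ((hE.harmonicAt_log_norm hE0).const_smul (c := r)).add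
      (harmonicAt_comp (φ := ψ) (by rw [hψ0]; exact hh) hψ)
  · have hnhds : ∀ᶠ t in 𝓝 (0 : ℂ), e.symm (ψ t) ≠ y → f (e.symm (ψ t)) =
        ((r * Real.log ‖e (e.symm (ψ t)) - e y‖ + h (e (e.symm (ψ t))) : ℝ) : EReal) := by
      have := eventually_nhdsWithin_iff.1 hexp.1
      rw [← hmap] at this
      exact this
    filter_upwards [nhdsWithin_le_nhds hnhds, nhdsWithin_le_nhds hψE,
      nhdsWithin_le_nhds (hE.continuousAt.eventually_ne hE0), self_mem_nhdsWithin,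
      nhdsWithin_le_nhds (hψt.eventually (e.open_target.mem_nhds (e.map_source hy)))]
      with t h1 h2 h3 h4 h5
    have ht0 : t ≠ 0 := h4
    have hne : e.symm (ψ t) ≠ y := by
      intro heq
      have : ψ t = a := by rw [← e.right_inv h5, heq]
      rw [this, sub_self] at h2
      exact mul_ne_zero ht0 h3 h2.symm
    rw [h1 hne, e.right_inv h5]
    change ((r * Real.log ‖ψ t - a‖ + h (ψ t) : ℝ) : EReal) = _
    rw [h2, norm_mul, Real.log_mul (norm_ne_zero_iff.2 ht0) (norm_ne_zero_iff.2 h3)]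
    simp only [logHarm]
    congr 1
    ring
  · have : ContinuousAt f (e.symm (ψ 0)) := by
      rw [hψ0, ha, e.left_inv hy]
      exact hexp.2
    refine ContinuousAt.comp (f := fun t => e.symm (ψ t)) this ?_
    rw [ContinuousAt, hψ0, ha, e.left_inv hy]
    exact hmap.le

/-- The terms are indexed by a point `y` of the fibre over `q` and a `k y`-th root of unity. When `z
= ξ ^ m`, the preimages of `z` near `y` are the solutions of `t ^ k y = ξ ^ m`, that is, the roots
of unity times `ξ ^ d y`. The coefficient of `log ‖ξ‖` is the residue times `d y`, so it inherits
the sign or vanishing of the residue. -/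
theorem exists_isLocalModel [IsManifold 𝓘(ℂ) ω Y] [IsManifold 𝓘(ℂ) ω Y']
    {ν : Y → Y'} (hν : IsBranchedCovering ν) {f : Y → EReal}
    (hf : IsHarmonicWithLogPoles f) (q : Y') :
    ∃ (J : Type v) (_ : Fintype J) (_ : Nonempty J) (m : ℕ) (ρ : J → ℝ) (H : J → ℂ → ℝ)
      (u : J → ℂ → EReal), IsLocalModel (tropicalTrace ν f) q m ρ H u ∧
      (q ∉ ν '' pol f → ∀ j, ρ j = 0) ∧ (q ∉ ν '' polNeg f → ∀ j, 0 ≤ ρ j) := by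
  classical
  choose k φ r h hk hφ0 hφmap hφν hharm hlog hcont hpol hneg using
    fun y : ν ⁻¹' {q} => exists_branch hν hf y.1
  have hq : ∀ y : ν ⁻¹' {q}, ν y = q := fun y => y.2
  have : Finite (ν ⁻¹' {q}) := (hν.finite_fiber q).to_subtype
  let _ : Fintype (ν ⁻¹' {q}) := Fintype.ofFinite _
  set e := chartAt ℂ q with he
  have hqs : q ∈ e.source := mem_chart_source ℂ q
  -- Any common multiple of the ramification indices would do; the product avoids a separate
  -- argument that it is nonzero.
  set m : ℕ := ∏ y, k y with hm
  have hm0 : m ≠ 0 := Finset.prod_ne_zero_iff.2 fun y _ => hk y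
  have hdvd : ∀ y, k y ∣ m := fun y => Finset.dvd_prod_of_mem k (Finset.mem_univ y)
  choose d hd using hdvd
  have hd0 : ∀ y, d y ≠ 0 := fun y h0 => hm0 (by rw [hd y, h0, mul_zero])
  set ζ : ∀ y : ν ⁻¹' {q}, ℂ := fun y => Complex.exp (2 * Real.pi * Complex.I / k y) with hζ
  have hprim : ∀ y, IsPrimitiveRoot (ζ y) (k y) := fun y => Complex.isPrimitiveRoot_exp _ (hk y)
  set τ : (Σ y : ν ⁻¹' {q}, Fin (k y)) → ℂ → ℂ := fun j ξ => ζ j.1 ^ (j.2 : ℕ) * ξ ^ d j.1 with hτ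
  have hτk : ∀ j ξ, τ j ξ ^ k j.1 = ξ ^ m := fun j ξ => by
    simp only [hτ]
    rw [mul_pow, ← pow_mul, mul_comm (j.2 : ℕ), pow_mul, (hprim j.1).pow_eq_one, one_pow, one_mul,
      ← pow_mul, mul_comm (d j.1), ← hd]
  have hτ0 : ∀ j, τ j 0 = 0 := fun j => by simp [hτ, hd0]
  have hτan : ∀ j, AnalyticAt ℂ (τ j) 0 := fun j => analyticAt_const.mul (analyticAt_id.pow _)
  have hζn : ∀ j : (Σ y : ν ⁻¹' {q}, Fin (k y)), ‖ζ j.1 ^ (j.2 : ℕ)‖ = 1 := fun j => by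
    rw [norm_pow, (hprim j.1).norm'_eq_one (hk j.1), one_pow]
  have hτt : ∀ j, Tendsto (τ j) (𝓝 0) (𝓝 0) := fun j => by
    have := (hτan j).continuousAt.tendsto
    rwa [hτ0] at this
  have hτt' : ∀ j, Tendsto (τ j) (𝓝[≠] 0) (𝓝[≠] 0) := fun j => by
    refine tendsto_nhdsWithin_iff.2 ⟨(hτt j).mono_left nhdsWithin_le_nhds, ?_⟩
    filter_upwards [self_mem_nhdsWithin] with ξ hξ
    refine mul_ne_zero ?_ (pow_ne_zero _ hξ)
    rw [← norm_ne_zero_iff, hζn]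
    exact one_ne_zero
  have hfib : Nonempty (ν ⁻¹' {q}) := by
    obtain ⟨y, hy⟩ := hν.surjective q
    exact ⟨⟨y, hy⟩⟩
  have hJ : Nonempty (Σ y : ν ⁻¹' {q}, Fin (k y)) := by
    obtain ⟨y⟩ := hfib
    exact ⟨⟨y, ⟨0, Nat.pos_of_ne_zero (hk y)⟩⟩⟩
  refine ⟨Σ y : ν ⁻¹' {q}, Fin (k y), inferInstance, hJ, m, fun j => r j.1 * d j.1,
    fun j ξ => h j.1 (τ j ξ), fun j ξ => f (φ j.1 (τ j ξ)), ⟨hm0, fun j => ?_, fun j => ?_,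
    fun j => ?_, ?_⟩, ?_, ?_⟩
  · exact harmonicAt_comp (φ := τ j) (by rw [hτ0]; exact hharm j.1) (hτan j)
  · refine ContinuousAt.comp (f := τ j) (g := fun t => f (φ j.1 t)) ?_ (hτan j).continuousAt
    rw [hτ0]
    exact hcont j.1
  · filter_upwards [(hτt' j).eventually (hlog j.1)] with ξ hξ
    rw [hξ]
    simp only [logHarm]
    congr 2
    simp only [hτ]
    rw [norm_mul, hζn, one_mul, norm_pow, Real.log_pow]
    ring
  · have hφν' : ∀ y : ν ⁻¹' {q}, ∀ᶠ t in 𝓝 (0 : ℂ),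
        ν (φ y t) ∈ e.source ∧ e (ν (φ y t)) = e q + t ^ k y := fun y => by
      have := hφν y
      rwa [hq y] at this
    -- A closed map sends fibres over nearby points into any given neighbourhood of the fibre over
    -- `q`; here that neighbourhood is the union of the images of the branches.
    have hcover : ∀ᶠ z in 𝓝 q, ∀ y' ∈ ν ⁻¹' {z}, ∃ y t, φ y t = y' ∧
        ν (φ y t) ∈ e.source ∧ e (ν (φ y t)) = e q + t ^ k y := by
      refine hν.proper.isClosedMap.eventually_nhds_fiber q fun y hy => ?_
      rw [← hφmap ⟨y, hy⟩, eventually_map]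
      filter_upwards [hφν' ⟨y, hy⟩] with t ht
      exact ⟨⟨y, hy⟩, t, rfl, ht⟩
    have htend : Tendsto (fun ξ : ℂ => e q + ξ ^ m) (𝓝 0) (𝓝 (e q)) := by
      have : Continuous fun ξ : ℂ => e q + ξ ^ m := by fun_prop
      simpa [hm0] using this.tendsto 0
    have htend' : Tendsto (fun ξ : ℂ => e.symm (e q + ξ ^ m)) (𝓝 0) (𝓝 q) :=
      (e.tendsto_symm hqs).comp htend
    have hφτ : ∀ᶠ ξ in 𝓝 (0 : ℂ), ∀ j : (Σ y : ν ⁻¹' {q}, Fin (k y)),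
        ν (φ j.1 (τ j ξ)) ∈ e.source ∧ e (ν (φ j.1 (τ j ξ))) = e q + τ j ξ ^ k j.1 :=
      eventually_all.2 fun j => (hτt j).eventually (hφν' j.1)
    filter_upwards [htend'.eventually hcover, hφτ,
      htend.eventually (e.open_target.mem_nhds (e.map_source hqs))] with ξ h1 h2 h3
    refine le_antisymm (iSup₂_le fun y' hy' => ?_) (iSup_le fun j => ?_)
    · obtain ⟨y, t, rfl, ht1, ht2⟩ := h1 y' hy'
      have hνt : ν (φ y t) = e.symm (e q + ξ ^ m) := hy'
      rw [hνt, e.right_inv h3, add_right_inj] at ht2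
      have : t ^ k y = (ξ ^ d y) ^ k y := by rw [← ht2, ← pow_mul, mul_comm, ← hd]
      obtain ⟨l, hl, hlt⟩ : ∃ l < k y, ζ y ^ l * ξ ^ d y = t := by
        have hmem : t ∈ Polynomial.nthRoots (k y) ((ξ ^ d y) ^ k y) :=
          (Polynomial.mem_nthRoots (Nat.pos_of_ne_zero (hk y))).2 this
        rw [(hprim y).nthRoots_eq rfl, Multiset.mem_map] at hmem
        obtain ⟨l, hl, hlt⟩ := hmem
        exact ⟨l, Multiset.mem_range.1 hl, hlt⟩
      have := le_iSup (fun j : (Σ y : ν ⁻¹' {q}, Fin (k y)) => f (φ j.1 (τ j ξ))) ⟨y, ⟨l, hl⟩⟩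
      simpa only [hτ, hlt] using this
    · refine le_iSup₂_of_le (φ j.1 (τ j ξ)) ?_ le_rfl
      obtain ⟨h4, h5⟩ := h2 j
      rw [hτk] at h5
      change ν (φ j.1 (τ j ξ)) = e.symm (e q + ξ ^ m)
      rw [← h5, e.left_inv h4]
  · intro hnot j
    have : (j.1 : Y) ∉ pol f := fun hmem => hnot ⟨j.1, hmem, hq j.1⟩
    dsimp only
    rw [hpol j.1 this, zero_mul]
  · intro hnot j
    have : (j.1 : Y) ∉ polNeg f := fun hmem => hnot ⟨j.1, hmem, hq j.1⟩
    exact mul_nonneg (hneg j.1 this) (Nat.cast_nonneg _)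

end Covering

/-! ### Consequences of the local model: continuity, arcs, singularities, maximum principle -/

section Model

variable {X J : Type*} [TopologicalSpace X] [ChartedSpace ℂ X]

theorem logHarm_zero (H : ℂ → ℝ) : logHarm 0 H = H := by
  funext ξ
  simp [logHarm]

/-- The substitution `z = ξ ^ m` in the chart at `q`. -/
noncomputable def powChart (q : X) (m : ℕ) (ξ : ℂ) : X :=
  (chartAt ℂ q).symm (chartAt ℂ q q + ξ ^ m)

theorem powChart_zero (q : X) {m : ℕ} (hm : m ≠ 0) : powChart q m 0 = q := by
  simp [powChart, hm]

theorem isOpenMap_add_pow (c : ℂ) {m : ℕ} (hm : m ≠ 0) : IsOpenMap fun ξ : ℂ => c + ξ ^ m :=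
  (isOpenMap_add_left c).comp (isOpenMap_pow hm)

theorem map_add_pow (c : ℂ) {m : ℕ} (hm : m ≠ 0) (ξ : ℂ) :
    map (fun ξ : ℂ => c + ξ ^ m) (𝓝 ξ) = 𝓝 (c + ξ ^ m) :=
  (isOpenMap_add_pow c hm).map_nhds_eq (by fun_prop)

theorem map_powChart (q : X) {m : ℕ} (hm : m ≠ 0) : map (powChart q m) (𝓝 0) = 𝓝 q := by
  have h1 := map_add_pow (chartAt ℂ q q) hm 0
  rw [zero_pow hm, add_zero] at h1
  change map ((chartAt ℂ q).symm ∘ fun ξ : ℂ => chartAt ℂ q q + ξ ^ m) (𝓝 0) = 𝓝 q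
  rw [← Filter.map_map, h1]
  exact (chartAt ℂ q).symm_map_nhds_eq (mem_chart_source ℂ q)

theorem eventually_of_powChart {q : X} {m : ℕ} (hm : m ≠ 0) {p : X → Prop}
    (h : ∀ᶠ ξ in 𝓝 (0 : ℂ), p (powChart q m ξ)) : ∀ᶠ x in 𝓝 q, p x := by
  rwa [← map_powChart q hm, eventually_map]

theorem eventually_nhdsNE_of_powChart {q : X} {m : ℕ} (hm : m ≠ 0) {p : X → Prop}
    (h : ∀ᶠ ξ in 𝓝[≠] (0 : ℂ), p (powChart q m ξ)) : ∀ᶠ x in 𝓝[≠] q, p x := by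
  rw [eventually_nhdsWithin_iff] at h ⊢
  refine eventually_of_powChart hm (h.mono fun ξ hξ hne => hξ ?_)
  rintro rfl
  exact hne (powChart_zero q hm)

variable {g : X → EReal} {q : X} {m : ℕ} {ρ : J → ℝ} {H : J → ℂ → ℝ} {u : J → ℂ → EReal}

namespace IsLocalModel

theorem eventually_iSup (M : IsLocalModel g q m ρ H u) :
    ∀ᶠ ξ in 𝓝 (0 : ℂ), g (powChart q m ξ) = ⨆ j, u j ξ := M.eq_iSup

theorem apply_eq (M : IsLocalModel g q m ρ H u) : g q = ⨆ j, u j 0 := by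
  have := M.eventually_iSup.self_of_nhds
  rwa [powChart_zero q M.ne_zero] at this

theorem apply_zero (M : IsLocalModel g q m ρ H u) {j : J} (hj : ρ j = 0) :
    u j 0 = ((H j 0 : ℝ) : EReal) := by
  have h1 : Tendsto (u j) (𝓝[≠] 0) (𝓝 (u j 0)) :=
    (M.continuousAt j).tendsto.mono_left nhdsWithin_le_nhds
  have h2 : Tendsto (fun ξ => ((H j ξ : ℝ) : EReal)) (𝓝[≠] 0) (𝓝 ((H j 0 : ℝ) : EReal)) :=
    (continuous_coe_real_ereal.tendsto _).comp
      ((M.harmonicAt j).1.continuousAt.tendsto.mono_left nhdsWithin_le_nhds)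
  refine tendsto_nhds_unique h1 (h2.congr' ?_)
  filter_upwards [M.eq_logHarm j] with ξ hξ
  rw [hξ, hj, logHarm_zero]

theorem apply_zero_of_pos (M : IsLocalModel g q m ρ H u) {j : J} (hj : 0 < ρ j) :
    u j 0 = ⊥ := by
  have h1 : Tendsto (u j) (𝓝[≠] 0) (𝓝 (u j 0)) :=
    (M.continuousAt j).tendsto.mono_left nhdsWithin_le_nhds
  have h2 : Tendsto (fun ξ => logHarm (ρ j) (H j) ξ) (𝓝[≠] 0) atBot :=
    (tendsto_log_norm.const_mul_atBot hj).atBot_add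
      ((M.harmonicAt j).1.continuousAt.tendsto.mono_left nhdsWithin_le_nhds)
  refine tendsto_nhds_unique h1 ((EReal.tendsto_coe_atBot.comp h2).congr' ?_)
  filter_upwards [M.eq_logHarm j] with ξ hξ
  exact hξ.symm

variable [Fintype J]

protected theorem continuousAt_apply (M : IsLocalModel g q m ρ H u) : ContinuousAt g q := by
  have h1 : ContinuousAt (fun ξ => ⨆ j, u j ξ) 0 := by
    simp only [← Finset.sup_univ_eq_iSup]
    exact ContinuousAt.finset_sup_apply fun j _ => M.continuousAt j
  rw [ContinuousAt, M.apply_eq]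
  rw [← map_powChart q M.ne_zero, tendsto_map'_iff]
  exact h1.tendsto.congr' (M.eventually_iSup.mono fun ξ hξ => hξ.symm)

end IsLocalModel

variable [Fintype J] [Nonempty J]

theorem continuousAt_maxLogHarm (hH : ∀ j, HarmonicAt (H j) 0) (hρ : ∀ j, ρ j = 0) :
    ContinuousAt (maxLogHarm ρ H) 0 := by
  refine ContinuousAt.finset_sup'_apply _ fun j _ => ?_
  simp only [hρ, logHarm_zero]
  exact (hH j).1.continuousAt

namespace IsLocalModel

theorem eventually_eq_maxLogHarm (M : IsLocalModel g q m ρ H u) :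
    ∀ᶠ ξ in 𝓝[≠] (0 : ℂ), g (powChart q m ξ) = ((maxLogHarm ρ H ξ : ℝ) : EReal) := by
  filter_upwards [nhdsWithin_le_nhds M.eventually_iSup, eventually_all.2 M.eq_logHarm] with ξ h1 h2
  rw [h1, coe_maxLogHarm]
  exact iSup_congr h2

theorem eventually_eq_maxLogHarm_of_zero (M : IsLocalModel g q m ρ H u) (hρ : ∀ j, ρ j = 0) :
    ∀ᶠ ξ in 𝓝 (0 : ℂ), g (powChart q m ξ) = ((maxLogHarm ρ H ξ : ℝ) : EReal) := by
  have h := eventually_nhdsWithin_iff.1 M.eventually_eq_maxLogHarm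
  filter_upwards [h] with ξ hξ
  rcases eq_or_ne ξ 0 with rfl | h0
  · rw [powChart_zero q M.ne_zero, M.apply_eq, coe_maxLogHarm]
    refine iSup_congr fun j => ?_
    rw [M.apply_zero (hρ j), hρ j, logHarm_zero]
  · exact hξ h0

/-- Away from `ξ = 0` the substitution `ξ ^ m` is locally biholomorphic, so it preserves and
reflects harmonicity. -/
theorem isHarmonicAt_powChart_iff [IsManifold 𝓘(ℂ) ω X] (M : IsLocalModel g q m ρ H u) :
    ∀ᶠ ξ in 𝓝[≠] (0 : ℂ), (IsHarmonicAt g (powChart q m ξ) ↔ HarmonicAt (maxLogHarm ρ H) ξ) := by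
  set e := chartAt ℂ q
  have hq : q ∈ e.source := mem_chart_source ℂ q
  have htend : Tendsto (fun ξ : ℂ => e q + ξ ^ m) (𝓝 0) (𝓝 (e q)) := by
    have := (map_add_pow (e q) M.ne_zero 0).le
    rwa [zero_pow M.ne_zero, add_zero] at this
  filter_upwards [eventually_nhds_of_eventually_nhdsNE M.eventually_eq_maxLogHarm,
    nhdsWithin_le_nhds (htend.eventually (e.open_target.mem_nhds (e.map_source hq))),
    self_mem_nhdsWithin] with ξ h1 h2 h3
  have hξ : ξ ≠ 0 := h3
  have hφ : AnalyticAt ℂ (fun ξ : ℂ => e q + ξ ^ m) ξ := analyticAt_const.add (analyticAt_id.pow m)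
  have hd : deriv (fun ξ : ℂ => e q + ξ ^ m) ξ ≠ 0 := by
    simp [M.ne_zero, hξ]
  have hr : e (powChart q m ξ) = e q + ξ ^ m := e.right_inv h2
  have hs : powChart q m ξ ∈ e.source := e.map_target h2
  rw [isHarmonicAt_iff (IsManifold.chart_mem_maximalAtlas q) hs, ← eHarmonicAt_coe_iff]
  change EHarmonicAt (fun w => g (e.symm w)) (e (powChart q m ξ)) ↔ _
  rw [hr, ← eHarmonicAt_comp_iff (G := fun w => g (e.symm w)) hφ hd]
  exact ⟨fun h => h.congr (h1.mono fun η hη => hη.symm), fun h => h.congr h1⟩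

/-- The points near `q` where `g` is not harmonic form finitely many arcs ending at `q`. -/
theorem exists_arcs [IsManifold 𝓘(ℂ) ω X] (M : IsLocalModel g q m ρ H u) :
    ∃ B : Finset (ℝ → ℝ), (∀ β ∈ B, AnalyticAt ℝ β 0) ∧ ∀ᶠ z in 𝓝[≠] (0 : ℂ),
      (¬ IsHarmonicAt g ((chartAt ℂ q).symm (chartAt ℂ q q + z)) ↔ ∃ β ∈ B, z ∈ arcSet m β) := by
  obtain ⟨A, hA, hev⟩ := exists_arcs_maxLogHarm (ρ := ρ) M.harmonicAt
  refine arcs_of_comp_pow M.ne_zero (A := A)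
    (T := {z | ¬ IsHarmonicAt g ((chartAt ℂ q).symm (chartAt ℂ q q + z))}) hA ?_
  filter_upwards [hev, M.isHarmonicAt_powChart_iff] with ξ h1 h2
  rw [← h1, ← h2]
  rfl

/-- Isolated points of the set where `g` is not harmonic are removable away from the poles. -/
theorem isHarmonicAt_of_isolated [IsManifold 𝓘(ℂ) ω X] (M : IsLocalModel g q m ρ H u)
    (hρ : ∀ j, ρ j = 0) (hiso : ∀ᶠ x in 𝓝[≠] q, IsHarmonicAt g x) : IsHarmonicAt g q := by
  set e := chartAt ℂ q
  have hq : q ∈ e.source := mem_chart_source ℂ q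
  have hm := M.ne_zero
  have htend : Tendsto (powChart q m) (𝓝[≠] 0) (𝓝[≠] q) := by
    refine tendsto_nhdsWithin_iff.2 ⟨(map_powChart q hm).le.trans' (map_mono nhdsWithin_le_nhds), ?_⟩
    have h2 : ∀ᶠ ξ in 𝓝 (0 : ℂ), e q + ξ ^ m ∈ e.target := by
      have := (map_add_pow (e q) hm 0).le
      rw [zero_pow hm, add_zero] at this
      exact this (e.open_target.mem_nhds (e.map_source hq))
    filter_upwards [nhdsWithin_le_nhds h2, self_mem_nhdsWithin] with ξ h3 h4 heq
    have : e q + ξ ^ m = e q := by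
      rw [← e.right_inv h3]
      exact congrArg e heq
    exact pow_ne_zero m h4 (by simpa using this)
  have hharm : ∀ᶠ ξ in 𝓝[≠] (0 : ℂ), HarmonicAt (maxLogHarm ρ H) ξ := by
    filter_upwards [htend.eventually hiso, M.isHarmonicAt_powChart_iff] with ξ h1 h2
    exact h2.1 h1
  -- On the punctured disc a single term realizes the maximum; with vanishing coefficients this term
  -- is harmonic at the origin as well.
  obtain ⟨j, hj⟩ := exists_eventually_maxLogHarm_eq M.harmonicAt hharm
  have hmax : ∀ᶠ ξ in 𝓝 (0 : ℂ), maxLogHarm ρ H ξ = H j ξ := by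
    have h1 : ∀ᶠ ξ in 𝓝[≠] (0 : ℂ), maxLogHarm ρ H ξ = H j ξ := by
      simpa only [hρ, logHarm_zero] using hj
    have h0 : maxLogHarm ρ H 0 = H j 0 := by
      have e1 := (continuousAt_maxLogHarm M.harmonicAt hρ).tendsto.mono_left
        (nhdsWithin_le_nhds (s := {(0 : ℂ)}ᶜ))
      have e2 := (M.harmonicAt j).1.continuousAt.tendsto.mono_left
        (nhdsWithin_le_nhds (s := {(0 : ℂ)}ᶜ))
      exact tendsto_nhds_unique e1 (e2.congr' (h1.mono fun ξ hξ => hξ.symm))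
    filter_upwards [eventually_nhdsWithin_iff.1 h1] with ξ hξ
    rcases eq_or_ne ξ 0 with rfl | hne
    exacts [h0, hξ hne]
  -- The function in the unramified coordinate; its pullback under the power map is harmonic at the
  -- origin, so `G` itself is.
  set G : ℂ → ℝ := fun z => (g (e.symm (e q + z))).toReal with hG
  have hgG := M.eventually_eq_maxLogHarm_of_zero hρ
  have hGharm : HarmonicAt G 0 := by
    refine harmonicAt_of_comp_pow hm (M.harmonicAt j) ?_
    filter_upwards [hgG, hmax] with ξ h1 h2
    change (g (powChart q m ξ)).toReal = _
    rw [h1, EReal.toReal_coe, h2]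
  refine ⟨fun w => G (w - e q), ?_, ?_⟩
  · refine harmonicAt_comp (φ := fun w => w - e q) ?_ (analyticAt_id.sub analyticAt_const)
    rw [sub_self]
    exact hGharm
  · have hreal : ∀ᶠ x in 𝓝 q, g x = (((g x).toReal : ℝ) : EReal) :=
      eventually_of_powChart hm (hgG.mono fun ξ hξ => by rw [hξ, EReal.toReal_coe])
    filter_upwards [hreal, e.open_source.mem_nhds hq] with x h1 h2
    change g x = ((G (e x - e q) : ℝ) : EReal)
    rw [hG]
    dsimp only
    rw [add_sub_cancel, e.left_inv h2]
    exact h1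

theorem eventually_real (M : IsLocalModel g q m ρ H u) :
    ∀ᶠ x in 𝓝[≠] q, g x = (((g x).toReal : ℝ) : EReal) :=
  eventually_nhdsNE_of_powChart M.ne_zero
    (M.eventually_eq_maxLogHarm.mono fun ξ hξ => by rw [hξ, EReal.toReal_coe])

/-- The terms with the smallest coefficient dominate, and the maximum of their harmonic parts is
continuous. Since `log ‖ξ ^ m‖ = m * log ‖ξ‖`, the coefficient in the original coordinate is the
smallest one divided by `m`. -/
theorem hasAtMostLogSingularityAt (M : IsLocalModel g q m ρ H u) :
    HasAtMostLogSingularityAt g q := by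
  classical
  set e := chartAt ℂ q
  have hq : q ∈ e.source := mem_chart_source ℂ q
  have hm := M.ne_zero
  obtain ⟨j₀, hj₀⟩ := Finite.exists_min ρ
  set J₀ : Finset J := Finset.univ.filter fun j => ρ j = ρ j₀ with hJ₀
  have hne : J₀.Nonempty := ⟨j₀, by simp [hJ₀]⟩
  set h₀ : ℂ → ℝ := fun ξ => J₀.sup' hne fun j => H j ξ with hh₀
  have hh₀c : ∀ᶠ ξ in 𝓝 (0 : ℂ), ContinuousAt h₀ ξ := by
    have : ∀ᶠ ξ in 𝓝 (0 : ℂ), ∀ j, ContinuousAt (H j) ξ :=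
      eventually_all.2 fun j => (M.harmonicAt j).eventually.mono fun ξ hξ => hξ.1.continuousAt
    filter_upwards [this] with ξ hξ
    exact ContinuousAt.finset_sup'_apply hne fun j _ => hξ j
  have hmax : ∀ᶠ ξ in 𝓝[≠] (0 : ℂ), maxLogHarm ρ H ξ = logHarm (ρ j₀) h₀ ξ := by
    have hlt : ∀ᶠ ξ in 𝓝[≠] (0 : ℂ), ∀ j, ρ j₀ < ρ j →
        logHarm (ρ j) (H j) ξ < logHarm (ρ j₀) (H j₀) ξ := by
      refine eventually_all.2 fun j => ?_
      by_cases h : ρ j₀ < ρ j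
      · exact (eventually_logHarm_lt h (M.harmonicAt j₀).1.continuousAt
          (M.harmonicAt j).1.continuousAt).mono fun ξ hξ _ => hξ
      · exact Eventually.of_forall fun ξ h' => (h h').elim
    filter_upwards [hlt] with ξ hξ
    have hle : ∀ j ∈ J₀, logHarm (ρ j) (H j) ξ ≤ logHarm (ρ j₀) h₀ ξ := fun j hj => by
      have hρj : ρ j = ρ j₀ := (Finset.mem_filter.1 hj).2
      simp only [logHarm, hρj]
      exact add_le_add_right (Finset.le_sup' (fun j => H j ξ) hj) _
    refine le_antisymm (maxLogHarm_le_iff.2 fun j => ?_) ?_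
    · rcases (hj₀ j).eq_or_lt with h | h
      · exact hle j (by simp [hJ₀, h])
      · exact (hξ j h).le.trans (hle j₀ (by simp [hJ₀]))
    · obtain ⟨j, hj, hjeq⟩ := Finset.exists_mem_eq_sup' hne fun j => H j ξ
      have hρj : ρ j = ρ j₀ := (Finset.mem_filter.1 hj).2
      have : logHarm (ρ j₀) h₀ ξ = logHarm (ρ j) (H j) ξ := by
        simp only [logHarm, hρj, hh₀, hjeq]
      rw [this]
      exact logHarm_le_maxLogHarm ρ H ξ j
  -- The continuous part is defined by subtraction in the original coordinate; the logarithm gives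
  -- no information at the centre, where the value is prescribed by `h₀`.
  set h : ℂ → ℝ := fun w => if w = e q then h₀ 0 else
    (g (e.symm w)).toReal - ρ j₀ / m * Real.log ‖w - e q‖ with hh
  have hhh₀ : ∀ᶠ ξ in 𝓝 (0 : ℂ), h (e q + ξ ^ m) = h₀ ξ := by
    have h1 := eventually_nhdsWithin_iff.1 (M.eventually_eq_maxLogHarm.and hmax)
    filter_upwards [h1] with ξ hξ
    rcases eq_or_ne ξ 0 with rfl | h0
    · simp [hh, hm]
    · obtain ⟨e1, e2⟩ := hξ h0
      have hne : e q + ξ ^ m ≠ e q := by simpa [hm] using h0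
      have e3 : g (e.symm (e q + ξ ^ m)) = ((logHarm (ρ j₀) h₀ ξ : ℝ) : EReal) := by
        rw [← e2, ← e1]
        rfl
      simp only [hh, if_neg hne, e3, EReal.toReal_coe, logHarm]
      rw [add_sub_cancel_left, norm_pow, Real.log_pow]
      have : (m : ℝ) ≠ 0 := by exact_mod_cast hm
      field_simp
      ring
  refine ⟨ρ j₀ / m, h, ?_, ?_, M.continuousAt_apply⟩
  -- Neighbourhood filters are images under `ξ ↦ e q + ξ ^ m`, so continuity of the pullback `h₀`
  -- descends to `h`.
  · have h1 : ∀ᶠ ξ in 𝓝 (0 : ℂ), ContinuousAt h (e q + ξ ^ m) := by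
      filter_upwards [eventually_eventually_nhds.2 hhh₀, hh₀c] with ξ e1 e2
      rw [ContinuousAt, ← map_add_pow (e q) hm, tendsto_map'_iff, e1.self_of_nhds]
      exact e2.tendsto.congr' (e1.mono fun η hη => hη.symm)
    have h2 := map_add_pow (e q) hm 0
    rw [zero_pow hm, add_zero] at h2
    rw [← h2, eventually_map]
    exact h1
  · filter_upwards [M.eventually_real, self_mem_nhdsWithin,
      nhdsWithin_le_nhds (e.open_source.mem_nhds hq)] with x h1 h2 h3
    have hne : e x ≠ e q := fun heq => h2 (e.injOn h3 hq heq)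
    change g x = ((ρ j₀ / m * Real.log ‖e x - e q‖ + h (e x) : ℝ) : EReal)
    simp only [hh, if_neg hne, e.left_inv h3]
    rw [add_sub_cancel]
    exact h1

/-- The maximum principle at points which are not poles with negative residue. -/
theorem eventually_eq_of_le (M : IsLocalModel g q m ρ H u) (hρ : ∀ j, 0 ≤ ρ j) {k : X → EReal}
    (hk : IsHarmonicAt k q) (hle : ∀ᶠ x in 𝓝 q, g x ≤ k x) (heq : g q = k q) :
    ∀ᶠ x in 𝓝 q, g x = k x := by
  set e := chartAt ℂ q
  have hm := M.ne_zero
  rw [isHarmonicAt_iff_chartAt] at hk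
  have hk' : EHarmonicAt (fun ξ => k (powChart q m ξ)) 0 :=
    EHarmonicAt.comp (G := fun w => k (e.symm w)) (φ := fun ξ : ℂ => e q + ξ ^ m)
      (by rw [zero_pow hm, add_zero]; exact hk) (analyticAt_const.add (analyticAt_id.pow m))
  obtain ⟨κ, hκ, hκev⟩ := hk'
  have hgq : g q = ((κ 0 : ℝ) : EReal) := by
    have : k (powChart q m 0) = ((κ 0 : ℝ) : EReal) := hκev.self_of_nhds
    rw [heq, ← this, powChart_zero q hm]
  obtain ⟨j, hj⟩ : ∃ j, u j 0 = g q := by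
    rw [M.apply_eq]
    exact exists_eq_ciSup_of_finite
  -- A positive coefficient would give this term the value `-∞` at the centre, but the common value
  -- there is real.
  have hρj : ρ j = 0 := by
    by_contra hne
    have := M.apply_zero_of_pos (lt_of_le_of_ne (hρ j) (Ne.symm hne))
    rw [hj, hgq] at this
    exact EReal.coe_ne_bot _ this
  have h0 : H j 0 = κ 0 := by
    have := M.apply_zero hρj
    rw [hj, hgq] at this
    exact_mod_cast this.symm
  have hle' : ∀ᶠ ξ in 𝓝 (0 : ℂ), g (powChart q m ξ) ≤ k (powChart q m ξ) := by
    rwa [← map_powChart q hm, eventually_map] at hle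
  have hHg : ∀ᶠ ξ in 𝓝 (0 : ℂ), ((H j ξ : ℝ) : EReal) ≤ g (powChart q m ξ) := by
    filter_upwards [eventually_nhdsWithin_iff.1 (M.eq_logHarm j), M.eventually_iSup] with ξ e1 e2
    rw [e2]
    refine le_trans (le_of_eq ?_) (le_iSup (fun j => u j ξ) j)
    rcases eq_or_ne ξ 0 with rfl | hne
    · exact (M.apply_zero hρj).symm
    · rw [e1 hne, hρj, logHarm_zero]
  -- The term lies below the trace, hence below `κ`, with equality at the centre; the maximum
  -- principle for the difference squeezes the trace.
  have hmax := eventually_eq_of_isLocalMax ((M.harmonicAt j).sub hκ) (by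
    filter_upwards [hle', hHg, hκev] with ξ e1 e2 e3
    rw [e3] at e1
    have : H j ξ ≤ κ ξ := by exact_mod_cast e2.trans e1
    simp only [Pi.sub_apply, h0, sub_self]
    linarith)
  refine eventually_of_powChart hm ?_
  filter_upwards [hmax, hle', hHg, hκev] with ξ e0 e1 e2 e3
  simp only [Pi.sub_apply, h0, sub_self, sub_eq_zero] at e0
  refine le_antisymm e1 ?_
  rw [e3, ← e0]
  exact e2

end IsLocalModel

end Model

/-! ### Curves which are locally finite unions of arcs -/

section Curve

variable {X : Type*} [TopologicalSpace X] [ChartedSpace ℂ X]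

/-- The inverse of the chart at `q`, centred at the origin. -/
noncomputable def centredChart (q : X) (z : ℂ) : X := (chartAt ℂ q).symm (chartAt ℂ q q + z)

theorem centredChart_zero (q : X) : centredChart q 0 = q := by
  simp [centredChart]

theorem tendsto_add_zero (c : ℂ) : Tendsto (fun z : ℂ => c + z) (𝓝 0) (𝓝 c) := by
  have : Continuous fun z : ℂ => c + z := by fun_prop
  simpa using this.tendsto 0

theorem eventually_mem_target (q : X) :
    ∀ᶠ z in 𝓝 (0 : ℂ), chartAt ℂ q q + z ∈ (chartAt ℂ q).target :=
  (tendsto_add_zero _).eventually ((chartAt ℂ q).open_target.mem_nhds (mem_chart_target ℂ q))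

theorem map_centredChart {q : X} {z : ℂ} (hz : chartAt ℂ q q + z ∈ (chartAt ℂ q).target) :
    map (centredChart q) (𝓝 z) = 𝓝 (centredChart q z) := by
  have h1 : map (fun z => chartAt ℂ q q + z) (𝓝 z) = 𝓝 (chartAt ℂ q q + z) :=
    (isOpenMap_add_left _).map_nhds_eq (by fun_prop)
  change map ((chartAt ℂ q).symm ∘ fun z => chartAt ℂ q q + z) (𝓝 z) = _
  rw [← Filter.map_map, h1]
  exact (chartAt ℂ q).symm.map_nhds_eq hz

theorem map_centredChart_zero (q : X) : map (centredChart q) (𝓝 0) = 𝓝 q := by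
  have := map_centredChart (q := q) (z := 0) (eventually_mem_target q).self_of_nhds
  rwa [centredChart_zero] at this

theorem injOn_centredChart (q : X) :
    InjOn (centredChart q) {z | chartAt ℂ q q + z ∈ (chartAt ℂ q).target} := by
  intro z hz w hw h
  exact add_left_cancel ((chartAt ℂ q).symm.injOn hz hw h)

theorem eventually_mem_target_of_mem {q : X} {z : ℂ}
    (hz : chartAt ℂ q q + z ∈ (chartAt ℂ q).target) :
    ∀ᶠ w in 𝓝 z, chartAt ℂ q q + w ∈ (chartAt ℂ q).target := by
  have : Continuous fun z : ℂ => chartAt ℂ q q + z := by fun_prop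
  exact (this.tendsto z).eventually ((chartAt ℂ q).open_target.mem_nhds hz)

theorem accPt_centredChart {q : X} {z : ℂ} (hz : chartAt ℂ q q + z ∈ (chartAt ℂ q).target)
    {T : Set X} : AccPt (centredChart q z) (𝓟 T) ↔ AccPt z (𝓟 (centredChart q ⁻¹' T)) := by
  rw [accPt_iff_frequently, accPt_iff_frequently, ← map_centredChart hz, frequently_map]
  refine frequently_congr ?_
  filter_upwards [eventually_mem_target_of_mem hz] with w hw
  rw [mem_preimage, (injOn_centredChart q).ne_iff hw hz]

theorem continuousOn_centredChart (q : X) :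
    ContinuousOn (centredChart q) {z | chartAt ℂ q q + z ∈ (chartAt ℂ q).target} :=
  (chartAt ℂ q).continuousOn_symm.comp (by fun_prop) fun _ hz => hz

/-- The set is near `q`, except perhaps for `q` itself, a finite union of arcs ending at `q`. -/
def HasArcsAt (T : Set X) (q : X) (m : ℕ) (B : Finset (ℝ → ℝ)) : Prop :=
  m ≠ 0 ∧ (∀ β ∈ B, AnalyticAt ℝ β 0) ∧
    ∀ᶠ z in 𝓝[≠] (0 : ℂ), (centredChart q z ∈ T ↔ ∃ β ∈ B, z ∈ arcSet m β)

/-- Finitely many arcs together with their common end point. -/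
def arcStar (m : ℕ) (B : Finset (ℝ → ℝ)) : Set ℂ :=
  {z | (z = 0 ∧ B.Nonempty) ∨ ∃ β ∈ B, z ∈ arcSet m β}

theorem accPt_of_arcs {m : ℕ} (hm : m ≠ 0) {β : ℝ → ℝ} (hβ : AnalyticAt ℝ β 0) :
    ∀ᶠ z in 𝓝 (0 : ℂ), (z = 0 ∨ z ∈ arcSet m β) → AccPt z (𝓟 (arcSet m β)) := by
  have hc : ∀ᶠ s in 𝓝[>] (0 : ℝ), ContinuousAt β s :=
    nhdsWithin_le_nhds (hβ.eventually_analyticAt.mono fun s hs => hs.continuousAt)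
  have hev := eventually_nhdsWithin_iff.1 ((tendsto_norm_rpow hm).eventually hc)
  filter_upwards [hev] with z hz
  rintro (rfl | hmem)
  · have := accPt_arcPath hm le_rfl hβ.continuousAt
    rwa [arcPath_zero hm] at this
  · exact accPt_of_mem_arcSet hm hmem (hz hmem.1)

theorem accPt_congr {z : ℂ} {A A' : Set ℂ} (h : AccPt z (𝓟 A))
    (hA : ∀ᶠ w in 𝓝[≠] z, w ∈ A → w ∈ A') : AccPt z (𝓟 A') := by
  rw [accPt_iff_frequently_nhdsNE] at h ⊢
  exact (h.and_eventually hA).mono fun w hw => hw.2 hw.1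

/-- The derived set contains the end point of the arcs. -/
theorem HasArcsAt.eventually_mem_derivedSet_iff {T : Set X} (hT : IsClosed T) {q : X} {m : ℕ}
    {B : Finset (ℝ → ℝ)} (h : HasArcsAt T q m B) :
    ∀ᶠ z in 𝓝 (0 : ℂ), (centredChart q z ∈ derivedSet T ↔ z ∈ arcStar m B) := by
  obtain ⟨hm, hB, hev⟩ := h
  have hacc : ∀ᶠ z in 𝓝 (0 : ℂ), ∀ β ∈ B, (z = 0 ∨ z ∈ arcSet m β) →
      AccPt z (𝓟 (arcSet m β)) := by
    rw [Filter.eventually_all_finset]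
    exact fun β hβ => accPt_of_arcs hm (hB β hβ)
  have hnear : ∀ᶠ z in 𝓝 (0 : ℂ), ∀ᶠ w in 𝓝[≠] z,
      (centredChart q w ∈ T ↔ ∃ β ∈ B, w ∈ arcSet m β) := by
    filter_upwards [eventually_nhdsWithin_iff.1 (eventually_nhds_of_eventually_nhdsNE hev)]
      with z hz
    rcases eq_or_ne z 0 with rfl | h0
    exacts [hev, nhdsWithin_le_nhds (hz h0)]
  filter_upwards [hacc, hnear, eventually_mem_target q, eventually_nhdsWithin_iff.1 hev]
    with z h1 h2 h3 h4
  rw [derivedSet, mem_ofPred_eq, accPt_centredChart h3]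
  constructor
  · intro hz
    rcases eq_or_ne z 0 with rfl | h0
    -- The centre is an accumulation point only if some arc ends there, which is why `arcStar`
    -- contains the origin only for nonempty `B`.
    · refine Or.inl ⟨rfl, ?_⟩
      rw [accPt_iff_frequently_nhdsNE] at hz
      obtain ⟨w, hw1, hw2⟩ := (hz.and_eventually h2).exists
      obtain ⟨β, hβ, -⟩ := hw2.1 hw1
      exact ⟨β, hβ⟩
    · refine Or.inr ((h4 h0).1 ?_)
      have := (accPt_centredChart h3).2 hz
      exact hT.closure_subset (derivedSet_subset_closure T this)
  · intro hz
    obtain ⟨β, hβ, hzβ⟩ : ∃ β ∈ B, z = 0 ∨ z ∈ arcSet m β := by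
      rcases hz with ⟨h0, β, hβ⟩ | ⟨β, hβ, hz⟩
      exacts [⟨β, hβ, Or.inl h0⟩, ⟨β, hβ, Or.inr hz⟩]
    exact accPt_congr (h1 β hβ hzβ) (h2.mono fun w hw hwβ => hw.2 ⟨β, hβ, hwβ⟩)

theorem isSemianalyticGerm_arcStar {m : ℕ} (hm : m ≠ 0) {B : Finset (ℝ → ℝ)}
    (hB : ∀ β ∈ B, AnalyticAt ℝ β 0) : IsSemianalyticGerm (arcStar m B) 0 := by
  have h1 : IsSemianalyticGerm (⋃ β ∈ B, arcSet m β) 0 :=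
    isSemianalyticGerm_biUnion B fun β hβ => isSemianalyticGerm_arcSet hm (hB β hβ)
  rcases B.eq_empty_or_nonempty with rfl | hne
  · exact (isSemianalyticGerm_empty 0).congr (Eventually.of_forall fun z => by simp [arcStar])
  · exact ((isSemianalyticGerm_singleton 0).union h1).congr
      (Eventually.of_forall fun z => by simp [arcStar, hne])

/-- Analyticity of finitely many functions at a point persists on a common neighbourhood, so the
condition can be handled at the level of germs. -/
theorem isSemianalytic_iff {S : Set X} : IsSemianalytic S ↔
    ∀ q : X, IsSemianalyticGerm ((chartAt ℂ q).symm ⁻¹' S) (chartAt ℂ q q) := by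
  constructor
  · intro h q
    obtain ⟨V, hV, hqV, -, n, m, F, G, hF, hG, hS⟩ := h q
    refine ⟨Fin n, Fin m, inferInstance, inferInstance, F, G, fun i => hF i _ hqV,
      fun i j => hG i j _ hqV, ?_⟩
    filter_upwards [hV.mem_nhds hqV] with w hw
    exact hS w hw
  · intro h q
    obtain ⟨ι, κ, _, _, F, G, hF, hG, hev⟩ := h q
    obtain ⟨n, ⟨eι⟩⟩ := Finite.exists_equiv_fin ι
    obtain ⟨m, ⟨eκ⟩⟩ := Finite.exists_equiv_fin κ
    have h1 : ∀ᶠ w in 𝓝 (chartAt ℂ q q), ∀ i, AnalyticAt ℝ (F i) w :=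
      eventually_all.2 fun i => (hF i).eventually_analyticAt
    have h2 : ∀ᶠ w in 𝓝 (chartAt ℂ q q), ∀ i j, AnalyticAt ℝ (G i j) w :=
      eventually_all.2 fun i => eventually_all.2 fun j => (hG i j).eventually_analyticAt
    have h3 : ∀ᶠ w in 𝓝 (chartAt ℂ q q), w ∈ (chartAt ℂ q).target :=
      (chartAt ℂ q).open_target.mem_nhds (mem_chart_target ℂ q)
    obtain ⟨V, hVsub, hV, hqV⟩ := mem_nhds_iff.1 (h1.and (h2.and (h3.and hev)))
    refine ⟨V, hV, hqV, fun w hw => (hVsub hw).2.2.1, n, m, fun i => F (eι.symm i),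
      fun i j => G (eι.symm i) (eκ.symm j), fun i w hw => (hVsub hw).1 _,
      fun i j w hw => (hVsub hw).2.1 _ _, fun w hw => ?_⟩
    refine (hVsub hw).2.2.2.trans ?_
    rw [← eι.symm.exists_congr_right]
    exact exists_congr fun i => and_congr_right fun _ => eκ.symm.forall_congr_right.symm

/-- The curve formed by the non-isolated points. -/
theorem isSemianalyticCurve_derivedSet [T1Space X] {T : Set X} (hT : IsClosed T)
    (harcs : ∀ q, ∃ m B, HasArcsAt T q m B) : IsSemianalyticCurve (derivedSet T) := by
  refine ⟨isSemianalytic_iff.2 fun q => ?_, ⟨isClosed_derivedSet T, fun q hq => ?_⟩, ?_⟩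
  · obtain ⟨m, B, h⟩ := harcs q
    have hev := h.eventually_mem_derivedSet_iff hT
    have hg : IsSemianalyticGerm (arcStar m B) ((fun w => w - chartAt ℂ q q) (chartAt ℂ q q)) := by
      simpa using isSemianalyticGerm_arcStar h.1 h.2.1
    refine (IsSemianalyticGerm.preimage (φ := fun w => w - chartAt ℂ q q) hg (by fun_prop)).congr ?_
    have ht : Tendsto (fun w => w - chartAt ℂ q q) (𝓝 (chartAt ℂ q q)) (𝓝 0) := by
      have : Continuous fun w : ℂ => w - chartAt ℂ q q := by fun_prop
      simpa using this.tendsto (chartAt ℂ q q)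
    filter_upwards [ht.eventually hev] with w hw
    rw [mem_preimage, mem_preimage, ← hw, centredChart, add_sub_cancel]
  · obtain ⟨m, B, h⟩ := harcs q
    have hev := h.eventually_mem_derivedSet_iff hT
    have ht := (eventually_mem_target q).self_of_nhds
    have h0 := hev.self_of_nhds
    rw [centredChart_zero] at h0
    obtain ⟨β, hβ⟩ : B.Nonempty := by
      rcases h0.1 hq with ⟨-, hne⟩ | ⟨β, hβ, -⟩
      exacts [hne, ⟨β, hβ⟩]
    have hacc := (accPt_of_arcs h.1 (h.2.1 β hβ)).self_of_nhds (Or.inl rfl)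
    have := (accPt_centredChart (q := q) ht (T := derivedSet T)).2
      (accPt_congr hacc (nhdsWithin_le_nhds (hev.mono fun w hw hwβ => hw.2 (Or.inr ⟨β, hβ, hwβ⟩))))
    rwa [centredChart_zero] at this
  · refine eq_empty_of_forall_notMem fun q hq => ?_
    obtain ⟨m, B, h⟩ := harcs q
    have hev := h.eventually_mem_derivedSet_iff hT
    have hmem : ∀ᶠ z in 𝓝 (0 : ℂ), centredChart q z ∈ derivedSet T := by
      have : ∀ᶠ x in 𝓝 q, x ∈ derivedSet T := mem_interior_iff_mem_nhds.1 hq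
      rwa [← map_centredChart_zero q, eventually_map] at this
    refine not_eventually_mem_arcSet m B ?_
    filter_upwards [nhdsWithin_le_nhds hev, nhdsWithin_le_nhds hmem, self_mem_nhdsWithin]
      with z h1 h2 h3
    exact (h1.1 h2).resolve_left fun h => h3 h.1

/-- The connected components of the curve are open in the curve. -/
theorem connectedComponentIn_derivedSet_mem_nhds {T : Set X} (hT : IsClosed T)
    (harcs : ∀ q, ∃ m B, HasArcsAt T q m B) {q : X} (hq : q ∈ derivedSet T) :
    ∀ᶠ x in 𝓝 q, x ∈ derivedSet T → x ∈ connectedComponentIn (derivedSet T) q := by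
  obtain ⟨m, B, h⟩ := harcs q
  obtain ⟨hm, hB, -⟩ := id h
  have hev := h.eventually_mem_derivedSet_iff hT
  have h0 := hev.self_of_nhds
  rw [centredChart_zero] at h0
  have hne : B.Nonempty := by
    rcases h0.1 hq with ⟨-, hne⟩ | ⟨β, hβ, -⟩
    exacts [hne, ⟨β, hβ⟩]
  obtain ⟨ε, hε, hball⟩ := Metric.eventually_nhds_iff_ball.1 (hev.and (eventually_mem_target q))
  have hc : ∀ᶠ s in 𝓝 (0 : ℝ), ∀ β ∈ B, ContinuousAt β s := by
    rw [Filter.eventually_all_finset]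
    exact fun β hβ => (hB β hβ).eventually_analyticAt.mono fun s hs => hs.continuousAt
  obtain ⟨δ₀, hδ₀, hδc⟩ := Metric.eventually_nhds_iff_ball.1 hc
  obtain ⟨δ, hδ, hδ1, hδ2⟩ : ∃ δ > 0, δ ≤ δ₀ ∧ δ ^ m < ε := by
    have ht : Tendsto (fun δ : ℝ => δ ^ m) (𝓝[>] 0) (𝓝 0) := by
      have : Continuous fun δ : ℝ => δ ^ m := by fun_prop
      have := this.tendsto 0
      rw [zero_pow hm] at this
      exact this.mono_left nhdsWithin_le_nhds
    have h4 : ∀ᶠ δ in 𝓝[>] (0 : ℝ), δ ≤ δ₀ := nhdsWithin_le_nhds (Iic_mem_nhds hδ₀)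
    obtain ⟨δ, h1, h2, h3⟩ :=
      ((ht.eventually (gt_mem_nhds hε)).and (h4.and self_mem_nhdsWithin)).exists
    exact ⟨δ, h3, h2, h1⟩
  have hpre : ∀ β ∈ B, IsPreconnected (insert 0 (arcSet m β ∩ Metric.ball 0 (δ ^ m))) := by
    refine fun β hβ => isPreconnected_insert_arcSet_inter_ball hm hδ fun s hs => ?_
    refine hδc s ?_ β hβ
    rw [mem_ball_zero_iff, Real.norm_of_nonneg hs.1]
    exact hs.2.trans_le hδ1
  have hsub : Metric.ball (0 : ℂ) (δ ^ m) ⊆ Metric.ball 0 ε := Metric.ball_subset_ball hδ2.le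
  -- Each short arc together with `q` is connected and lies in the curve, so it stays in the
  -- component of `q`.
  have hcomp : ∀ β ∈ B, ∀ z ∈ arcSet m β ∩ Metric.ball 0 (δ ^ m),
      centredChart q z ∈ connectedComponentIn (derivedSet T) q := by
    intro β hβ z hz
    have hin : ∀ w ∈ insert 0 (arcSet m β ∩ Metric.ball 0 (δ ^ m)),
        w ∈ Metric.ball (0 : ℂ) ε ∧ w ∈ arcStar m B := by
      rintro w (rfl | hw)
      exacts [⟨Metric.mem_ball_self hε, Or.inl ⟨rfl, hne⟩⟩, ⟨hsub hw.2, Or.inr ⟨β, hβ, hw.1⟩⟩]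
    have himg := (hpre β hβ).image (centredChart q)
      ((continuousOn_centredChart q).mono fun w hw => (hball w (hin w hw).1).2)
    refine himg.subset_connectedComponentIn ⟨0, mem_insert _ _, centredChart_zero q⟩ ?_
      ⟨z, mem_insert_of_mem _ hz, rfl⟩
    rintro _ ⟨w, hw, rfl⟩
    exact (hball w (hin w hw).1).1.2 (hin w hw).2
  rw [← map_centredChart_zero q, eventually_map]
  filter_upwards [Metric.ball_mem_nhds (0 : ℂ) (pow_pos hδ m)] with z hz hzT
  rcases (hball z (hsub hz)).1.1 hzT with ⟨rfl, -⟩ | ⟨β, hβ, hzβ⟩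
  · rw [centredChart_zero]
    rw [centredChart_zero] at hzT
    exact mem_connectedComponentIn hq
  · exact hcomp β hβ z ⟨hzβ, hz⟩

end Curve

/-! ### Local finiteness of the components of the curve and of its complement -/

section Components

variable {X : Type*} [TopologicalSpace X] {S : Set X}

/-- When components are open in the closed set `S`, a component coincides near each point either
with `S` or with the empty set. Local properties of `S` therefore pass to its components. -/
theorem eventually_mem_connectedComponentIn_iff_or (hS : IsClosed S)
    (hcomp : ∀ q ∈ S, ∀ᶠ x in 𝓝 q, x ∈ S → x ∈ connectedComponentIn S q) (x q : X) :
    (∀ᶠ y in 𝓝 q, y ∈ connectedComponentIn S x ↔ y ∈ S) ∨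
      (q ∉ connectedComponentIn S x ∧ ∀ᶠ y in 𝓝 q, y ∉ connectedComponentIn S x) := by
  by_cases hqS : q ∈ S
  · by_cases hq : q ∈ connectedComponentIn S x
    · refine Or.inl ((hcomp q hqS).mono fun y hy => ?_)
      rw [connectedComponentIn_eq hq]
      exact ⟨fun h => connectedComponentIn_subset _ _ h, hy⟩
    · refine Or.inr ⟨hq, (hcomp q hqS).mono fun y hy hyx => hq ?_⟩
      rw [connectedComponentIn_eq hyx,
        ← connectedComponentIn_eq (hy (connectedComponentIn_subset _ _ hyx))]
      exact mem_connectedComponentIn hqS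
  · refine Or.inr ⟨fun h => hqS (connectedComponentIn_subset _ _ h), ?_⟩
    filter_upwards [hS.isOpen_compl.mem_nhds hqS] with y hy h
    exact hy (connectedComponentIn_subset _ _ h)

/-- A point of `S` has a neighbourhood meeting only its own component, and a point off `S` has one
meeting none. -/
theorem locallyFinite_connectedComponentIn (hS : IsClosed S)
    (hcomp : ∀ q ∈ S, ∀ᶠ x in 𝓝 q, x ∈ S → x ∈ connectedComponentIn S q) :
    LocallyFinite fun C : {C | ∃ x ∈ S, C = connectedComponentIn S x} => (C : Set X) := by
  intro q
  by_cases hq : q ∈ S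
  · refine ⟨_, hcomp q hq, Set.Subsingleton.finite ?_⟩
    have key : ∀ C ∈ {C | ∃ x ∈ S, C = connectedComponentIn S x},
        (C ∩ {x | x ∈ S → x ∈ connectedComponentIn S q}).Nonempty →
        C = connectedComponentIn S q := by
      rintro _ ⟨x, hx, rfl⟩ ⟨y, hy, hyq⟩
      rw [connectedComponentIn_eq hy, ← connectedComponentIn_eq
        (hyq (connectedComponentIn_subset _ _ hy))]
    intro C hC D hD
    exact Subtype.ext ((key C C.2 hC).trans (key D D.2 hD).symm)
  · refine ⟨_, hS.isOpen_compl.mem_nhds hq, Set.Subsingleton.finite ?_⟩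
    rintro ⟨_, x, hx, rfl⟩ ⟨y, hy, hyS⟩
    exact absurd (connectedComponentIn_subset _ _ hy) hyS

variable [ChartedSpace ℂ X]

theorem IsSemianalyticCurve.connectedComponentIn (hS : IsSemianalyticCurve S)
    (hcomp : ∀ q ∈ S, ∀ᶠ x in 𝓝 q, x ∈ S → x ∈ connectedComponentIn S q) (x : X) :
    IsSemianalyticCurve (connectedComponentIn S x) := by
  have hor := eventually_mem_connectedComponentIn_iff_or hS.perfect.closed hcomp x
  refine ⟨isSemianalytic_iff.2 fun q => ?_, ⟨?_, fun q hq => ?_⟩, ?_⟩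
  · have ht : Tendsto (chartAt ℂ q).symm (𝓝 (chartAt ℂ q q)) (𝓝 q) := by
      have := (chartAt ℂ q).symm.continuousAt (mem_chart_target ℂ q)
      rwa [ContinuousAt, (chartAt ℂ q).left_inv (mem_chart_source ℂ q)] at this
    rcases hor q with h | ⟨-, h⟩
    · exact (isSemianalytic_iff.1 hS.semianalytic q).congr
        ((ht.eventually h).mono fun w hw => by simpa using hw)
    · exact (isSemianalyticGerm_empty _).congr
        ((ht.eventually h).mono fun w hw => by simpa using hw)
  · rw [← isOpen_compl_iff, isOpen_iff_mem_nhds]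
    intro q hq
    rcases hor q with h | ⟨-, h⟩
    · have : q ∉ S := fun hS => hq (h.self_of_nhds.2 hS)
      filter_upwards [hS.perfect.closed.isOpen_compl.mem_nhds this] with y hy h
      exact hy (connectedComponentIn_subset _ _ h)
    · exact h
  · rcases hor q with h | ⟨h, -⟩
    · have hacc := hS.perfect.acc q (connectedComponentIn_subset _ _ hq)
      rw [accPt_iff_frequently_nhdsNE] at hacc ⊢
      exact (hacc.and_eventually (nhdsWithin_le_nhds h)).mono fun y hy => hy.2.2 hy.1
    · exact absurd hq h
  · exact subset_empty_iff.1
      (hS.interior_eq_empty ▸ interior_mono (connectedComponentIn_subset S x))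

/-- The components of the complement of the curve are locally finite. -/
theorem finite_connectedComponentIn_diff_derivedSet {T : Set X} (hT : IsClosed T)
    {W : Set X} (hW : IsOpen W) {q : X} (hq : q ∈ W) {m : ℕ} {B : Finset (ℝ → ℝ)}
    (h : HasArcsAt T q m B) : ∃ N ∈ 𝓝 q,
      {C : Set X | (∃ y ∈ W \ derivedSet T, C = connectedComponentIn (W \ derivedSet T) y) ∧
        (C ∩ N).Nonempty}.Finite := by
  obtain ⟨hm, hB, -⟩ := id h
  have hev := h.eventually_mem_derivedSet_iff hT
  have hWev : ∀ᶠ z in 𝓝 (0 : ℂ), centredChart q z ∈ W := by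
    have := hW.mem_nhds hq
    rwa [← map_centredChart_zero q] at this
  obtain ⟨ε, hε, hball⟩ :=
    Metric.eventually_nhds_iff_ball.1 (hev.and ((eventually_mem_target q).and hWev))
  have ht : Tendsto (fun δ : ℝ => δ ^ m) (𝓝[>] 0) (𝓝 0) := by
    have : Continuous fun δ : ℝ => δ ^ m := by fun_prop
    have := this.tendsto 0
    rw [zero_pow hm] at this
    exact this.mono_left nhdsWithin_le_nhds
  obtain ⟨δ, hδ1, ⟨𝓑, hfin, hpre, hcov⟩, hδ⟩ := ((ht.eventually (gt_mem_nhds hε)).and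
    ((exists_finite_sectors hm B hB).and self_mem_nhdsWithin)).exists
  have hsub : Metric.ball (0 : ℂ) (δ ^ m) ⊆ Metric.ball 0 ε := Metric.ball_subset_ball hδ1.le
  refine ⟨centredChart q '' Metric.ball 0 (δ ^ m), ?_, ?_⟩
  · rw [← map_centredChart_zero q]
    exact image_mem_map (Metric.ball_mem_nhds 0 (pow_pos hδ m))
  -- A connected sector lies in a single component of the complement, which `F` recovers. Components
  -- meeting the small disc are thus values of `F` on the finitely many sectors, or the component of
  -- the centre.
  set F : Set ℂ → Set X := fun D =>
    {x | ∃ z ∈ D, x ∈ connectedComponentIn (W \ derivedSet T) (centredChart q z)} with hF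
  refine ((hfin.image F).insert (connectedComponentIn (W \ derivedSet T) q)).subset ?_
  rintro _ ⟨⟨y, -, rfl⟩, x, hx, z, hz, rfl⟩
  have hxW := connectedComponentIn_subset _ _ hx
  rcases eq_or_ne z 0 with rfl | hz0
  · left
    rw [centredChart_zero] at hx
    exact connectedComponentIn_eq hx
  right
  have hzU : z ∈ ⋃₀ 𝓑 := by
    rw [hcov]
    exact ⟨hz, hz0, fun β hβ hzβ => hxW.2 ((hball z (hsub hz)).1.2 (Or.inr ⟨β, hβ, hzβ⟩))⟩
  obtain ⟨D, hD, hzD⟩ := hzU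
  have hDsub : ∀ w ∈ D, w ∈ Metric.ball (0 : ℂ) ε ∧ w ∉ arcStar m B := by
    intro w hw
    have : w ∈ ⋃₀ 𝓑 := ⟨D, hD, hw⟩
    rw [hcov] at this
    refine ⟨hsub this.1, ?_⟩
    rintro (⟨h0, -⟩ | ⟨β, hβ, hwβ⟩)
    exacts [this.2.1 h0, this.2.2 β hβ hwβ]
  have himg := (hpre D hD).image (centredChart q)
    ((continuousOn_centredChart q).mono fun w hw => (hball w (hDsub w hw).1).2.1)
  have hDW : centredChart q '' D ⊆ W \ derivedSet T := by
    rintro _ ⟨w, hw, rfl⟩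
    have := hball w (hDsub w hw).1
    exact ⟨this.2.2, fun hw' => (hDsub w hw).2 (this.1.1 hw')⟩
  have heq : ∀ w ∈ D, connectedComponentIn (W \ derivedSet T) (centredChart q w) =
      connectedComponentIn (W \ derivedSet T) y := by
    intro w hw
    rw [connectedComponentIn_eq hx]
    exact (connectedComponentIn_eq
      (himg.subset_connectedComponentIn ⟨z, hzD, rfl⟩ hDW ⟨w, hw, rfl⟩)).symm
  refine ⟨D, hD, ?_⟩
  ext x'
  constructor
  · rintro ⟨w, hw, hx'⟩
    rwa [heq w hw] at hx'
  · intro hx'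
    exact ⟨z, hzD, by rwa [heq z hzD]⟩

end Components

/-! ### The distributional Laplacian -/

section Laplacian

open Laplacian

/-- A cutoff equal to `1` near the support of the test function turns `h` into a compactly supported
smooth function, for which Green's identity on the whole plane has no boundary term. -/
theorem exists_integral_mul_laplacian_eq_zero {h : ℂ → ℝ} {c : ℂ} (hh : HarmonicAt h c) :
    ∃ r > 0, ∀ ψ : ℂ → ℝ, ContDiff ℝ ∞ ψ → HasCompactSupport ψ → tsupport ψ ⊆ Metric.ball c r →
      ∫ w : ℂ, h w * Δ ψ w = 0 := by
  have h1 : ∀ᶠ w in 𝓝 c, AnalyticAt ℝ h w := (HarmonicAt.analyticAt hh).eventually_analyticAt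
  obtain ⟨r, hr, hball⟩ := Metric.eventually_nhds_iff_ball.1 (h1.and hh.2)
  let χ : ContDiffBump c := ⟨r / 3, r / 2, by positivity, by linarith⟩
  set φ : ℂ → ℝ := fun w => χ w * h w with hφ
  have hsupp : tsupport φ ⊆ tsupport χ := tsupport_mul_subset_left
  have hφc : HasCompactSupport φ := χ.hasCompactSupport.mul_right
  have hφs : ContDiff ℝ ∞ φ := by
    refine contDiff_iff_contDiffAt.2 fun w => ?_
    by_cases hw : w ∉ tsupport φ
    · exact contDiffAt_const.congr_of_eventuallyEq (notMem_tsupport_iff_eventuallyEq.1 hw)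
    rw [not_not] at hw
    have hw' : w ∈ Metric.closedBall c (r / 2) := χ.tsupport_eq ▸ hsupp hw
    refine χ.contDiff.contDiffAt.mul (hball w ?_).1.contDiffAt
    exact Metric.closedBall_subset_ball (by linarith) hw'
  have hφeq : ∀ w ∈ Metric.ball c (r / 3), φ w = h w := fun w hw => by
    simp [hφ, χ.one_of_mem_closedBall (Metric.ball_subset_closedBall hw)]
  refine ⟨r / 3, by positivity, fun ψ hψ hψc hψs => ?_⟩
  have hΔψ : ∀ w ∉ Metric.ball c (r / 3), Δ ψ w = 0 := by
    intro w hw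
    have h0 : ψ =ᶠ[𝓝 w] fun _ => 0 := notMem_tsupport_iff_eventuallyEq.1 fun h => hw (hψs h)
    have := (laplacian_congr_nhds h0).self_of_nhds
    rw [this]
    exact (harmonicAt_const 0).2.self_of_nhds
  have hΔφ : ∀ w ∈ Metric.ball c (r / 3), Δ φ w = 0 := by
    intro w hw
    have h0 : φ =ᶠ[𝓝 w] h := by
      filter_upwards [Metric.isOpen_ball.mem_nhds hw] with z hz using hφeq z hz
    rw [(laplacian_congr_nhds h0).self_of_nhds]
    exact (hball w (Metric.ball_subset_ball (by linarith) hw)).2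
  have key := SchwartzMap.integral_mul_laplacian_right_eq_left (μ := (volume : Measure ℂ))
    (hφc.toSchwartzMap hφs) (hψc.toSchwartzMap hψ)
  simp only [SchwartzMap.laplacian_apply] at key
  have hl : ∀ w, h w * Δ ψ w = φ w * Δ ψ w := fun w => by
    by_cases hw : w ∈ Metric.ball c (r / 3)
    · rw [hφeq w hw]
    · simp [hΔψ w hw]
  have hr0 : ∀ w, Δ φ w * ψ w = 0 := fun w => by
    by_cases hw : w ∈ Metric.ball c (r / 3)
    · rw [hΔφ w hw, zero_mul]
    · rw [image_eq_zero_of_notMem_tsupport fun h => hw (hψs h), mul_zero]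
  calc ∫ w : ℂ, h w * Δ ψ w = ∫ w : ℂ, φ w * Δ ψ w := integral_congr_ae (.of_forall hl)
    _ = ∫ w : ℂ, Δ φ w * ψ w := key
    _ = 0 := by simp [hr0]

theorem notMem_laplacianSupport {X : Type*} [TopologicalSpace X] [ChartedSpace ℂ X]
    {g : X → EReal} {x : X} (h : IsHarmonicAt g x) : x ∉ laplacianSupport g := by
  rw [isHarmonicAt_iff_chartAt] at h
  obtain ⟨u, hu, hev⟩ := h
  obtain ⟨r, hr, hint⟩ := exists_integral_mul_laplacian_eq_zero hu
  have ht : ∀ᶠ w in 𝓝 (chartAt ℂ x x), w ∈ (chartAt ℂ x).target :=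
    (chartAt ℂ x).open_target.mem_nhds (mem_chart_target ℂ x)
  obtain ⟨V, hVsub, hV, hxV⟩ :=
    mem_nhds_iff.1 (hev.and (ht.and (Metric.ball_mem_nhds (chartAt ℂ x x) hr)))
  refine not_not.2 ⟨V, hV, hxV, fun w hw => (hVsub hw).2.1, fun ψ hψ hψc hψs => ?_⟩
  rw [← hint ψ hψ hψc fun w hw => (hVsub (hψs hw)).2.2]
  refine integral_congr_ae (.of_forall fun w => ?_)
  by_cases hw : w ∈ tsupport ψ
  · simp [(hVsub (hψs hw)).1]
  · have h0 : ψ =ᶠ[𝓝 w] fun _ => 0 := notMem_tsupport_iff_eventuallyEq.1 hw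
    have : Δ ψ w = 0 := by
      rw [(laplacian_congr_nhds h0).self_of_nhds]
      exact (harmonicAt_const 0).2.self_of_nhds
    simp [this]

end Laplacian

/-! ### Local integrability -/

section Integrability

/-- The function `‖z‖⁻¹` is locally integrable in real dimension two, and the centre, where no bound
is assumed, is a null set. -/
theorem integrableAt_of_norm_le_inv {f : ℂ → ℝ} {c : ℂ} {C : ℝ}
    (hf : ∀ᶠ w in 𝓝[≠] c, ‖f w‖ ≤ C * ‖w - c‖⁻¹) {s : Set ℂ} (hs : s ∈ 𝓝 c)
    (hm : AEStronglyMeasurable f (volume.restrict s)) : IntegrableAtFilter f (𝓝 c) volume := by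
  obtain ⟨δ, hδ, hball⟩ := Metric.eventually_nhds_iff_ball.1
    ((eventually_nhdsWithin_iff.1 hf).and hs)
  have hint : LocallyIntegrable (fun z : ℂ => C * ‖z‖⁻¹) volume := by
    refine locallyIntegrable_of_norm_le_rpow (C := |C|) (α := 1) (by simp) (by simp) ?_ ?_
    · refine .of_forall fun z => ?_
      rw [Real.rpow_neg_one, norm_mul, norm_inv, norm_norm, Real.norm_eq_abs]
    · exact (measurable_norm.inv.const_mul C).aestronglyMeasurable
  have hint' : IntegrableOn (fun z : ℂ => C * ‖z‖⁻¹) (Metric.ball 0 δ) :=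
    (hint.integrableOn_isCompact (isCompact_closedBall (0 : ℂ) δ)).mono_set
      Metric.ball_subset_closedBall
  have hb := ((integrable_indicator_iff measurableSet_ball).2 hint').comp_sub_right c
  refine ⟨Metric.ball c δ, Metric.ball_mem_nhds c hδ, Integrable.mono' hb.integrableOn
    (hm.mono_measure (Measure.restrict_mono (fun w hw => (hball w hw).2) le_rfl)) ?_⟩
  have hne : ∀ᵐ w ∂(volume.restrict (Metric.ball c δ)), w ≠ c :=
    ae_restrict_of_ae (Measure.ae_ne volume c)
  filter_upwards [hne, ae_restrict_mem measurableSet_ball] with w hw hwb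
  rw [indicator_of_mem (by simpa [dist_eq_norm] using hwb)]
  exact (hball w hwb).1 hw

theorem norm_log_le_inv {t : ℝ} (ht : 0 < t) (ht1 : t ≤ 1) : |Real.log t| ≤ t⁻¹ := by
  rw [abs_of_nonpos (Real.log_nonpos ht.le ht1), ← Real.log_inv]
  exact (Real.log_le_sub_one_of_pos (inv_pos.2 ht)).trans (by linarith)

/-- A nonzero derivative bounds `‖τ w - τ c‖` below by a multiple of `‖w - c‖`, and `|log t| ≤ t⁻¹`
for `0 < t ≤ 1`. The continuous part is bounded and is absorbed using `1 ≤ ‖w - c‖⁻¹` near `c`. -/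
theorem exists_norm_logHarm_comp_le {τ : ℂ → ℂ} {c : ℂ} (hτ : DifferentiableAt ℂ τ c)
    (hd : deriv τ c ≠ 0) {r : ℝ} {k : ℂ → ℝ} (hk : ContinuousAt k (τ c)) :
    ∃ C, ∀ᶠ w in 𝓝[≠] c, ‖r * Real.log ‖τ w - τ c‖ + k (τ w)‖ ≤ C * ‖w - c‖⁻¹ := by
  set a := ‖deriv τ c‖ / 2 with ha
  have ha0 : 0 < a := by positivity
  have h1 : ∀ᶠ w in 𝓝[≠] c, a * ‖w - c‖ ≤ ‖τ w - τ c‖ := by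
    have ht := (hasDerivAt_iff_tendsto_slope.1 hτ.hasDerivAt).norm
    have hlt : a < ‖deriv τ c‖ := by
      have := norm_pos_iff.2 hd
      linarith
    filter_upwards [ht.eventually (lt_mem_nhds hlt), self_mem_nhdsWithin] with w hw hne
    have hpos : 0 < ‖w - c‖ := norm_pos_iff.2 (sub_ne_zero.2 hne)
    rw [slope_def_field, norm_div, lt_div_iff₀ hpos] at hw
    exact hw.le
  have h2 : ∀ᶠ w in 𝓝[≠] c, ‖τ w - τ c‖ ≤ 1 := by
    have ht : Tendsto (fun w => ‖τ w - τ c‖) (𝓝 c) (𝓝 0) := by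
      have : ContinuousAt (fun w => ‖τ w - τ c‖) c := (hτ.continuousAt.sub continuousAt_const).norm
      simpa [ContinuousAt] using this
    exact nhdsWithin_le_nhds (ht.eventually (ge_mem_nhds one_pos))
  have h3 : ∀ᶠ w in 𝓝[≠] c, ‖k (τ w)‖ ≤ ‖k (τ c)‖ + 1 := by
    have ht : ContinuousAt (fun w => ‖k (τ w)‖) c :=
      (ContinuousAt.comp (f := τ) (g := k) hk hτ.continuousAt).norm
    exact nhdsWithin_le_nhds (ht.eventually (ge_mem_nhds (lt_add_one _)))
  have h4 : ∀ᶠ w in 𝓝[≠] c, ‖w - c‖ ≤ 1 := by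
    have ht : Continuous fun w : ℂ => ‖w - c‖ := by fun_prop
    refine nhdsWithin_le_nhds ((ht.tendsto c).eventually (ge_mem_nhds ?_))
    simp
  refine ⟨|r| * a⁻¹ + (‖k (τ c)‖ + 1), ?_⟩
  filter_upwards [h1, h2, h3, h4, self_mem_nhdsWithin] with w h1 h2 h3 h4 hne
  have hpos : 0 < ‖w - c‖ := norm_pos_iff.2 (sub_ne_zero.2 hne)
  have hτpos : 0 < ‖τ w - τ c‖ := (mul_pos ha0 hpos).trans_le h1
  have h5 : |Real.log ‖τ w - τ c‖| ≤ a⁻¹ * ‖w - c‖⁻¹ := by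
    refine (norm_log_le_inv hτpos h2).trans ?_
    rw [← mul_inv]
    exact inv_anti₀ (mul_pos ha0 hpos) h1
  have h6 : 1 ≤ ‖w - c‖⁻¹ := (one_le_inv₀ hpos).2 h4
  calc ‖r * Real.log ‖τ w - τ c‖ + k (τ w)‖
      ≤ ‖r * Real.log ‖τ w - τ c‖‖ + ‖k (τ w)‖ := norm_add_le _ _
    _ = |r| * |Real.log ‖τ w - τ c‖| + ‖k (τ w)‖ := by
      rw [norm_mul, Real.norm_eq_abs, Real.norm_eq_abs (Real.log _)]
    _ ≤ |r| * (a⁻¹ * ‖w - c‖⁻¹) + (‖k (τ c)‖ + 1) * ‖w - c‖⁻¹ := by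
      refine add_le_add (mul_le_mul_of_nonneg_left h5 (abs_nonneg r)) (h3.trans ?_)
      exact le_mul_of_one_le_right (by positivity) h6
    _ = (|r| * a⁻¹ + (‖k (τ c)‖ + 1)) * ‖w - c‖⁻¹ := by ring

/-- The logarithmic expansion at a point is given in the chart centred there, while integrability is
tested in another chart; the bound is therefore stated for the transition map `τ`. -/
theorem isLocallyIntegrableOn_of_log {X : Type*} [TopologicalSpace X] [ChartedSpace ℂ X]
    [IsManifold 𝓘(ℂ) ω X] {g : X → EReal} (hg : Continuous g)
    (hlog : ∀ x, HasAtMostLogSingularityAt g x) (U : Set X) : IsLocallyIntegrableOn g U := by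
  intro x c hc
  set e := chartAt ℂ x
  refine IntegrableAtFilter.filter_mono nhdsWithin_le_nhds ?_
  set p := e.symm c
  have hp : p ∈ e.source := e.map_target hc.1
  have hep : e p = c := e.right_inv hc.1
  have he : e ∈ IsManifold.maximalAtlas 𝓘(ℂ) ω X := IsManifold.chart_mem_maximalAtlas x
  have he' : chartAt ℂ p ∈ IsManifold.maximalAtlas 𝓘(ℂ) ω X := IsManifold.chart_mem_maximalAtlas p
  have hp' := mem_chart_source ℂ p
  obtain ⟨r, k, hk, hexp, -⟩ := hlog p
  set τ : ℂ → ℂ := fun w => chartAt ℂ p (e.symm w) with hτ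
  have han : AnalyticAt ℂ τ c := hep ▸ analyticAt_transition he he' hp hp'
  have hd : deriv τ c ≠ 0 := hep ▸ deriv_transition_ne_zero he he' hp hp'
  obtain ⟨C, hC⟩ := exists_norm_logHarm_comp_le (r := r) han.differentiableAt hd
    (k := k) hk.self_of_nhds
  refine integrableAt_of_norm_le_inv (C := C) (s := e.target) ?_ (e.open_target.mem_nhds hc.1) ?_
  · have ht : Tendsto e.symm (𝓝[≠] c) (𝓝[≠] p) := by
      refine tendsto_nhdsWithin_iff.2
        ⟨(e.symm.continuousAt hc.1).tendsto.mono_left nhdsWithin_le_nhds, ?_⟩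
      filter_upwards [nhdsWithin_le_nhds (e.open_target.mem_nhds hc.1), self_mem_nhdsWithin]
        with w hw hne heq
      exact hne (e.symm.injOn hw hc.1 heq)
    filter_upwards [hC, ht.eventually hexp] with w h1 h2
    rw [h2, EReal.toReal_coe]
    exact h1
  · have hcont : ContinuousOn (fun w => g (e.symm w)) e.target :=
      hg.comp_continuousOn e.continuousOn_symm
    exact (measurable_ereal_toReal.comp_aemeasurable
      (hcont.aemeasurable e.open_target.measurableSet)).aestronglyMeasurable

end Integrability

/-! ### Subharmonicity -/

section Subharmonic

variable {X : Type*} [TopologicalSpace X] [ChartedSpace ℂ X]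

theorem neBot_nhdsNE (q : X) : (𝓝[≠] q).NeBot := by
  have h0 := (eventually_mem_target q).self_of_nhds
  have := (accPt_centredChart (q := q) h0 (T := univ)).2
    (by simpa [AccPt] using (inferInstance : (𝓝[≠] (0 : ℂ)).NeBot))
  simpa [centredChart_zero, AccPt] using this

theorem exists_mem_connectedComponentIn_ne_bot {g : X → EReal} {U : Set X} (hU : IsOpen U) {x : X}
    (hx : x ∈ U) (hreal : ∀ᶠ y in 𝓝[≠] x, g y = (((g y).toReal : ℝ) : EReal)) :
    ∃ y ∈ connectedComponentIn U x, g y ≠ ⊥ := by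
  have := ChartedSpace.locallyConnectedSpace ℂ X
  have := neBot_nhdsNE x
  have hcc : connectedComponentIn U x ∈ 𝓝 x :=
    connectedComponentIn_mem_nhds (hU.mem_nhds hx)
  obtain ⟨y, h1, h2⟩ := (hreal.and (nhdsWithin_le_nhds hcc)).exists
  exact ⟨y, h2, h1 ▸ EReal.coe_ne_bot _⟩

/-- The local maximum principle implies domination by harmonic functions. -/
theorem le_harmonic_of_maximum_principle [IsManifold 𝓘(ℂ) ω X] {g : X → EReal} {U : Set X}
    (hcont : Continuous g) (hlt : ∀ x ∈ U, g x < ⊤)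
    (hmax : ∀ q ∈ U, ∀ k : X → EReal, IsHarmonicAt k q → (∀ᶠ x in 𝓝 q, g x ≤ k x) → g q = k q →
      ∀ᶠ x in 𝓝 q, g x = k x)
    {e : OpenPartialHomeomorph X ℂ} (he : e ∈ IsManifold.maximalAtlas 𝓘(ℂ) ω X) {c : ℂ} {R : ℝ}
    (hR : 0 < R) (hsub : Metric.closedBall c R ⊆ e.target)
    (hU : e.symm '' Metric.closedBall c R ⊆ U) {h : ℂ → ℝ}
    (hh : ContinuousOn h (Metric.closedBall c R)) (hharm : HarmonicOnNhd h (Metric.ball c R))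
    (hbd : ∀ w ∈ Metric.sphere c R, g (e.symm w) ≤ (h w : EReal)) :
    ∀ w ∈ Metric.ball c R, g (e.symm w) ≤ (h w : EReal) := by
  intro w₁ hw₁
  by_contra hcon
  rw [not_le] at hcon
  -- The difference of the two functions may be `-∞` but is continuous with values below `+∞`, so it
  -- attains a maximum on the closed disc, real and positive if domination fails.
  set v : ℂ → EReal := fun w => g (e.symm w) + ((-h w : ℝ) : EReal) with hv
  have hvle : ∀ (w : ℂ) (a : ℝ), v w ≤ a ↔ g (e.symm w) ≤ ((h w + a : ℝ) : EReal) := by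
    intro w a
    simp only [hv]
    rw [EReal.coe_neg, ← sub_eq_add_neg,
      EReal.sub_le_iff_le_add (.inl (EReal.coe_ne_bot _)) (.inl (EReal.coe_ne_top _)), add_comm (h w),
      EReal.coe_add]
  have hvge : ∀ (w : ℂ) (a : ℝ), (a : EReal) ≤ v w ↔ ((h w + a : ℝ) : EReal) ≤ g (e.symm w) := by
    intro w a
    simp only [hv]
    rw [EReal.coe_neg, ← sub_eq_add_neg,
      EReal.le_sub_iff_add_le (.inl (EReal.coe_ne_bot _)) (.inl (EReal.coe_ne_top _)),
      add_comm (h w), EReal.coe_add]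
  have hvc : ContinuousOn v (Metric.closedBall c R) := by
    intro w hw
    have h1 : ContinuousWithinAt (fun w => g (e.symm w)) (Metric.closedBall c R) w :=
      (hcont.comp_continuousOn (e.continuousOn_symm.mono hsub)) w hw
    have h2 : ContinuousWithinAt (fun w => ((-h w : ℝ) : EReal)) (Metric.closedBall c R) w :=
      continuous_coe_real_ereal.continuousAt.comp_continuousWithinAt (hh w hw).neg
    have h3 := EReal.continuousAt_add (p := (g (e.symm w), ((-h w : ℝ) : EReal)))
      (.inr (EReal.coe_ne_bot _)) (.inr (EReal.coe_ne_top _))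
    exact h3.comp_continuousWithinAt (f := fun w => (g (e.symm w), ((-h w : ℝ) : EReal)))
      (h1.prodMk h2)
  obtain ⟨w₂, hw₂, hmaxw⟩ := (isCompact_closedBall c R).exists_isMaxOn
    ⟨c, Metric.mem_closedBall_self hR.le⟩ hvc
  have hpos : 0 < v w₂ := by
    refine lt_of_lt_of_le ?_ (hmaxw (Metric.ball_subset_closedBall hw₁))
    rw [← not_le, ← EReal.coe_zero, hvle, add_zero]
    exact not_le.2 hcon
  have hvtop : v w₂ ≠ ⊤ := by
    refine EReal.add_ne_top (hlt _ (hU ⟨w₂, hw₂, rfl⟩)).ne (EReal.coe_ne_top _)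
  obtain ⟨a, ha⟩ : ∃ a : ℝ, v w₂ = a :=
    ⟨_, (EReal.coe_toReal hvtop (ne_bot_of_gt hpos)).symm⟩
  have ha0 : 0 < a := by rw [ha] at hpos; exact_mod_cast hpos
  have hlea : ∀ w ∈ Metric.closedBall c R, v w ≤ a := fun w hw => ha ▸ hmaxw hw
  -- The set where the maximum is attained avoids the boundary circle, where the difference is at
  -- most `0`. It is closed by continuity and open by the local maximum principle.
  set Z : Set ℂ := Metric.closedBall c R ∩ v ⁻¹' {(a : EReal)} with hZ
  have hZball : Z ⊆ Metric.ball c R := by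
    rintro w ⟨hw, hwa⟩
    by_contra hnot
    have hws : w ∈ Metric.sphere c R :=
      le_antisymm (Metric.mem_closedBall.1 hw) (not_lt.1 hnot)
    have h0 : v w ≤ ((0 : ℝ) : EReal) := by
      rw [hvle, add_zero]
      exact hbd w hws
    rw [mem_preimage, mem_singleton_iff] at hwa
    rw [hwa] at h0
    exact absurd (EReal.coe_le_coe_iff.1 h0) (not_le.2 ha0)
  have hZclosed : IsClosed Z :=
    hvc.preimage_isClosed_of_isClosed Metric.isClosed_closedBall isClosed_singleton
  have hZopen : IsOpen Z := by
    rw [isOpen_iff_mem_nhds]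
    intro w hw
    have hwb := hZball hw
    have hwt := hsub hw.1
    have hnear : ∀ᶠ w' in 𝓝 w, w' ∈ Metric.ball c R := Metric.isOpen_ball.mem_nhds hwb
    set q := e.symm w with hq
    have hqs : q ∈ e.source := e.map_target hwt
    have heq : e q = w := e.right_inv hwt
    have hk : IsHarmonicAt (fun x => ((h (e x) + a : ℝ) : EReal)) q := by
      rw [isHarmonicAt_iff he hqs, heq]
      refine ⟨fun w' => h w' + a, (hharm w hwb).add (harmonicAt_const a), ?_⟩
      filter_upwards [e.open_target.mem_nhds hwt] with w' hw'
      rw [e.right_inv hw']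
    have hres := hmax q (hU ⟨w, hw.1, rfl⟩) _ hk ?_ ?_
    · filter_upwards [hnear, (e.symm.continuousAt hwt).eventually hres] with w' h1 h2
      have h1' := Metric.ball_subset_closedBall h1
      refine ⟨h1', ?_⟩
      rw [e.right_inv (hsub h1')] at h2
      exact le_antisymm ((hvle _ _).2 h2.le) ((hvge _ _).2 h2.ge)
    · have htend : Tendsto e (𝓝 q) (𝓝 w) := heq ▸ e.continuousAt hqs
      filter_upwards [htend.eventually hnear, e.open_source.mem_nhds hqs] with x h1 h2
      have := (hvle _ _).1 (hlea _ (Metric.ball_subset_closedBall h1))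
      rwa [e.left_inv h2] at this
    · have hwa : v w = a := hw.2
      rw [heq]
      exact le_antisymm ((hvle _ _).1 hwa.le) ((hvge _ _).1 hwa.ge)
  -- A nonempty clopen subset of the plane is everything, yet `Z` lies in a disc.
  have huniv : Z = univ := IsClopen.eq_univ ⟨hZclosed, hZopen⟩ ⟨w₂, hw₂, ha⟩
  have hbad : c + (R : ℂ) ∈ Metric.ball c R := hZball (huniv ▸ mem_univ _)
  simp [abs_of_pos hR] at hbad

end Subharmonic

/-! ### Local statements applied to the tropical trace -/

section Trace

theorem isOpen_setOf_isHarmonicAt {X : Type*} [TopologicalSpace X] [ChartedSpace ℂ X]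
    [IsManifold 𝓘(ℂ) ω X] (g : X → EReal) : IsOpen {x | IsHarmonicAt g x} := by
  rw [isOpen_iff_mem_nhds]
  intro x hx
  obtain ⟨h, hh, hev⟩ := isHarmonicAt_iff_chartAt.1 hx
  have hs := mem_chart_source ℂ x
  have h1 : ∀ᶠ w in 𝓝 (chartAt ℂ x x), HarmonicAt h w := hh.eventually
  have hcont : Tendsto (chartAt ℂ x) (𝓝 x) (𝓝 (chartAt ℂ x x)) := (chartAt ℂ x).continuousAt hs
  filter_upwards [hcont.eventually (h1.and hev.eventually_nhds),
    (chartAt ℂ x).open_source.mem_nhds hs] with y hy hys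
  exact (isHarmonicAt_iff (IsManifold.chart_mem_maximalAtlas x) hys).2 ⟨h, hy.1, hy.2⟩

/-- The points where the function is not harmonic. -/
def nonHarmonicLocus {X : Type*} [TopologicalSpace X] [ChartedSpace ℂ X] (g : X → EReal) : Set X :=
  {x | ¬ IsHarmonicAt g x}

theorem isClosed_nonHarmonicLocus {X : Type*} [TopologicalSpace X] [ChartedSpace ℂ X]
    [IsManifold 𝓘(ℂ) ω X] (g : X → EReal) : IsClosed (nonHarmonicLocus g) :=
  (isOpen_setOf_isHarmonicAt g).isClosed_compl

theorem IsLocalModel.lt_top {X J : Type*} [TopologicalSpace X] [ChartedSpace ℂ X] [Fintype J]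
    [Nonempty J] {g : X → EReal} {q : X} {m : ℕ} {ρ : J → ℝ} {H : J → ℂ → ℝ} {u : J → ℂ → EReal}
    (M : IsLocalModel g q m ρ H u) (hρ : ∀ j, 0 ≤ ρ j) : g q < ⊤ := by
  obtain ⟨j, hj⟩ := exists_eq_ciSup_of_finite (f := fun j => u j 0)
  rw [M.apply_eq, ← hj]
  rcases (hρ j).eq_or_lt with h | h
  · rw [M.apply_zero h.symm]
    exact EReal.coe_lt_top _
  · rw [M.apply_zero_of_pos h]
    exact bot_lt_top

variable {Y Y' : Type*} [TopologicalSpace Y] [ChartedSpace ℂ Y] [IsManifold 𝓘(ℂ) ω Y]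
  [TopologicalSpace Y'] [ChartedSpace ℂ Y'] [IsManifold 𝓘(ℂ) ω Y']
  {ν : Y → Y'} {f : Y → EReal}

theorem continuous_tropicalTrace (hν : IsBranchedCovering ν) (hf : IsHarmonicWithLogPoles f) :
    Continuous (tropicalTrace ν f) := by
  refine continuous_iff_continuousAt.2 fun q => ?_
  obtain ⟨J, _, _, m, ρ, H, u, M, -⟩ := exists_isLocalModel hν hf q
  exact M.continuousAt_apply

theorem hasAtMostLogSingularityAt_tropicalTrace (hν : IsBranchedCovering ν)
    (hf : IsHarmonicWithLogPoles f) (q : Y') :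
    HasAtMostLogSingularityAt (tropicalTrace ν f) q := by
  obtain ⟨J, _, _, m, ρ, H, u, M, -⟩ := exists_isLocalModel hν hf q
  exact M.hasAtMostLogSingularityAt

theorem isSubharmonicOn_tropicalTrace [T1Space Y'] (hν : IsBranchedCovering ν)
    (hf : IsHarmonicWithLogPoles f) :
    IsSubharmonicOn (tropicalTrace ν f) (ν '' polNeg f)ᶜ := by
  have hcont := continuous_tropicalTrace hν hf
  have hlt : ∀ x ∈ (ν '' polNeg f)ᶜ, tropicalTrace ν f x < ⊤ := by
    intro q hq
    obtain ⟨J, _, _, m, ρ, H, u, M, -, hneg⟩ := exists_isLocalModel hν hf q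
    exact M.lt_top (hneg hq)
  refine ⟨hcont.upperSemicontinuous.upperSemicontinuousOn _, hlt, fun x hx => ?_, ?_⟩
  · obtain ⟨J, _, _, m, ρ, H, u, M, -⟩ := exists_isLocalModel hν hf x
    have hfin : (ν '' polNeg f).Finite := (hf.finite_pol.subset subset_union_left).image ν
    exact exists_mem_connectedComponentIn_ne_bot hfin.isClosed.isOpen_compl hx M.eventually_real
  · intro e he c R hR hsub hU h hh hharm hbd
    refine le_harmonic_of_maximum_principle hcont hlt (fun q hq k hk hle heq => ?_) he hR hsub hU hh
      hharm hbd
    obtain ⟨J, _, _, m, ρ, H, u, M, -, hneg⟩ := exists_isLocalModel hν hf q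
    exact M.eventually_eq_of_le (hneg hq) hk hle heq

theorem exists_hasArcsAt_nonHarmonicLocus (hν : IsBranchedCovering ν)
    (hf : IsHarmonicWithLogPoles f) (q : Y') :
    ∃ m B, HasArcsAt (nonHarmonicLocus (tropicalTrace ν f)) q m B := by
  obtain ⟨J, _, _, m, ρ, H, u, M, -⟩ := exists_isLocalModel hν hf q
  obtain ⟨B, hB, hev⟩ := M.exists_arcs
  exact ⟨m, B, M.ne_zero, hB, hev⟩

/-- Off the derived set the non-harmonic locus has at most an isolated point at `q`, and away from
the images of the poles such a point is removable. -/
theorem isHarmonicAt_tropicalTrace (hν : IsBranchedCovering ν) (hf : IsHarmonicWithLogPoles f)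
    {q : Y'} (hq : q ∉ ν '' pol f) (hqS : q ∉ derivedSet (nonHarmonicLocus (tropicalTrace ν f))) :
    IsHarmonicAt (tropicalTrace ν f) q := by
  obtain ⟨J, _, _, m, ρ, H, u, M, hpol, -⟩ := exists_isLocalModel hν hf q
  refine M.isHarmonicAt_of_isolated (hpol hq) ?_
  rw [mem_derivedSet, accPt_iff_frequently_nhdsNE, not_frequently] at hqS
  exact hqS.mono fun x hx => not_not.1 hx

end Trace

end TropicalTrace

theorem mainTheorem7
    {Y Y' : Type*}
    [TopologicalSpace Y] [T2Space Y] [ChartedSpace ℂ Y] [IsManifold 𝓘(ℂ) ω Y]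
    [TopologicalSpace Y'] [T2Space Y'] [ChartedSpace ℂ Y'] [IsManifold 𝓘(ℂ) ω Y']
    (ν : Y → Y') (hν : IsBranchedCovering ν)
    (f : Y → EReal) (hf : IsHarmonicWithLogPoles f) :
    -- real-valued, continuous and piecewise harmonic off the images of the poles
    (∀ z ∈ (ν '' pol f)ᶜ, tropicalTrace ν f z ≠ ⊥ ∧ tropicalTrace ν f z ≠ ⊤) ∧
    ContinuousOn (tropicalTrace ν f) (ν '' pol f)ᶜ ∧
    IsPiecewiseHarmonicOn (tropicalTrace ν f) (ν '' pol f)ᶜ ∧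
    -- subharmonic off the images of the poles with negative residue
    IsSubharmonicOn (tropicalTrace ν f) (ν '' polNeg f)ᶜ ∧
    -- at most logarithmic singularities
    (∀ z ∈ ν '' pol f, HasAtMostLogSingularityAt (tropicalTrace ν f) z) ∧
    -- the distributional Laplacian and its support
    IsLocallyIntegrableOn (tropicalTrace ν f) (ν '' polNeg f)ᶜ ∧
    ∃ (𝒞 : Set (Set Y')) (Q : Set Y'),
      (∀ C ∈ 𝒞, IsSemianalyticCurve C ∧ IsConnected C) ∧
      LocallyFinite (fun C : 𝒞 => (C : Set Y')) ∧
      IsSemianalyticCurve (⋃₀ 𝒞) ∧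
      (CompactSpace Y' → 𝒞.Finite) ∧
      Q.Finite ∧ Q ⊆ ν '' pol f ∧
      laplacianSupport (tropicalTrace ν f) ∩ (ν '' polNeg f)ᶜ ⊆ ⋃₀ 𝒞 ∪ Q := by
  have hcont := continuous_tropicalTrace hν hf
  have hT := isClosed_nonHarmonicLocus (tropicalTrace ν f)
  have harcs := exists_hasArcsAt_nonHarmonicLocus hν hf
  have hQ : (ν '' pol f).Finite := hf.finite_pol.image ν
  -- The non-harmonic locus may have isolated points at images of poles. The derived set removes
  -- them, so that `S` is of pure dimension one, and they are accounted for by `Q`.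
  set S := derivedSet (nonHarmonicLocus (tropicalTrace ν f)) with hS
  have hcurve : IsSemianalyticCurve S := isSemianalyticCurve_derivedSet hT harcs
  have hcomp : ∀ q ∈ S, ∀ᶠ x in 𝓝 q, x ∈ S → x ∈ connectedComponentIn S q :=
    fun q hq => connectedComponentIn_derivedSet_mem_nhds hT harcs hq
  have hlf := locallyFinite_connectedComponentIn hcurve.perfect.closed hcomp
  have hunion : ⋃₀ {C | ∃ x ∈ S, C = connectedComponentIn S x} = S := by
    ext x
    constructor
    · rintro ⟨_, ⟨y, -, rfl⟩, hx⟩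
      exact connectedComponentIn_subset _ _ hx
    · exact fun hx => ⟨_, ⟨x, hx, rfl⟩, mem_connectedComponentIn hx⟩
  refine ⟨fun z hz => ?_, hcont.continuousOn, ⟨S, hcurve, fun x hx => ?_, fun x hx => ?_⟩,
    isSubharmonicOn_tropicalTrace hν hf,
    fun z _ => hasAtMostLogSingularityAt_tropicalTrace hν hf z,
    isLocallyIntegrableOn_of_log hcont (hasAtMostLogSingularityAt_tropicalTrace hν hf) _,
    {C | ∃ x ∈ S, C = connectedComponentIn S x}, ν '' pol f, ?_, hlf, ?_, fun _ => ?_, hQ,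
    subset_rfl, ?_⟩
  · obtain ⟨J, _, _, m, ρ, H, u, M, hpol, -⟩ := exists_isLocalModel hν hf z
    have := (M.eventually_eq_maxLogHarm_of_zero (hpol hz)).self_of_nhds
    rw [powChart_zero z M.ne_zero] at this
    rw [this]
    exact ⟨EReal.coe_ne_bot _, EReal.coe_ne_top _⟩
  · exact isHarmonicAt_tropicalTrace hν hf hx.1 hx.2
  · obtain ⟨m, B, h⟩ := harcs x
    exact finite_connectedComponentIn_diff_derivedSet hT hQ.isClosed.isOpen_compl hx h
  · rintro _ ⟨x, hx, rfl⟩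
    exact ⟨hcurve.connectedComponentIn hcomp x, isConnected_connectedComponentIn_iff.2 hx⟩
  · rwa [hunion]
  -- A locally finite family of nonempty sets in a compact space is finite.
  · refine Set.finite_coe_iff.1 (Set.finite_univ_iff.1 (hlf.finite_of_compact ?_))
    rintro ⟨_, x, hx, rfl⟩
    exact ⟨x, mem_connectedComponentIn hx⟩
  · rintro x ⟨hx, -⟩
    rw [hunion]
    by_contra hcon
    rw [mem_union, not_or] at hcon
    exact notMem_laplacianSupport (isHarmonicAt_tropicalTrace hν hf hcon.2 hcon.1) hx
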